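/- **Setting.** Fix $\gamma>1$ and one of the two equation-of-state laws $\tilde\lambda(\chi)=\chi/(\gamma-1)$ (law (a)) or $\tilde\lambda(\chi)=1/(\chi\gamma-1)$ (law (b), i.e. $\tilde\gamma=\chi\gamma$); put $\tilde\gamma=1+1/\tilde\lambda$. Physical states are $V=(\rho,u,v,p,\chi)$, admissible if $\rho,p,\tilde\lambda(\chi)>0$; conserved states are $Q(V)=(\rho,\rho u,\rho v,\rho E,\rho\chi)$ with $\rho E=\tilde\lambda(\chi)p+\rho\kappa$, $\kappa=(u^2+v^2)/2$; for a unit vector $n$ the flux is, with $u_n=(u,v)\cdot n$, $$\mathbb F(V)\cdot n=\big(\rho u_n,\ \rho u u_n+pn_1,\ \rho v u_n+pn_2,\ u_n(\rho E+p),\ \rho\chi u_n\big).$$ The non-conservative form is $\partial_tV+A_V\partial_xV+B_V\partial_yV=0$, where $$A_V\xi=(u\xi_1+\rho\xi_2,\ u\xi_2+\xi_4/\rho,\ u\xi_3,\ \tilde\gamma p\,\xi_2+u\xi_4,\ u\xi_5),\quad B_V\xi=(v\xi_1+\rho\xi_3,\ v\xi_2,\ v\xi_3+\xi_4/\rho,\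 \tilde\gamma p\,\xi_3+v\xi_4,\ v\xi_5).$$ **Scheme.** The mesh consists of polygonal cells $\omega_i$ with disjoint interiors, each split without overlap into the triangles joining its barycenter (mean of its vertices) to its edges. In each cell the numerical solution $v_h^n$ at time $t^n$ is a polynomial in $(x,y)$ of degree $\le N$, and the predictor $\tilde v_h$ on $\omega_i\times[t^n,t^{n+1}]$ is a polynomial in $(x,y,t)$ of total degree $\le N$, both expanded in rescaled Taylor bases; $\varphi_k$ denotes the basis functions in space, $\Delta t=t^{n+1}-t^n$. The non-conservative scheme in cell $i$ is, for all $k$, $$\int_{\omega_i}\varphi_k\,(v_h^{n+1}-v_h^n)\,dx+\int_{t^n}^{t^{n+1}}\!\!\int_{\partial\omega_i}\varphi_k\,\mathsf D_n^-(\tilde v_h^+-\tilde v_h^-)\,dS\,dt+\int_{t^n}^{t^{n+1}}\!\!\int_{\omega_i}\varphi_k\,\big(A_V\partial_x\tilde v_h+B_V\partial_y\tilde v_h\big)\,dx\,dt=0,$$ where $\tilde v_h^-$, $\tilde v_h^+$ are the traces from $\omega_i$ and from the neighbouring cells, $\mathsf D_n^-=\int_0^1\big([A_V,B_V](\tilde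 v_h^-+s(\tilde v_h^+-\tilde v_h^-))\cdot n\big)^-ds$, and $(\cdot)^-$ is the negative part through the eigenvalue decomposition. The space integrals in the last two terms, and in $\Phi_i$ below, are evaluated by quadrature with nonnegative weights and with nodes in the cell, respectively on its edges: exact for polynomials of degree $\le N-1$ in each cell (of degree $0$ if $N=0$) and of degree $\le N$ on each edge. For a numerical flux $F_n(V^-,V^+)$ the conservation defect is $$\Delta_i^n=\frac1{|\omega_i|\Delta t}\Big(\int_{\omega_i}Q(v_h^{n+1})\,dx-\int_{\omega_i}Q(v_h^{n})\,dx\Big)+\frac{\Phi_i}{|\omega_i|},\qquad \Phi_i=\frac1{\Delta t}\int_{t^n}^{t^{n+1}}\!\!\int_{\partial\omega_i}F_n(\tilde v_h^-,\tilde v_h^+)\,dS\,dt .$$ **Claim.** There is a numerical flux $F$, depending only on $\gamma$ and the law, that is consistent ($F_n(V,V)=\mathbb F(V)\cdot n$), continuous across faces ($F_n(V,W)+F_{-n}(W,V)=0$) and Lipschitz in $(V,W)$ on compact sets of admissible states uniformly in $n$, with the following property. Let $\chi_1\ne\chi_2$ with $\tilde\lambda(\chi_1),\tilde\lambda(\chi_2)>0$,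 let $\epsilon,\sigma,M>0$, $C\in\mathbb R$, $N\ge 0$, and take a sequence of such computations of degree $N$ with mesh sizes $h\to0$ on shape-regular meshes (each cell contains a disc of radius $\sigma h$ and has perimeter $\le h/\sigma$), with $\Delta t\ge\sigma h$. On each mesh select a set $S$ of pairs $(i,n)$ such that every edge of $\omega_i$ is shared with a neighbouring cell, the scheme holds in cell $i$ for the step $n$, and there are a disc $B_i\supset\omega_i\cup\partial\omega_i$ centred at the barycenter of $\omega_i$ and constants $|u_0|,|v_0|\le M$, $1/M\le p_0\le M$ with $$|u-u_0|,\ |v-v_0|,\ |p-p_0|\le C h^{1+\epsilon},\qquad 1/M\le\rho\le M,\qquad \chi\text{ between }\chi_1\text{ and }\chi_2$$ in $B_i$ for $v_h^n$, for the predictor $\tilde v_h$ (at all times in $[t^n,t^{n+1}]$), and for the updated solution $v_h^{n+1}$. Then the scheme is quasi-conservative for mass, momentum and energy on $S$, that is, $$\sup_{(i,n)\in S}\big\|\big(\Delta_i^n\big)_{\rho,\rho u,\rho v,\rho E}\big\|\longrightarrow0\quad\text{as }h\to0,$$ in each of the following cases: 1. single material: for each $(i,n)\in S$, $\chi$ is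 constant in such a disc (in $v_h^n$, $\tilde v_h$ and $v_h^{n+1}$), with either law; 2. multi-material with law (a), $\tilde\lambda=\chi/(\gamma-1)$; 3. multi-material with law (b), $\tilde\gamma=\chi\gamma$, provided that for some $\delta>0$ and $C'$, for each $(i,n)\in S$, the values $\chi_h$ of the marker in such a disc (in $v_h^n$, $\tilde v_h$ and $v_h^{n+1}$) satisfy $$\Big|\frac1{\gamma\chi_h-1}-\frac{\varrho(\chi_h)}{\gamma-1}\Big|\le C'h^{1+\delta},\qquad \varrho(\chi)=\frac{\gamma-1}{\gamma_1-1}+(\gamma-1)\frac{\chi-\chi_1}{\chi_2-\chi_1}\Big(\frac1{\gamma_2-1}-\frac1{\gamma_1-1}\Big),\quad \gamma_j=\gamma\chi_j .$$ -/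

import Mathlib

open MeasureTheory Filter Topology
open scoped ENNReal

noncomputable section

namespace QCons

/-- Points of the plane `(x, y)`. -/
abbrev Pt : Type := ℝ × ℝ

/-- Five-component vectors.  A physical state is `V = (ρ, u, v, p, χ)`; a conserved state is
`Q = (ρ, ρu, ρv, ρE, ρχ)`. -/
abbrev State : Type := Fin 5 → ℝ

/-! ### Multi-material Euler equations -/

/-- The two equation-of-state laws: `linear` is `λ(χ) = χ / (γ - 1)`,
`ratio` is `λ(χ) = 1 / (γ χ - 1)`, that is `γ̃(χ) = χ γ`. -/
inductive EOS where
  | linear : EOS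
  | ratio : EOS

/-- The function `λ̃(χ) = 1 / (γ̃(χ) - 1)`. -/
def lam (γ : ℝ) : EOS → ℝ → ℝ
  | EOS.linear, χ => χ / (γ - 1)
  | EOS.ratio, χ => 1 / (χ * γ - 1)

/-- The adiabatic index `γ̃(χ)`, from `λ̃ = 1 / (γ̃ - 1)`. -/
def gammaTilde (γ : ℝ) (eos : EOS) (χ : ℝ) : ℝ := 1 + 1 / lam γ eos χ

/-- Admissible physical states: `ρ > 0`, `p > 0` and `λ̃(χ) > 0` (i.e. `γ̃(χ) > 1`). -/
def Admissible (γ : ℝ) (eos : EOS) (V : State) : Prop :=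
  0 < V 0 ∧ 0 < V 3 ∧ 0 < lam γ eos (V 4)

/-- Kinetic energy `κ = u²/2 + v²/2`. -/
def kinetic (V : State) : ℝ := V 1 ^ 2 / 2 + V 2 ^ 2 / 2

/-- Total energy density: `ρE = λ̃(χ) p + ρ κ`, i.e. `p = (γ̃ - 1)(ρE - ρκ)`. -/
def totalEnergy (γ : ℝ) (eos : EOS) (V : State) : ℝ :=
  lam γ eos (V 4) * V 3 + V 0 * kinetic V

/-- The conserved variables as functions of the physical ones. -/
def consVar (γ : ℝ) (eos : EOS) (V : State) : State :=
  ![V 0, V 0 * V 1, V 0 * V 2, totalEnergy γ eos V, V 0 * V 4]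

/-- The normal velocity. -/
def normalVel (V : State) (n : Pt) : ℝ := V 1 * n.1 + V 2 * n.2

/-- The conservative flux in direction `n`. -/
def physFlux (γ : ℝ) (eos : EOS) (V : State) (n : Pt) : State :=
  ![V 0 * normalVel V n,
    V 0 * V 1 * normalVel V n + V 3 * n.1,
    V 0 * V 2 * normalVel V n + V 3 * n.2,
    normalVel V n * (totalEnergy γ eos V + V 3),
    V 0 * V 4 * normalVel V n]

/-- The matrix `A_V` of the non-conservative form. -/
def matA (γ : ℝ) (eos : EOS) (V : State) : Matrix (Fin 5) (Fin 5) ℝ :=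
  !![V 1, V 0, 0, 0, 0;
     0, V 1, 0, 1 / V 0, 0;
     0, 0, V 1, 0, 0;
     0, gammaTilde γ eos (V 4) * V 3, 0, V 1, 0;
     0, 0, 0, 0, V 1]

/-- The matrix `B_V` of the non-conservative form. -/
def matB (γ : ℝ) (eos : EOS) (V : State) : Matrix (Fin 5) (Fin 5) ℝ :=
  !![V 2, 0, V 0, 0, 0;
     0, V 2, 0, 0, 0;
     0, 0, V 2, 1 / V 0, 0;
     0, 0, gammaTilde γ eos (V 4) * V 3, V 2, 0;
     0, 0, 0, 0, V 2]

/-- `[A_V, B_V] · n`. -/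
def matN (γ : ℝ) (eos : EOS) (V : State) (n : Pt) : Matrix (Fin 5) (Fin 5) ℝ :=
  n.1 • matA γ eos V + n.2 • matB γ eos V

/-- `R` is the negative part of `M` computed through a real eigenvalue decomposition
`M = P diag(d) P⁻¹`, namely `R = P diag(min(d, 0)) P⁻¹`. -/
def IsNegPart (M R : Matrix (Fin 5) (Fin 5) ℝ) : Prop :=
  ∃ (P : Matrix (Fin 5) (Fin 5) ℝ) (d : Fin 5 → ℝ), IsUnit P.det ∧
    M = P * Matrix.diagonal d * P⁻¹ ∧
    R = P * Matrix.diagonal (fun a => min (d a) 0) * P⁻¹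

open scoped Classical in
/-- The negative part of a matrix diagonalizable over `ℝ` (it does not depend on the
decomposition used). -/
def matNeg (M : Matrix (Fin 5) (Fin 5) ℝ) : Matrix (Fin 5) (Fin 5) ℝ :=
  if hM : ∃ R, IsNegPart M R then hM.choose else 0

/-- The segment path between two states. -/
def path (Vm Vp : State) (s : ℝ) : State := Vm + s • (Vp - Vm)

/-- The path-averaged matrix `D_n⁻ = ∫₀¹ ([A_V, B_V](path(s)) · n)⁻ ds`. -/
def matD (γ : ℝ) (eos : EOS) (n : Pt) (Vm Vp : State) : Matrix (Fin 5) (Fin 5) ℝ :=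
  Matrix.of fun a b => ∫ s in (0 : ℝ)..1, matNeg (matN γ eos (path Vm Vp s) n) a b

/-- The face fluctuation `D · n = D_n⁻ (V⁺ - V⁻)`. -/
def fluctuation (γ : ℝ) (eos : EOS) (n : Pt) (Vm Vp : State) : State :=
  (matD γ eos n Vm Vp).mulVec (Vp - Vm)

/-- Two-point numerical fluxes `F_n(V⁻, V⁺)`, giving five conserved components. -/
abbrev NumFlux : Type := Pt → State → State → State

/-- Unit vectors of the plane, for the Euclidean norm. -/
def IsUnitVec (n : Pt) : Prop := n.1 ^ 2 + n.2 ^ 2 = 1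

/-- The classical assumptions on a numerical flux: consistency with the physical flux, continuity
across a face (what leaves one side enters the other), and Lipschitz continuity on every compact
set of admissible states, uniformly in the direction. -/
structure IsNumericalFlux (γ : ℝ) (eos : EOS) (F : NumFlux) : Prop where
  consistent : ∀ n V, IsUnitVec n → Admissible γ eos V → F n V V = physFlux γ eos V n
  face : ∀ n V W, IsUnitVec n → Admissible γ eos V → Admissible γ eos W →
    F n V W + F (-n) W V = 0
  lipschitz : ∀ K : Set State, IsCompact K → (∀ V ∈ K, Admissible γ eos V) →
    ∃ L : ℝ, ∀ n, IsUnitVec n → ∀ V ∈ K, ∀ W ∈ K, ∀ V' ∈ K, ∀ W' ∈ K,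
      ‖F n V W - F n V' W'‖ ≤ L * (‖V - V'‖ + ‖W - W'‖)

/-! ### Geometry -/

/-- The open Euclidean disc. -/
def disc (c : Pt) (r : ℝ) : Set Pt := {x | (x.1 - c.1) ^ 2 + (x.2 - c.2) ^ 2 < r ^ 2}

/-- Arithmetic mean of a list of `m + 3` points. -/
def barycenter {m : ℕ} (vert : Fin (m + 3) → Pt) : Pt :=
  ((m : ℝ) + 3)⁻¹ • ∑ k, vert k

/-- Twice the signed area of the triangle `a b c`. -/
def orient (a b c : Pt) : ℝ := (b.1 - a.1) * (c.2 - a.2) - (b.2 - a.2) * (c.1 - a.1)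

/-- The triangle joining the barycenter to the `k`-th edge.  Indices in `Fin (m + 3)` are cyclic, so
that the last vertex is followed by the first one. -/
def subTriangle {m : ℕ} (vert : Fin (m + 3) → Pt) (k : Fin (m + 3)) : Set Pt :=
  convexHull ℝ {barycenter vert, vert k, vert (k + 1)}

/-- A polygonal cell with `m + 3` vertices in counterclockwise order, split without overlap into
the triangles that join its barycenter to its edges. -/
structure Polygon where
  m : ℕ
  vert : Fin (m + 3) → Pt
  pos : ∀ k, 0 < orient (barycenter vert) (vert k) (vert (k + 1))
  nonoverlap : Pairwise fun k l =>
    Disjoint (interior (subTriangle vert k)) (interior (subTriangle vert l))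

namespace Polygon

variable (P : Polygon)

/-- The cell barycenter. -/
def bary : Pt := barycenter P.vert

/-- The closed cell. -/
def region : Set Pt := ⋃ k, subTriangle P.vert k

/-- The area of the cell. -/
def area : ℝ := (volume P.region).toReal

/-- The length of the `k`-th edge. -/
def edgeLen (k : Fin (P.m + 3)) : ℝ :=
  Real.sqrt (((P.vert (k + 1)).1 - (P.vert k).1) ^ 2 + ((P.vert (k + 1)).2 - (P.vert k).2) ^ 2)

/-- The perimeter of the cell. -/
def perimeter : ℝ := ∑ k, P.edgeLen k

/-- The outward unit normal of the `k`-th edge. -/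
def normal (k : Fin (P.m + 3)) : Pt :=
  (((P.vert (k + 1)).2 - (P.vert k).2) / P.edgeLen k,
    -((P.vert (k + 1)).1 - (P.vert k).1) / P.edgeLen k)

/-- The point with parameter `s ∈ [0, 1]` on the `k`-th edge. -/
def edgePoint (k : Fin (P.m + 3)) (s : ℝ) : Pt := P.vert k + s • (P.vert (k + 1) - P.vert k)

/-- The characteristic length of the cell: its radius of gyration. -/
def size : ℝ :=
  1 / Real.sqrt P.area *
    Real.sqrt (∫ x in P.region, ((x.1 - P.bary.1) ^ 2 + (x.2 - P.bary.2) ^ 2))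

/-- The rescaled Taylor basis function with exponents `ℓ = (p, q)`. -/
def basis (ℓ : ℕ × ℕ) (x : Pt) : ℝ :=
  ((x.1 - P.bary.1) / P.size) ^ ℓ.1 * ((x.2 - P.bary.2) / P.size) ^ ℓ.2

end Polygon

/-- A polygonal tessellation: cells with disjoint interiors, and for each edge of each cell
the cell on the other side, if there is one. -/
structure Mesh where
  Cell : Type
  poly : Cell → Polygon
  disjoint : Pairwise fun i j =>
    Disjoint (interior (poly i).region) (interior (poly j).region)
  nbr : (i : Cell) → Fin ((poly i).m + 3) → Option Cell
  nbr_iff : ∀ i k j, nbr i k = some j ↔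
    ∃ l, (poly j).vert l = (poly i).vert (k + 1) ∧ (poly j).vert (l + 1) = (poly i).vert k

/-- Shape regularity at mesh size `h`: each cell contains a disc of radius `σ h` and has
perimeter at most `h / σ`. -/
def Mesh.ShapeRegular (T : Mesh) (h σ : ℝ) : Prop :=
  ∀ i, (∃ c, disc c (σ * h) ⊆ (T.poly i).region) ∧ (T.poly i).perimeter ≤ h / σ

/-! ### Quadrature -/

/-- A quadrature rule: nodes and weights. -/
structure QuadRule (α : Type) where
  size : ℕ
  node : Fin size → α
  weight : Fin size → ℝ

/-- The value of a quadrature rule on a function. -/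
def QuadRule.eval {α : Type} (q : QuadRule α) (f : α → ℝ) : ℝ :=
  ∑ a, q.weight a * f (q.node a)

/-- Quadrature in a cell: nodes in the cell, nonnegative weights, and exactness for all
polynomials in two variables of total degree at most `d`. -/
structure CellRuleExact (P : Polygon) (q : QuadRule Pt) (d : ℕ) : Prop where
  node_mem : ∀ a, q.node a ∈ P.region
  weight_nonneg : ∀ a, 0 ≤ q.weight a
  exact : ∀ a b : ℕ, a + b ≤ d →
    q.eval (fun x => x.1 ^ a * x.2 ^ b) = ∫ x in P.region, x.1 ^ a * x.2 ^ b

/-- Quadrature on the reference edge `[0, 1]`: nodes in it, nonnegative weights, and exactness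
for all polynomials of degree at most `d`. -/
structure EdgeRuleExact (q : QuadRule ℝ) (d : ℕ) : Prop where
  node_mem : ∀ a, q.node a ∈ Set.Icc (0 : ℝ) 1
  weight_nonneg : ∀ a, 0 ≤ q.weight a
  exact : ∀ a : ℕ, a ≤ d → q.eval (fun s => s ^ a) = ∫ s in (0 : ℝ)..1, s ^ a

/-! ### The discrete solution and the scheme -/

/-- Exponents `(p, q)` with `p + q ≤ N`. -/
def idx2 (N : ℕ) : Finset (ℕ × ℕ) :=
  (Finset.range (N + 1) ×ˢ Finset.range (N + 1)).filter fun ℓ => ℓ.1 + ℓ.2 ≤ N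

/-- Exponents `((p, q), r)` with `p + q + r ≤ N`. -/
def idx3 (N : ℕ) : Finset ((ℕ × ℕ) × ℕ) :=
  (idx2 N ×ˢ Finset.range (N + 1)).filter fun ℓ => ℓ.1.1 + ℓ.1.2 + ℓ.2 ≤ N

/-- The data of a computation of degree `N` on one mesh: mesh size, time levels, quadrature
rules, and the expansion coefficients of the numerical solution at each time level and of the
space-time predictor in each time slab. -/
structure Discretization (N : ℕ) where
  mesh : Mesh
  h : ℝ
  time : ℕ → ℝ
  cellRule : mesh.Cell → QuadRule Pt
  edgeRule : QuadRule ℝ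
  solCoef : ℕ → mesh.Cell → ℕ × ℕ → State
  predCoef : ℕ → mesh.Cell → (ℕ × ℕ) × ℕ → State

namespace Discretization

variable {N : ℕ} (D : Discretization N)

/-- The `n`-th time step. -/
def dt (n : ℕ) : ℝ := D.time (n + 1) - D.time n

/-- The numerical solution of cell `i` at time level `n`. -/
def sol (n : ℕ) (i : D.mesh.Cell) (x : Pt) : State :=
  fun c => ∑ ℓ ∈ idx2 N, (D.mesh.poly i).basis ℓ x * D.solCoef n i ℓ c

/-- The space-time predictor of cell `i` in the `n`-th time slab. -/
def pred (n : ℕ) (i : D.mesh.Cell) (x : Pt) (t : ℝ) : State :=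
  fun c => ∑ ℓ ∈ idx3 N, (D.mesh.poly i).basis ℓ.1 x *
    ((t - D.time n) / (D.mesh.poly i).size) ^ ℓ.2 * D.predCoef n i ℓ c

/-- The outer trace on the `k`-th edge of cell `i`: the predictor of the neighbouring cell
(and, by convention, the inner predictor if the edge lies on the boundary of the domain). -/
def outer (n : ℕ) (i : D.mesh.Cell) (k : Fin ((D.mesh.poly i).m + 3)) (x : Pt) (t : ℝ) : State :=
  D.pred n ((D.mesh.nbr i k).getD i) x t

/-- The non-conservative product `H(ṽ) = A_V ∂ₓṽ + B_V ∂ᵧṽ` in cell `i`. -/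
def nonCons (γ : ℝ) (eos : EOS) (n : ℕ) (i : D.mesh.Cell) (x : Pt) (t : ℝ) : State :=
  (matA γ eos (D.pred n i x t)).mulVec
      (fun c => deriv (fun s => D.pred n i (s, x.2) t c) x.1) +
    (matB γ eos (D.pred n i x t)).mulVec
      (fun c => deriv (fun s => D.pred n i (x.1, s) t c) x.2)

/-- Numerical integration over the boundary of cell `i`; the integrand depends on the edge and on
the point. -/
def bdryQuad (i : D.mesh.Cell) (f : Fin ((D.mesh.poly i).m + 3) → Pt → ℝ) : ℝ :=
  ∑ k, (D.mesh.poly i).edgeLen k * D.edgeRule.eval (fun s => f k ((D.mesh.poly i).edgePoint k s))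

/-- The path-integrated ADER-DG corrector in cell `i` for the `n`-th step, tested against every
basis function, componentwise. -/
def SatisfiesDG (γ : ℝ) (eos : EOS) (n : ℕ) (i : D.mesh.Cell) : Prop :=
  ∀ a ∈ idx2 N, ∀ c : Fin 5,
    (∑ ℓ ∈ idx2 N,
      (∫ x in (D.mesh.poly i).region, (D.mesh.poly i).basis a x * (D.mesh.poly i).basis ℓ x) *
        (D.solCoef (n + 1) i ℓ c - D.solCoef n i ℓ c)) +
    (∫ t in (D.time n)..(D.time (n + 1)),
      D.bdryQuad i (fun k x => (D.mesh.poly i).basis a x *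
        fluctuation γ eos ((D.mesh.poly i).normal k) (D.pred n i x t) (D.outer n i k x t) c)) +
    (∫ t in (D.time n)..(D.time (n + 1)),
      (D.cellRule i).eval (fun x => (D.mesh.poly i).basis a x * D.nonCons γ eos n i x t c)) = 0

/-- The time-averaged flux balance `Φ_i` of cell `i`. -/
def fluxBalance (F : NumFlux) (n : ℕ) (i : D.mesh.Cell) : State := fun c =>
  1 / D.dt n * ∫ t in (D.time n)..(D.time (n + 1)),
    D.bdryQuad i (fun k x =>
      F ((D.mesh.poly i).normal k) (D.pred n i x t) (D.outer n i k x t) c)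

/-- The cell average of the conserved variables at time level `n`. -/
def consAverage (γ : ℝ) (eos : EOS) (n : ℕ) (i : D.mesh.Cell) : State := fun c =>
  1 / (D.mesh.poly i).area * ∫ x in (D.mesh.poly i).region, consVar γ eos (D.sol n i x) c

/-- The conservation defect of cell `i` in the `n`-th step:
`Δ = (q̄ⁿ⁺¹ - q̄ⁿ) / Δt + Φ / |ω|`. -/
def defect (γ : ℝ) (eos : EOS) (F : NumFlux) (n : ℕ) (i : D.mesh.Cell) : State := fun c =>
  (D.consAverage γ eos (n + 1) i c - D.consAverage γ eos n i c) / D.dt n +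
    D.fluxBalance F n i c / (D.mesh.poly i).area

/-- The property `R` of states holds in a disc centred at the barycenter of cell `i` that contains
the closed cell, for the solution at both time levels and for the predictor of the `n`-th slab, in
every cell that meets the disc. -/
def HoldsAround (n : ℕ) (i : D.mesh.Cell) (R : State → Prop) : Prop :=
  ∃ r : ℝ, (D.mesh.poly i).region ⊆ disc (D.mesh.poly i).bary r ∧
    ∀ j, ∀ x ∈ (D.mesh.poly j).region ∩ disc (D.mesh.poly i).bary r,
      R (D.sol n j x) ∧ R (D.sol (n + 1) j x) ∧
        ∀ t ∈ Set.Icc (D.time n) (D.time (n + 1)), R (D.pred n j x t)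

end Discretization

/-- The state has velocity and pressure equal to `(u₀, v₀)` and `p₀` up to the error `e`, density
between `1/M` and `M`, and marker between `χ₁` and `χ₂`. -/
def NearContact (χ₁ χ₂ M e u₀ v₀ p₀ : ℝ) (V : State) : Prop :=
  |V 1 - u₀| ≤ e ∧ |V 2 - v₀| ≤ e ∧ |V 3 - p₀| ≤ e ∧
    1 / M ≤ V 0 ∧ V 0 ≤ M ∧ V 4 ∈ Set.uIcc χ₁ χ₂

/-- The standing hypotheses on a sequence `D` of computations with mesh size tending to zero, at
the selected pairs `S` of a cell and a time step.  The constants `σ`, `C`, `M` are uniform. -/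
structure ContactSetting (γ : ℝ) (eos : EOS) (χ₁ χ₂ ε σ C M : ℝ) {N : ℕ}
    (D : ℕ → Discretization N) (S : ∀ k, Set ((D k).mesh.Cell × ℕ)) : Prop where
  h_pos : ∀ k, 0 < (D k).h
  h_lim : Tendsto (fun k => (D k).h) atTop (𝓝 0)
  shape : ∀ k, (D k).mesh.ShapeRegular (D k).h σ
  step : ∀ k n, σ * (D k).h ≤ (D k).dt n
  cell_quad : ∀ k i, CellRuleExact ((D k).mesh.poly i) ((D k).cellRule i) (N - 1)
  edge_quad : ∀ k, EdgeRuleExact (D k).edgeRule N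
  has_nbr : ∀ k, ∀ s ∈ S k, ∀ e, ((D k).mesh.nbr s.1 e).isSome
  scheme : ∀ k, ∀ s ∈ S k, (D k).SatisfiesDG γ eos s.2 s.1
  contact : ∀ k, ∀ s ∈ S k, ∃ u₀ v₀ p₀ : ℝ, |u₀| ≤ M ∧ |v₀| ≤ M ∧ 1 / M ≤ p₀ ∧ p₀ ≤ M ∧
    (D k).HoldsAround s.2 s.1 (NearContact χ₁ χ₂ M (C * (D k).h ^ (1 + ε)) u₀ v₀ p₀)

/-- Single-material flow: the marker is constant around each selected cell. -/
def SingleMaterial {N : ℕ} (D : ℕ → Discretization N) (S : ∀ k, Set ((D k).mesh.Cell × ℕ)) :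
    Prop :=
  ∀ k, ∀ s ∈ S k, ∃ χ₀ : ℝ, (D k).HoldsAround s.2 s.1 (fun V => V 4 = χ₀)

/-- The affine map `ϱ(χ)` passing from the linear law to the ratio law, with `γ_j = γ χ_j`. -/
def linkMap (γ χ₁ χ₂ χ : ℝ) : ℝ :=
  (γ - 1) / (γ * χ₁ - 1) +
    (γ - 1) * ((χ - χ₁) / (χ₂ - χ₁)) * (1 / (γ * χ₂ - 1) - 1 / (γ * χ₁ - 1))

/-- The compatibility `1/(γχ - 1) - ϱ(χ)/(γ - 1) = O(h^(1+δ))` around the selected cells. -/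
def Compatible (γ χ₁ χ₂ δ C : ℝ) {N : ℕ} (D : ℕ → Discretization N)
    (S : ∀ k, Set ((D k).mesh.Cell × ℕ)) : Prop :=
  ∀ k, ∀ s ∈ S k, (D k).HoldsAround s.2 s.1 (fun V =>
    |1 / (γ * V 4 - 1) - linkMap γ χ₁ χ₂ (V 4) / (γ - 1)| ≤ C * (D k).h ^ (1 + δ))

/-- Quasi-conservation of mass, momentum and energy (components `0, 1, 2, 3`): with the numerical
flux `F`, the supremum over the selected cells and steps of the conservation defect tends to zero
with the mesh size. -/
def QuasiConservative (γ : ℝ) (eos : EOS) (F : NumFlux) {N : ℕ}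
    (D : ℕ → Discretization N) (S : ∀ k, Set ((D k).mesh.Cell × ℕ)) : Prop :=
  Tendsto (fun k => ⨆ s ∈ S k, ⨆ c : Fin 4, ‖(D k).defect γ eos F s.2 s.1 c.castSucc‖ₑ)
    atTop (𝓝 0)

end QCons

end

/-!
A flow that is near a material contact has velocity and pressure equal to constants `u₀, v₀, p₀` up
to `e = o(h)`.  There the nonlinear conserved variables are, up to `O(e)`, affine functions of the
density and the marker with constant coefficients (`contactCons`, `consVar_near`): momentum is
`(u₀, v₀) ρ`, and the energy is `κ₀ ρ + p₀ λ(χ)`, where `λ(χ)` is affine in `χ` up to `O(e)` in each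
of the three cases of the theorem.  Conservation of mass, momentum and energy therefore follows from
the evolution of the cell means of `ρ` and `χ`, that is, from two components of the scheme tested
with the constant function.

For these two components the scheme is, up to errors, the upwind scheme for transport with the
constant velocity `(u₀, v₀)` (`Discretization.CellContact.abs_increment_add_le`).  The rows of the
negative part of the Euler matrix that they involve are explicit (`matNeg_matN_density`,
`matNeg_matN_marker`), so the fluctuation is `min (u₀ · n) 0` times the jump, up to `O(e)`.  In the
volume term the inverse inequality (`exists_isInverseConstant`) bounds the gradients of velocity and
pressure by `O(e / h)` and those of density and marker by `O(1 / h)`; what remains is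
`u₀ ∂ₓ + v₀ ∂ᵧ` of the predictor, which the quadrature rules integrate exactly and which the
divergence theorem on the cell turns into a boundary term
(`Discretization.eval_grad_eq_bdryQuad`).

The numerical flux `upwindFlux` upwinds the conserved variables with the mean normal velocity of the
two states and adds the pressure terms at the mean pressure.  Near a contact it is the same upwind
flux of `contactCons`, plus constant vectors whose quadrature over the closed boundary of the cell
vanishes (`Discretization.bdryQuad_normal`).  Increments and fluxes then cancel up to
`O(e / h)` times `|ω| Δt`, which bounds the defect by a constant multiple of `e / h`
(`Discretization.CellContact.abs_defect_le`).
-/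

namespace QCons

/-! ### Polynomials in the plane -/

/-- The space of polynomial functions on the plane of total degree at most `d`. -/
def polySpace (d : ℕ) : Submodule ℝ (Pt → ℝ) :=
  Submodule.span ℝ {f | ∃ a b : ℕ, a + b ≤ d ∧ f = fun x => x.1 ^ a * x.2 ^ b}

/-- The partial derivative in the first variable. -/
noncomputable def dx (f : Pt → ℝ) (x : Pt) : ℝ := deriv (fun s => f (s, x.2)) x.1

/-- The partial derivative in the second variable. -/
noncomputable def dy (f : Pt → ℝ) (x : Pt) : ℝ := deriv (fun s => f (x.1, s)) x.2

theorem monomial_mem_polySpace {a b d : ℕ} (h : a + b ≤ d) :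
    (fun x : Pt => x.1 ^ a * x.2 ^ b) ∈ polySpace d :=
  Submodule.subset_span ⟨a, b, h, rfl⟩

theorem polySpace_mono {d e : ℕ} (h : d ≤ e) : polySpace d ≤ polySpace e := by
  refine Submodule.span_mono ?_
  rintro f ⟨a, b, hab, rfl⟩
  exact ⟨a, b, hab.trans h, rfl⟩

theorem const_mem_polySpace (c : ℝ) (d : ℕ) : (fun _ : Pt => c) ∈ polySpace d := by
  have h := (polySpace d).smul_mem c (monomial_mem_polySpace (a := 0) (b := 0) (Nat.zero_le d))
  convert h using 1
  ext x
  simp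

theorem mul_mem_polySpace {f g : Pt → ℝ} {d e : ℕ} (hf : f ∈ polySpace d) (hg : g ∈ polySpace e) :
    f * g ∈ polySpace (d + e) := by
  have h := Submodule.mul_mem_mul hf hg
  rw [polySpace, polySpace, Submodule.span_mul_span] at h
  refine (Submodule.span_mono ?_) h
  rintro _ ⟨_, ⟨a, b, hab, rfl⟩, _, ⟨a', b', hab', rfl⟩, rfl⟩
  refine ⟨a + a', b + b', by omega, ?_⟩
  ext x
  simp only [Pi.mul_apply]
  ring

theorem pow_mem_polySpace {f : Pt → ℝ} (hf : f ∈ polySpace 1) (p : ℕ) :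
    f ^ p ∈ polySpace p := by
  induction p with
  | zero => exact const_mem_polySpace 1 0
  | succ p ih => rw [pow_succ]; exact mul_mem_polySpace ih hf

theorem polySpace_contDiff {f : Pt → ℝ} {d : ℕ} (hf : f ∈ polySpace d) : ContDiff ℝ 1 f := by
  induction hf using Submodule.span_induction with
  | mem f h => obtain ⟨a, b, -, rfl⟩ := h; fun_prop
  | zero => exact contDiff_const
  | add f g _ _ hf hg => exact hf.add hg
  | smul c f _ hf => exact contDiff_const.smul hf

theorem polySpace_continuous {f : Pt → ℝ} {d : ℕ} (hf : f ∈ polySpace d) : Continuous f :=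
  (polySpace_contDiff hf).continuous

theorem hasDerivAt_dx {f : Pt → ℝ} (hf : ContDiff ℝ 1 f) (x : Pt) :
    HasDerivAt (fun s => f (s, x.2)) (dx f x) x.1 := by
  have h : DifferentiableAt ℝ f (x.1, x.2) := (hf.differentiable one_ne_zero) _
  have h2 : DifferentiableAt ℝ (fun s : ℝ => f (s, x.2)) x.1 :=
    DifferentiableAt.comp (g := f) (f := fun s : ℝ => (s, x.2)) x.1 h (by fun_prop)
  exact h2.hasDerivAt

theorem hasDerivAt_dy {f : Pt → ℝ} (hf : ContDiff ℝ 1 f) (x : Pt) :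
    HasDerivAt (fun s => f (x.1, s)) (dy f x) x.2 := by
  have h : DifferentiableAt ℝ f (x.1, x.2) := (hf.differentiable one_ne_zero) _
  have h2 : DifferentiableAt ℝ (fun s : ℝ => f (x.1, s)) x.2 :=
    DifferentiableAt.comp (g := f) (f := fun s : ℝ => (x.1, s)) x.2 h (by fun_prop)
  exact h2.hasDerivAt

theorem dx_mem_polySpace {f : Pt → ℝ} {d : ℕ} (hf : f ∈ polySpace d) :
    dx f ∈ polySpace (d - 1) := by
  have key : ∃ g ∈ polySpace (d - 1), ∀ x : Pt, HasDerivAt (fun s => f (s, x.2)) (g x) x.1 := by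
    induction hf using Submodule.span_induction with
    | mem f h =>
      obtain ⟨a, b, hab, rfl⟩ := h
      refine ⟨(a : ℝ) • fun x : Pt => x.1 ^ (a - 1) * x.2 ^ b, ?_, fun x => ?_⟩
      · rcases Nat.eq_zero_or_pos a with rfl | ha
        · simp
        · exact Submodule.smul_mem _ _ (monomial_mem_polySpace (by omega))
      · have := (hasDerivAt_pow a x.1).mul_const (x.2 ^ b)
        exact this.congr_deriv (mul_assoc (a : ℝ) (x.1 ^ (a - 1)) (x.2 ^ b))
    | zero => exact ⟨0, Submodule.zero_mem _, fun x => hasDerivAt_const _ _⟩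
    | add f g _ _ hf hg =>
      obtain ⟨f', hf', h1⟩ := hf
      obtain ⟨g', hg', h2⟩ := hg
      exact ⟨f' + g', Submodule.add_mem _ hf' hg', fun x => (h1 x).add (h2 x)⟩
    | smul c f _ hf =>
      obtain ⟨f', hf', h1⟩ := hf
      exact ⟨c • f', Submodule.smul_mem _ _ hf', fun x => (h1 x).const_smul c⟩
  obtain ⟨g, hg, h⟩ := key
  have : dx f = g := funext fun x => (h x).deriv
  rwa [this]

theorem comp_swap_mem_polySpace {f : Pt → ℝ} {d : ℕ} (hf : f ∈ polySpace d) :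
    (fun x : Pt => f (x.2, x.1)) ∈ polySpace d := by
  induction hf using Submodule.span_induction with
  | mem f h =>
    obtain ⟨a, b, hab, rfl⟩ := h
    refine Submodule.subset_span ⟨b, a, by omega, ?_⟩
    ext x
    ring
  | zero => exact Submodule.zero_mem _
  | add f g _ _ hf hg => exact Submodule.add_mem _ hf hg
  | smul c f _ hf => exact Submodule.smul_mem _ c hf

theorem dy_mem_polySpace {f : Pt → ℝ} {d : ℕ} (hf : f ∈ polySpace d) :
    dy f ∈ polySpace (d - 1) :=
  comp_swap_mem_polySpace (dx_mem_polySpace (comp_swap_mem_polySpace hf))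

/-- Along a line, a polynomial of total degree at most `d` is a polynomial of degree at most `d` in
the parameter. -/
theorem polySpace_line {f : Pt → ℝ} {d : ℕ} (hf : f ∈ polySpace d) (a v : Pt) :
    ∃ P : Polynomial ℝ, P.natDegree ≤ d ∧ ∀ s, f (a + s • v) = P.eval s := by
  induction hf using Submodule.span_induction with
  | mem f h =>
    obtain ⟨p, q, hpq, rfl⟩ := h
    refine ⟨(Polynomial.C v.1 * Polynomial.X + Polynomial.C a.1) ^ p *
      (Polynomial.C v.2 * Polynomial.X + Polynomial.C a.2) ^ q, ?_, fun s => ?_⟩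
    · refine Polynomial.natDegree_mul_le.trans ?_
      have h1 := Polynomial.natDegree_pow_le_of_le p
        (Polynomial.natDegree_linear_le (a := v.1) (b := a.1))
      have h2 := Polynomial.natDegree_pow_le_of_le q
        (Polynomial.natDegree_linear_le (a := v.2) (b := a.2))
      omega
    · simp only [Prod.fst_add, Prod.snd_add, Prod.smul_fst, Prod.smul_snd, smul_eq_mul,
        Polynomial.eval_mul, Polynomial.eval_pow, Polynomial.eval_add, Polynomial.eval_C,
        Polynomial.eval_X]
      ring
  | zero => exact ⟨0, by simp, by simp⟩
  | add f g _ _ hf hg =>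
    obtain ⟨P, hP, h1⟩ := hf
    obtain ⟨Q, hQ, h2⟩ := hg
    exact ⟨P + Q, Polynomial.natDegree_add_le_of_degree_le hP hQ, fun s => by simp [h1, h2]⟩
  | smul c f _ hf =>
    obtain ⟨P, hP, h1⟩ := hf
    exact ⟨Polynomial.C c * P, (Polynomial.natDegree_C_mul_le c P).trans hP, fun s => by simp [h1]⟩

/-! ### Inverse inequality -/

/-- Bounds on `[-1/2, 1/2]` extend to `[-R, R]`, for the values and the derivative, with a constant
that depends only on the degree and on `R`. -/
theorem exists_polynomial_bound (N : ℕ) (R : ℝ) : ∃ K : ℝ, 0 ≤ K ∧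
    ∀ p : Polynomial ℝ, p.natDegree ≤ N → ∀ e, (∀ s, |s| ≤ 1 / 2 → |p.eval s| ≤ e) →
      ∀ x, |x| ≤ R → |p.eval x| ≤ K * e ∧ |p.derivative.eval x| ≤ K * e := by
  classical
  set v : Fin (N + 1) → ℝ := fun j => (j : ℝ) / (2 * ((N : ℝ) + 1)) with hv
  have hN : (0 : ℝ) < 2 * ((N : ℝ) + 1) := by positivity
  have hinj : Set.InjOn v (Finset.univ : Finset (Fin (N + 1))) := by
    intro i _ j _ hij
    have h2 := (div_left_inj' hN.ne').1 hij
    exact Fin.ext (by exact_mod_cast h2)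
  have hbd : ∀ q : Polynomial ℝ, ∃ B : ℝ, ∀ x, |x| ≤ R → |q.eval x| ≤ B := by
    intro q
    obtain ⟨B, hB⟩ := (isCompact_Icc (a := -R) (b := R)).exists_bound_of_continuousOn
      (f := fun x => q.eval x) q.continuous.continuousOn
    exact ⟨B, fun x hx => by simpa using hB x (abs_le.1 hx)⟩
  set L : Fin (N + 1) → Polynomial ℝ := fun j => Lagrange.basis Finset.univ v j with hL
  choose B1 hB1 using fun j => hbd (L j)
  choose B2 hB2 using fun j => hbd (L j).derivative
  refine ⟨∑ j, (|B1 j| + |B2 j|), by positivity, fun p hp e he x hx => ?_⟩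
  have hpd : p.degree < (Finset.univ : Finset (Fin (N + 1))).card := by
    rw [Finset.card_univ, Fintype.card_fin]
    exact lt_of_le_of_lt Polynomial.degree_le_natDegree (by exact_mod_cast Nat.lt_succ_of_le hp)
  have hint : p = ∑ j, Polynomial.C (p.eval (v j)) * L j := by
    conv_lhs => rw [Lagrange.eq_interpolate hinj hpd, Lagrange.interpolate_apply]
  have hval : ∀ j, |p.eval (v j)| ≤ e := by
    intro j
    refine he _ ?_
    rw [hv, abs_of_nonneg (by positivity), div_le_iff₀ hN]
    have : (j : ℝ) ≤ N := by exact_mod_cast Nat.lt_succ_iff.1 j.2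
    linarith
  have main : ∀ (T : Fin (N + 1) → ℝ), (∀ j, |T j| ≤ |B1 j| + |B2 j|) →
      |∑ j, p.eval (v j) * T j| ≤ (∑ j, (|B1 j| + |B2 j|)) * e := by
    intro T hT
    refine (Finset.abs_sum_le_sum_abs _ _).trans ?_
    rw [Finset.sum_mul]
    refine Finset.sum_le_sum fun j _ => ?_
    rw [abs_mul, mul_comm]
    exact mul_le_mul (hT j) (hval j) (abs_nonneg _) (by positivity)
  constructor
  · have h1 : p.eval x = ∑ j, p.eval (v j) * (L j).eval x := by
      conv_lhs => rw [hint]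
      simp [Polynomial.eval_finsetSum]
    rw [h1]
    exact main _ fun j => ((hB1 j x hx).trans (le_abs_self _)).trans
      (le_add_of_nonneg_right (abs_nonneg _))
  · have h1 : p.derivative.eval x = ∑ j, p.eval (v j) * (L j).derivative.eval x := by
      conv_lhs => rw [hint]
      simp [Polynomial.eval_finsetSum]
    rw [h1]
    exact main _ fun j => ((hB2 j x hx).trans (le_abs_self _)).trans
      (le_add_of_nonneg_left (abs_nonneg _))

theorem exists_polynomial_bound_scaled (N : ℕ) (R : ℝ) : ∃ K : ℝ, 0 ≤ K ∧
    ∀ p : Polynomial ℝ, p.natDegree ≤ N → ∀ c r e, 0 < r →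
      (∀ s, |s - c| ≤ r / 2 → |p.eval s| ≤ e) →
      ∀ x, |x - c| ≤ R * r → |p.eval x| ≤ K * e ∧ |p.derivative.eval x| ≤ K * e / r := by
  obtain ⟨K, hK, h⟩ := exists_polynomial_bound N R
  refine ⟨K, hK, fun p hp c r e hr he x hx => ?_⟩
  set q : Polynomial ℝ := p.comp (Polynomial.C r * Polynomial.X + Polynomial.C c) with hq
  have hqN : q.natDegree ≤ N := by
    refine Polynomial.natDegree_comp_le.trans ?_
    calc p.natDegree * (Polynomial.C r * Polynomial.X + Polynomial.C c).natDegree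
        ≤ N * 1 := Nat.mul_le_mul hp Polynomial.natDegree_linear_le
      _ = N := mul_one N
  have hqe : ∀ s, q.eval s = p.eval (r * s + c) := fun s => by simp [hq]
  have hqd : ∀ s, q.derivative.eval s = r * p.derivative.eval (r * s + c) := fun s => by
    simp [hq, Polynomial.derivative_comp]
  have hx' : |(x - c) / r| ≤ R := by
    rw [abs_div, abs_of_pos hr, div_le_iff₀ hr]
    exact hx
  have h1 := h q hqN e (fun s hs => by
    rw [hqe]
    refine he _ ?_
    rw [add_sub_cancel_right, abs_mul, abs_of_pos hr]
    nlinarith) ((x - c) / r) hx'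
  have hxx : r * ((x - c) / r) + c = x := by field_simp; ring
  rw [hqe, hqd, hxx, abs_mul, abs_of_pos hr] at h1
  refine ⟨h1.1, ?_⟩
  rw [le_div_iff₀ hr, mul_comm]
  exact h1.2

/-- `K` is a constant in the inverse inequality of degree `N`: a polynomial within `e` of a constant
on a square of side `r` has partial derivatives at most `K e / r` on the concentric square of
half-side `R r`. -/
def IsInverseConstant (N : ℕ) (R K : ℝ) : Prop :=
  0 ≤ K ∧ ∀ f ∈ polySpace N, ∀ (c : Pt) (r e a : ℝ), 0 < r →
    (∀ x : Pt, |x.1 - c.1| ≤ r / 2 → |x.2 - c.2| ≤ r / 2 → |f x - a| ≤ e) →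
    ∀ x : Pt, |x.1 - c.1| ≤ R * r → |x.2 - c.2| ≤ R * r →
      |dx f x| ≤ K * e / r ∧ |dy f x| ≤ K * e / r

theorem exists_isInverseConstant (N : ℕ) (R : ℝ) : ∃ K : ℝ, IsInverseConstant N R K := by
  obtain ⟨K, hK, h⟩ := exists_polynomial_bound_scaled N R
  have main : ∀ f ∈ polySpace N, ∀ (c : Pt) (r e a : ℝ), 0 < r →
      (∀ x : Pt, |x.1 - c.1| ≤ r / 2 → |x.2 - c.2| ≤ r / 2 → |f x - a| ≤ e) →
      ∀ x : Pt, |x.1 - c.1| ≤ R * r → |x.2 - c.2| ≤ R * r → |dx f x| ≤ K * K * e / r := by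
    intro f hf c r e a hr he x hx1 hx2
    have hg : (f - fun _ => a) ∈ polySpace N := Submodule.sub_mem _ hf (const_mem_polySpace a N)
    -- the bound is first carried along the vertical line through a point `s` of the small square,
    -- then along the horizontal line through `x`
    have step : ∀ s, |s - c.1| ≤ r / 2 → |f (s, x.2) - a| ≤ K * e := by
      intro s hs
      obtain ⟨P, hP, hPe⟩ := polySpace_line hg (s, 0) (0, 1)
      have hPe' : ∀ y, P.eval y = f (s, y) - a := fun y => by simp [← hPe y]
      have := (h P hP c.2 r e hr (fun y hy => by rw [hPe']; exact he (s, y) hs hy) x.2 hx2).1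
      rwa [hPe'] at this
    obtain ⟨P, hP, hPe⟩ := polySpace_line hg (0, x.2) (1, 0)
    have hPe' : ∀ y, f (y, x.2) = P.eval y + a := fun y => by simp [← hPe y]
    have hd : dx f x = P.derivative.eval x.1 := by
      simp only [dx, hPe']
      exact ((P.hasDerivAt x.1).add_const a).deriv
    rw [hd, mul_assoc]
    refine (h P hP c.1 r (K * e) hr (fun y hy => ?_) x.1 hx1).2
    have := step y hy
    rwa [hPe', add_sub_cancel_right] at this
  refine ⟨K * K, by positivity, fun f hf c r e a hr he x hx1 hx2 =>
    ⟨main f hf c r e a hr he x hx1 hx2, ?_⟩⟩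
  exact main _ (comp_swap_mem_polySpace hf) (c.2, c.1) r e a hr
    (fun y h1 h2 => he (y.2, y.1) h2 h1) (x.2, x.1) hx2 hx1

/-! ### Quadrature rules on polynomials -/

namespace QuadRule

theorem eval_add {α : Type} (q : QuadRule α) (f g : α → ℝ) :
    q.eval (fun x => f x + g x) = q.eval f + q.eval g := by
  simp [QuadRule.eval, mul_add, Finset.sum_add_distrib]

theorem eval_sub {α : Type} (q : QuadRule α) (f g : α → ℝ) :
    q.eval (fun x => f x - g x) = q.eval f - q.eval g := by
  simp [QuadRule.eval, mul_sub, Finset.sum_sub_distrib]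

theorem eval_const_mul {α : Type} (q : QuadRule α) (c : ℝ) (f : α → ℝ) :
    q.eval (fun x => c * f x) = c * q.eval f := by
  simp [QuadRule.eval, Finset.mul_sum, mul_left_comm]

theorem abs_eval_le {α : Type} (q : QuadRule α) (hw : ∀ a, 0 ≤ q.weight a) {f : α → ℝ} {e : ℝ}
    (hf : ∀ a, |f (q.node a)| ≤ e) : |q.eval f| ≤ (∑ a, q.weight a) * e := by
  refine (Finset.abs_sum_le_sum_abs _ _).trans ?_
  rw [Finset.sum_mul]
  refine Finset.sum_le_sum fun a _ => ?_
  rw [abs_mul, abs_of_nonneg (hw a)]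
  exact mul_le_mul_of_nonneg_left (hf a) (hw a)

end QuadRule

theorem EdgeRuleExact.sum_weight {q : QuadRule ℝ} {d : ℕ} (hq : EdgeRuleExact q d) :
    ∑ a, q.weight a = 1 := by
  have := hq.exact 0 (Nat.zero_le d)
  simpa [QuadRule.eval] using this

theorem EdgeRuleExact.eval_polynomial {q : QuadRule ℝ} {d : ℕ} (hq : EdgeRuleExact q d)
    (P : Polynomial ℝ) (hP : P.natDegree ≤ d) :
    q.eval (fun s => P.eval s) = ∫ s in (0 : ℝ)..1, P.eval s := by
  simp only [Polynomial.eval_eq_sum_range]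
  rw [intervalIntegral.integral_finsetSum
    fun i _ => (Continuous.intervalIntegrable (by fun_prop) _ _)]
  simp only [intervalIntegral.integral_const_mul, QuadRule.eval, Finset.mul_sum]
  rw [Finset.sum_comm]
  refine Finset.sum_congr rfl fun i hi => ?_
  rw [← hq.exact i (by have := Finset.mem_range.1 hi; omega), QuadRule.eval, Finset.mul_sum]
  exact Finset.sum_congr rfl fun a _ => by ring

theorem CellRuleExact.sum_weight {P : Polygon} {q : QuadRule Pt} {d : ℕ}
    (hq : CellRuleExact P q d) : ∑ a, q.weight a = P.area := by
  have := hq.exact 0 0 (Nat.zero_le d)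
  simpa [QuadRule.eval, Polygon.area, Measure.real] using this

theorem CellRuleExact.eval_polySpace {P : Polygon} {q : QuadRule Pt} {d : ℕ}
    (hq : CellRuleExact P q d) (hc : IsCompact P.region) {f : Pt → ℝ} (hf : f ∈ polySpace d) :
    q.eval f = ∫ x in P.region, f x := by
  induction hf using Submodule.span_induction with
  | mem f h => obtain ⟨a, b, hab, rfl⟩ := h; exact hq.exact a b hab
  | zero => simp [QuadRule.eval]
  | add f g hf hg h1 h2 =>
    have := integral_add ((polySpace_continuous hf).continuousOn.integrableOn_compact (μ := volume) hc)
      ((polySpace_continuous hg).continuousOn.integrableOn_compact hc)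
    simp only [Pi.add_apply]
    rw [this, ← h1, ← h2]
    exact q.eval_add f g
  | smul c f _ h1 =>
    simp only [Pi.smul_apply, smul_eq_mul]
    rw [integral_const_mul, ← h1]
    exact q.eval_const_mul c f

/-! ### The divergence theorem on triangles -/

theorem fderiv_apply_eq {f : Pt → ℝ} (hf : ContDiff ℝ 1 f) (x w : Pt) :
    fderiv ℝ f x w = dx f x * w.1 + dy f x * w.2 := by
  have hx : HasFDerivAt f (fderiv ℝ f x) x := (hf.differentiable one_ne_zero x).hasFDerivAt
  have h1 : fderiv ℝ f x (1, 0) = dx f x := by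
    have hl : HasDerivAt (fun s : ℝ => ((s, x.2) : Pt)) (1, 0) x.1 :=
      (hasDerivAt_id x.1).prodMk (hasDerivAt_const _ _)
    exact (HasFDerivAt.comp_hasDerivAt (l := f) x.1 hx hl).unique (hasDerivAt_dx hf x)
  have h2 : fderiv ℝ f x (0, 1) = dy f x := by
    have hl : HasDerivAt (fun s : ℝ => ((x.1, s) : Pt)) (0, 1) x.2 :=
      (hasDerivAt_const _ _).prodMk (hasDerivAt_id x.2)
    exact (HasFDerivAt.comp_hasDerivAt (l := f) x.2 hx hl).unique (hasDerivAt_dy hf x)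
  have hw : w = w.1 • ((1, 0) : Pt) + w.2 • ((0, 1) : Pt) := by
    ext <;> simp
  conv_lhs => rw [hw]
  rw [map_add, map_smul, map_smul, h1, h2, smul_eq_mul, smul_eq_mul]
  ring

theorem continuous_dx {f : Pt → ℝ} (hf : ContDiff ℝ 1 f) : Continuous (dx f) := by
  have : dx f = fun x => fderiv ℝ f x (1, 0) := by
    ext x; rw [fderiv_apply_eq hf]; simp
  rw [this]
  exact (hf.continuous_fderiv one_ne_zero).clm_apply continuous_const

theorem continuous_dy {f : Pt → ℝ} (hf : ContDiff ℝ 1 f) : Continuous (dy f) := by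
  have : dy f = fun x => fderiv ℝ f x (0, 1) := by
    ext x; rw [fderiv_apply_eq hf]; simp
  rw [this]
  exact (hf.continuous_fderiv one_ne_zero).clm_apply continuous_const

/-- The reference triangle, with vertices `(0, 0)`, `(1, 0)`, `(0, 1)`. -/
def refTriangle : Set Pt := {z | 0 ≤ z.1 ∧ 0 ≤ z.2 ∧ z.1 + z.2 ≤ 1}

theorem isClosed_refTriangle : IsClosed refTriangle :=
  (isClosed_le continuous_const continuous_fst).inter
    ((isClosed_le continuous_const continuous_snd).inter
      (isClosed_le (continuous_fst.add continuous_snd) continuous_const))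

theorem isCompact_refTriangle : IsCompact refTriangle := by
  refine (isCompact_Icc (a := ((0, 0) : Pt)) (b := (1, 1))).of_isClosed_subset
    isClosed_refTriangle ?_
  rintro ⟨s, t⟩ ⟨h1, h2, h3⟩
  simp only at h1 h2 h3
  exact ⟨⟨h1, h2⟩, ⟨by simp only; linarith, by simp only; linarith⟩⟩

theorem convex_refTriangle : Convex ℝ refTriangle := by
  rintro ⟨x1, x2⟩ ⟨h1, h2, h3⟩ ⟨y1, y2⟩ ⟨k1, k2, k3⟩ a b ha hb hab
  simp only at h1 h2 h3 k1 k2 k3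
  refine ⟨?_, ?_, ?_⟩ <;> simp only [Prod.fst_add, Prod.snd_add, Prod.smul_fst, Prod.smul_snd,
    smul_eq_mul]
  · positivity
  · positivity
  · nlinarith

theorem integral_refTriangle {g : Pt → ℝ} (hg : Continuous g) :
    ∫ z in refTriangle, g z = ∫ t in (0 : ℝ)..1, ∫ s in (0 : ℝ)..(1 - t), g (s, t) := by
  have hm : MeasurableSet refTriangle := isClosed_refTriangle.measurableSet
  have hi : Integrable (refTriangle.indicator g) :=
    (integrable_indicator_iff hm).2 (hg.continuousOn.integrableOn_compact isCompact_refTriangle)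
  rw [← integral_indicator hm, Measure.volume_eq_prod, integral_prod_symm _ hi,
    intervalIntegral.integral_of_le zero_le_one, ← integral_Icc_eq_integral_Ioc,
    ← integral_indicator measurableSet_Icc]
  refine integral_congr_ae (Eventually.of_forall fun t => ?_)
  by_cases ht : t ∈ Set.Icc (0 : ℝ) 1
  · simp only [Set.indicator_of_mem ht]
    rw [intervalIntegral.integral_of_le (by linarith [ht.2]), ← integral_Icc_eq_integral_Ioc,
      ← integral_indicator measurableSet_Icc]
    refine integral_congr_ae (Eventually.of_forall fun s => ?_)
    by_cases hs : s ∈ Set.Icc (0 : ℝ) (1 - t)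
    · have : ((s, t) : Pt) ∈ refTriangle := ⟨hs.1, ht.1, by simp only; linarith [hs.2]⟩
      simp only [Set.indicator_of_mem hs, Set.indicator_of_mem this]
    · have : ((s, t) : Pt) ∉ refTriangle := fun h =>
        hs ⟨h.1, by have := h.2.2; simp only at this; linarith⟩
      simp only [Set.indicator_of_notMem hs, Set.indicator_of_notMem this]
  · simp only [Set.indicator_of_notMem ht]
    have : ∀ s, refTriangle.indicator g (s, t) = 0 := fun s =>
      Set.indicator_of_notMem (fun h => ht ⟨h.2.1, by
        have := h.2.2; have := h.1; simp only at *; linarith⟩) _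
    simp [this]

theorem integral_refTriangle' {g : Pt → ℝ} (hg : Continuous g) :
    ∫ z in refTriangle, g z = ∫ s in (0 : ℝ)..1, ∫ t in (0 : ℝ)..(1 - s), g (s, t) := by
  have h := integral_refTriangle (g := fun z => g (z.2, z.1)) (by fun_prop)
  rw [← h]
  have hs : Prod.swap ⁻¹' refTriangle = refTriangle := by
    ext z
    simp only [refTriangle, Set.mem_preimage, Set.mem_ofPred_eq, Prod.fst_swap, Prod.snd_swap]
    constructor <;> rintro ⟨h1, h2, h3⟩ <;> exact ⟨h2, h1, by linarith⟩
  have := (Measure.measurePreserving_swap (μ := (volume : Measure ℝ)) (ν := volume)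
    ).setIntegral_preimage_emb (MeasurableEquiv.prodComm.measurableEmbedding) g refTriangle
  rw [hs] at this
  exact this.symm

/-- The mean of `f` over the segment from `A` to `B`. -/
noncomputable def segMean (f : Pt → ℝ) (A B : Pt) : ℝ := ∫ s in (0 : ℝ)..1, f (A + s • (B - A))

theorem segMean_symm (f : Pt → ℝ) (A B : Pt) : segMean f B A = segMean f A B := by
  have h := intervalIntegral.integral_comp_sub_left (a := 0) (b := 1)
    (fun s => f (A + s • (B - A))) 1
  simp only [sub_self, sub_zero] at h
  rw [segMean, segMean, ← h]
  refine intervalIntegral.integral_congr fun s _ => ?_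
  congr 1
  rw [sub_smul, one_smul, smul_sub, smul_sub]
  abel

/-- The affine parametrization of the triangle `A B C` by the reference triangle. -/
def triMap (A B C : Pt) (z : Pt) : Pt := A + z.1 • (B - A) + z.2 • (C - A)

theorem triMap_image (A B C : Pt) : triMap A B C '' refTriangle = convexHull ℝ {A, B, C} := by
  refine Set.Subset.antisymm ?_ (convexHull_min ?_ ?_)
  · rintro _ ⟨z, ⟨h1, h2, h3⟩, rfl⟩
    have hc := convex_convexHull ℝ ({A, B, C} : Set Pt)
    have hA : A ∈ convexHull ℝ ({A, B, C} : Set Pt) := subset_convexHull _ _ (by simp)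
    have hB : B ∈ convexHull ℝ ({A, B, C} : Set Pt) := subset_convexHull _ _ (by simp)
    have hC : C ∈ convexHull ℝ ({A, B, C} : Set Pt) := subset_convexHull _ _ (by simp)
    have := hc.sum_mem (t := Finset.univ) (w := ![1 - z.1 - z.2, z.1, z.2]) (z := ![A, B, C])
      (by intro i _; fin_cases i <;> simp <;> linarith) (by simp [Fin.sum_univ_three]; ring)
      (by intro i _; fin_cases i <;> simpa)
    convert this using 1
    simp only [triMap, Fin.sum_univ_three, Matrix.cons_val_zero, Matrix.cons_val_one,
      Matrix.cons_val]
    module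
  · rintro x (rfl | rfl | rfl)
    · exact ⟨(0, 0), by simp [refTriangle], by simp [triMap]⟩
    · exact ⟨(1, 0), by simp [refTriangle], by simp [triMap]⟩
    · exact ⟨(0, 1), by simp [refTriangle], by simp [triMap]⟩
  · rintro _ ⟨x, hx, rfl⟩ _ ⟨y, hy, rfl⟩ a b ha hb hab
    refine ⟨a • x + b • y, convex_refTriangle hx hy ha hb hab, ?_⟩
    simp only [triMap, Prod.fst_add, Prod.snd_add, Prod.smul_fst, Prod.smul_snd, smul_eq_mul]
    have : A = a • A + b • A := by rw [← add_smul, hab, one_smul]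
    nth_rewrite 1 [this]
    module

/-- The linear part of `triMap`. -/
noncomputable def triLin (u v : Pt) : Pt →L[ℝ] Pt :=
  LinearMap.toContinuousLinearMap (Matrix.toLin (Module.Basis.finTwoProd ℝ)
    (Module.Basis.finTwoProd ℝ)
    !![u.1, v.1; u.2, v.2])

theorem triLin_apply (u v z : Pt) : triLin u v z = z.1 • u + z.2 • v := by
  rw [triLin, Matrix.toLin_finTwoProd_toContinuousLinearMap]
  ext <;> simp [mul_comm]

theorem triLin_det (u v : Pt) : (triLin u v).det = u.1 * v.2 - u.2 * v.1 := by
  simp only [triLin, LinearMap.det_toContinuousLinearMap, LinearMap.det_toLin,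
    Matrix.det_fin_two_of]
  ring

theorem triMap_hasFDerivAt (A B C z : Pt) :
    HasFDerivAt (triMap A B C) (triLin (B - A) (C - A)) z := by
  have h : triMap A B C = fun z => A + triLin (B - A) (C - A) z := by
    ext z <;> simp [triMap, triLin_apply, add_assoc]
  rw [h]
  exact (triLin (B - A) (C - A)).hasFDerivAt.const_add A

theorem triMap_continuous (A B C : Pt) : Continuous (triMap A B C) :=
  continuous_iff_continuousAt.2 fun z => (triMap_hasFDerivAt A B C z).continuousAt

theorem triMap_injective {A B C : Pt} (h : 0 < orient A B C) :
    Function.Injective (triMap A B C) := by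
  rintro ⟨s, t⟩ ⟨s', t'⟩ hz
  simp only [triMap, orient, Prod.ext_iff, Prod.fst_add, Prod.snd_add, Prod.smul_fst,
    Prod.smul_snd, smul_eq_mul, Prod.fst_sub, Prod.snd_sub] at *
  obtain ⟨h1, h2⟩ := hz
  have hs : ((B.1 - A.1) * (C.2 - A.2) - (B.2 - A.2) * (C.1 - A.1)) * (s - s') = 0 := by
    linear_combination (C.2 - A.2) * h1 - (C.1 - A.1) * h2
  have ht : ((B.1 - A.1) * (C.2 - A.2) - (B.2 - A.2) * (C.1 - A.1)) * (t - t') = 0 := by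
    linear_combination (B.1 - A.1) * h2 - (B.2 - A.2) * h1
  constructor
  · linarith [(mul_eq_zero.1 hs).resolve_left h.ne']
  · linarith [(mul_eq_zero.1 ht).resolve_left h.ne']

theorem isCompact_triangle (A B C : Pt) : IsCompact (convexHull ℝ ({A, B, C} : Set Pt)) := by
  rw [← triMap_image]
  exact isCompact_refTriangle.image (triMap_continuous A B C)

theorem integral_triangle {A B C : Pt} (h : 0 < orient A B C) (g : Pt → ℝ) :
    ∫ x in convexHull ℝ {A, B, C}, g x =
      ∫ z in refTriangle, orient A B C * g (triMap A B C z) := by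
  rw [← triMap_image, integral_image_eq_integral_abs_det_fderiv_smul volume
    isClosed_refTriangle.measurableSet
    (fun z _ => (triMap_hasFDerivAt A B C z).hasFDerivWithinAt) (triMap_injective h).injOn]
  have : |(triLin (B - A) (C - A)).det| = orient A B C := by
    rw [triLin_det]
    exact abs_of_pos h
  simp only [this, smul_eq_mul]

theorem integral_dir_fst {f : Pt → ℝ} (hf : ContDiff ℝ 1 f) (A B C : Pt) :
    ∫ z in refTriangle, (dx f (triMap A B C z) * (B - A).1 + dy f (triMap A B C z) * (B - A).2) =
      segMean f B C - segMean f A C := by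
  have hc := triMap_continuous A B C
  have h1 := continuous_dx hf
  have h2 := continuous_dy hf
  have hfc := hf.continuous
  rw [integral_refTriangle (by fun_prop)]
  have hin : ∀ t, ∫ s in (0 : ℝ)..(1 - t), (dx f (triMap A B C (s, t)) * (B - A).1 +
      dy f (triMap A B C (s, t)) * (B - A).2) = f (B + t • (C - B)) - f (A + t • (C - A)) := by
    intro t
    rw [intervalIntegral.integral_eq_sub_of_hasDerivAt (f := fun s => f (triMap A B C (s, t)))]
    · congr 2
      · simp only [triMap]; module
      · simp only [triMap]; module
    · intro s _
      rw [← fderiv_apply_eq hf]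
      have hd : HasDerivAt (fun s : ℝ => triMap A B C (s, t)) (B - A) s := by
        have := ((hasDerivAt_id s).smul_const (B - A)).const_add A |>.add_const (t • (C - A))
        simpa [triMap] using this
      exact HasFDerivAt.comp_hasDerivAt (l := f) s
        (hf.differentiable one_ne_zero _).hasFDerivAt hd
    · exact Continuous.intervalIntegrable (by fun_prop) _ _
  simp only [hin]
  exact intervalIntegral.integral_sub (Continuous.intervalIntegrable (by fun_prop) _ _)
    (Continuous.intervalIntegrable (by fun_prop) _ _)

theorem integral_dir_snd {f : Pt → ℝ} (hf : ContDiff ℝ 1 f) (A B C : Pt) :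
    ∫ z in refTriangle, (dx f (triMap A B C z) * (C - A).1 + dy f (triMap A B C z) * (C - A).2) =
      segMean f B C - segMean f A B := by
  have hc := triMap_continuous A B C
  have h1 := continuous_dx hf
  have h2 := continuous_dy hf
  have hfc := hf.continuous
  rw [integral_refTriangle' (by fun_prop), ← segMean_symm f B C]
  have hin : ∀ s, ∫ t in (0 : ℝ)..(1 - s), (dx f (triMap A B C (s, t)) * (C - A).1 +
      dy f (triMap A B C (s, t)) * (C - A).2) = f (C + s • (B - C)) - f (A + s • (B - A)) := by
    intro s
    rw [intervalIntegral.integral_eq_sub_of_hasDerivAt (f := fun t => f (triMap A B C (s, t)))]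
    · congr 2
      · simp only [triMap]; module
      · simp only [triMap]; module
    · intro t _
      rw [← fderiv_apply_eq hf]
      have hd : HasDerivAt (fun t : ℝ => triMap A B C (s, t)) (C - A) t := by
        have := ((hasDerivAt_id t).smul_const (C - A)).const_add (A + s • (B - A))
        simpa [triMap] using this
      exact HasFDerivAt.comp_hasDerivAt (l := f) t
        (hf.differentiable one_ne_zero _).hasFDerivAt hd
    · exact Continuous.intervalIntegrable (by fun_prop) _ _
  simp only [hin]
  exact intervalIntegral.integral_sub (Continuous.intervalIntegrable (by fun_prop) _ _)
    (Continuous.intervalIntegrable (by fun_prop) _ _)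

/-- The divergence theorem on a triangle, first component. -/
theorem integral_triangle_dx {f : Pt → ℝ} (hf : ContDiff ℝ 1 f) {A B C : Pt}
    (h : 0 < orient A B C) :
    ∫ x in convexHull ℝ {A, B, C}, dx f x = (B.2 - A.2) * segMean f A B +
      (C.2 - B.2) * segMean f B C + (A.2 - C.2) * segMean f A C := by
  have hc := triMap_continuous A B C
  have h1 := continuous_dx hf
  have h2 := continuous_dy hf
  rw [integral_triangle h]
  have e : ∀ z, orient A B C * dx f (triMap A B C z) =
      (C.2 - A.2) * (dx f (triMap A B C z) * (B - A).1 + dy f (triMap A B C z) * (B - A).2) -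
      (B.2 - A.2) * (dx f (triMap A B C z) * (C - A).1 + dy f (triMap A B C z) * (C - A).2) := by
    intro z
    simp only [orient, Prod.fst_sub, Prod.snd_sub]
    ring
  simp only [e]
  rw [integral_sub, integral_const_mul, integral_const_mul, integral_dir_fst hf,
    integral_dir_snd hf]
  · ring
  all_goals
    exact (Continuous.continuousOn (by fun_prop)).integrableOn_compact isCompact_refTriangle

/-- The divergence theorem on a triangle, second component. -/
theorem integral_triangle_dy {f : Pt → ℝ} (hf : ContDiff ℝ 1 f) {A B C : Pt}
    (h : 0 < orient A B C) :
    ∫ x in convexHull ℝ {A, B, C}, dy f x = -((B.1 - A.1) * segMean f A B +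
      (C.1 - B.1) * segMean f B C + (A.1 - C.1) * segMean f A C) := by
  have hc := triMap_continuous A B C
  have h1 := continuous_dx hf
  have h2 := continuous_dy hf
  rw [integral_triangle h]
  have e : ∀ z, orient A B C * dy f (triMap A B C z) =
      (B.1 - A.1) * (dx f (triMap A B C z) * (C - A).1 + dy f (triMap A B C z) * (C - A).2) -
      (C.1 - A.1) * (dx f (triMap A B C z) * (B - A).1 + dy f (triMap A B C z) * (B - A).2) := by
    intro z
    simp only [orient, Prod.fst_sub, Prod.snd_sub]
    ring
  simp only [e]
  rw [integral_sub, integral_const_mul, integral_const_mul, integral_dir_fst hf,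
    integral_dir_snd hf]
  · ring
  all_goals
    exact (Continuous.continuousOn (by fun_prop)).integrableOn_compact isCompact_refTriangle

namespace Polygon

variable (P : Polygon)

/-! ### Geometry of a polygonal cell -/

theorem isCompact_subTriangle (k : Fin (P.m + 3)) : IsCompact (subTriangle P.vert k) :=
  isCompact_triangle _ _ _

theorem isCompact_region : IsCompact P.region :=
  isCompact_iUnion P.isCompact_subTriangle

theorem integrableOn_region {f : Pt → ℝ} (hf : Continuous f) : IntegrableOn f P.region :=
  hf.continuousOn.integrableOn_compact P.isCompact_region

theorem aedisjoint_subTriangle :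
    Pairwise (Function.onFun (AEDisjoint volume) fun k => subTriangle P.vert k) := by
  intro k l hkl
  have hk : Convex ℝ (subTriangle P.vert k) := convex_convexHull ℝ _
  have hl : Convex ℝ (subTriangle P.vert l) := convex_convexHull ℝ _
  refine measure_mono_null (t := frontier (subTriangle P.vert k) ∪
    frontier (subTriangle P.vert l)) ?_
    (measure_union_null (hk.addHaar_frontier volume) (hl.addHaar_frontier volume))
  rintro x ⟨hxk, hxl⟩
  by_contra hx
  have hx' := not_or.1 hx
  have h1 : x ∈ interior (subTriangle P.vert k) := by
    by_contra h; exact hx'.1 ⟨subset_closure hxk, h⟩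
  have h2 : x ∈ interior (subTriangle P.vert l) := by
    by_contra h; exact hx'.2 ⟨subset_closure hxl, h⟩
  exact Set.disjoint_left.1 (P.nonoverlap hkl) h1 h2

theorem integral_region {f : Pt → ℝ} (hf : Continuous f) :
    ∫ x in P.region, f x = ∑ k, ∫ x in subTriangle P.vert k, f x := by
  rw [Polygon.region, integral_iUnion_ae
    (fun k => (P.isCompact_subTriangle k).measurableSet.nullMeasurableSet)
    P.aedisjoint_subTriangle (P.integrableOn_region hf), tsum_fintype]

/-- The divergence theorem on a cell, first component: the contributions of the edges that two
triangles share cancel. -/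
theorem integral_region_dx {f : Pt → ℝ} (hf : ContDiff ℝ 1 f) :
    ∫ x in P.region, dx f x =
      ∑ k, ((P.vert (k + 1)).2 - (P.vert k).2) * segMean f (P.vert k) (P.vert (k + 1)) := by
  rw [P.integral_region (continuous_dx hf)]
  have h : ∀ k, ∫ x in subTriangle P.vert k, dx f x = _ := fun k =>
    integral_triangle_dx hf (P.pos k)
  simp only [h]
  have hs := Equiv.sum_comp (Equiv.addRight (1 : Fin (P.m + 3)))
    fun k => ((P.vert k).2 - P.bary.2) * segMean f P.bary (P.vert k)
  simp only [Equiv.coe_addRight] at hs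
  rw [← sub_eq_zero, ← Finset.sum_sub_distrib]
  rw [← sub_eq_zero, ← Finset.sum_sub_distrib] at hs
  rw [← neg_eq_zero, ← Finset.sum_neg_distrib]
  rw [← hs]
  refine Finset.sum_congr rfl fun k _ => ?_
  simp only [Polygon.bary]
  ring

/-- The divergence theorem on a cell, second component. -/
theorem integral_region_dy {f : Pt → ℝ} (hf : ContDiff ℝ 1 f) :
    ∫ x in P.region, dy f x =
      ∑ k, -((P.vert (k + 1)).1 - (P.vert k).1) * segMean f (P.vert k) (P.vert (k + 1)) := by
  rw [P.integral_region (continuous_dy hf)]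
  have h : ∀ k, ∫ x in subTriangle P.vert k, dy f x = _ := fun k =>
    integral_triangle_dy hf (P.pos k)
  simp only [h]
  have hs := Equiv.sum_comp (Equiv.addRight (1 : Fin (P.m + 3)))
    fun k => ((P.vert k).1 - P.bary.1) * segMean f P.bary (P.vert k)
  simp only [Equiv.coe_addRight] at hs
  rw [← sub_eq_zero, ← Finset.sum_sub_distrib]
  rw [← sub_eq_zero, ← Finset.sum_sub_distrib] at hs
  rw [← hs]
  refine Finset.sum_congr rfl fun k _ => ?_
  simp only [Polygon.bary]
  ring

theorem edgeLen_nonneg (k : Fin (P.m + 3)) : 0 ≤ P.edgeLen k := Real.sqrt_nonneg _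

theorem edgeLen_sq (k : Fin (P.m + 3)) : P.edgeLen k ^ 2 =
    ((P.vert (k + 1)).1 - (P.vert k).1) ^ 2 + ((P.vert (k + 1)).2 - (P.vert k).2) ^ 2 :=
  Real.sq_sqrt (by positivity)

theorem edgeLen_pos (k : Fin (P.m + 3)) : 0 < P.edgeLen k := by
  refine (P.edgeLen_nonneg k).lt_of_ne' fun h => ?_
  have h2 := P.edgeLen_sq k
  rw [h] at h2
  have h3 := P.pos k
  have h4 : (P.vert (k + 1)).1 = (P.vert k).1 := by nlinarith
  have h5 : (P.vert (k + 1)).2 = (P.vert k).2 := by nlinarith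
  rw [orient, h4, h5] at h3
  linarith

theorem edgeLen_mul_normal_fst (k : Fin (P.m + 3)) :
    P.edgeLen k * (P.normal k).1 = (P.vert (k + 1)).2 - (P.vert k).2 :=
  mul_div_cancel₀ _ (P.edgeLen_pos k).ne'

theorem edgeLen_mul_normal_snd (k : Fin (P.m + 3)) :
    P.edgeLen k * (P.normal k).2 = -((P.vert (k + 1)).1 - (P.vert k).1) :=
  mul_div_cancel₀ _ (P.edgeLen_pos k).ne'

theorem isUnitVec_normal (k : Fin (P.m + 3)) : IsUnitVec (P.normal k) := by
  have h := P.edgeLen_sq k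
  have h0 := (P.edgeLen_pos k).ne'
  simp only [IsUnitVec, Polygon.normal]
  field_simp
  rw [h]
  ring

theorem sum_edgeLen_mul_normal_fst : ∑ k, P.edgeLen k * (P.normal k).1 = 0 := by
  simp only [edgeLen_mul_normal_fst, Finset.sum_sub_distrib]
  rw [sub_eq_zero]
  exact Equiv.sum_comp (Equiv.addRight (1 : Fin (P.m + 3))) fun k => (P.vert k).2

theorem sum_edgeLen_mul_normal_snd : ∑ k, P.edgeLen k * (P.normal k).2 = 0 := by
  simp only [edgeLen_mul_normal_snd, Finset.sum_neg_distrib, Finset.sum_sub_distrib]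
  rw [neg_eq_zero, sub_eq_zero]
  exact Equiv.sum_comp (Equiv.addRight (1 : Fin (P.m + 3))) fun k => (P.vert k).1

theorem edgePoint_mem_region (k : Fin (P.m + 3)) {s : ℝ} (hs : s ∈ Set.Icc (0 : ℝ) 1) :
    P.edgePoint k s ∈ P.region := by
  refine Set.mem_iUnion.2 ⟨k, ?_⟩
  refine (convex_convexHull ℝ _).segment_subset
    (subset_convexHull _ _ (by simp)) (subset_convexHull _ _ (by simp))
    (?_ : P.edgePoint k s ∈ segment ℝ (P.vert k) (P.vert (k + 1)))
  rw [segment_eq_image']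
  exact ⟨s, hs, rfl⟩

theorem dist_vert_le_edgeLen (k : Fin (P.m + 3)) :
    dist (P.vert k) (P.vert (k + 1)) ≤ P.edgeLen k := by
  rw [dist_comm, Prod.dist_eq, Real.dist_eq, Real.dist_eq]
  refine max_le (Real.abs_le_sqrt ?_) (Real.abs_le_sqrt ?_)
  · exact le_add_of_nonneg_right (sq_nonneg _)
  · exact le_add_of_nonneg_left (sq_nonneg _)

theorem dist_vert_zero_le (k : Fin (P.m + 3)) : dist (P.vert 0) (P.vert k) ≤ P.perimeter := by
  have h := dist_le_range_sum_dist (fun j : ℕ => P.vert (Fin.ofNat (P.m + 3) j)) k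
  have h0 : Fin.ofNat (P.m + 3) (k : ℕ) = k := by ext; simp
  have h00 : Fin.ofNat (P.m + 3) 0 = 0 := rfl
  rw [h0, h00] at h
  refine h.trans ?_
  have hle : ∑ j ∈ Finset.range k, dist (P.vert (Fin.ofNat (P.m + 3) j))
      (P.vert (Fin.ofNat (P.m + 3) (j + 1))) ≤
      ∑ j ∈ Finset.range (P.m + 3), P.edgeLen (Fin.ofNat (P.m + 3) j) := by
    refine (Finset.sum_le_sum fun j _ => ?_).trans
      (Finset.sum_le_sum_of_subset_of_nonneg (Finset.range_subset_range.2 k.2.le)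
        fun j _ _ => P.edgeLen_nonneg _)
    have : Fin.ofNat (P.m + 3) (j + 1) = Fin.ofNat (P.m + 3) j + 1 := by
      ext; simp [Fin.val_add]
    rw [this]
    exact P.dist_vert_le_edgeLen _
  refine hle.trans (le_of_eq ?_)
  rw [Finset.sum_range, Polygon.perimeter]
  refine Finset.sum_congr rfl fun j _ => ?_
  congr 1
  ext
  simp

theorem region_subset_closedBall : P.region ⊆ Metric.closedBall (P.vert 0) P.perimeter := by
  have hv : ∀ k, P.vert k ∈ Metric.closedBall (P.vert 0) P.perimeter := fun k => by
    rw [Metric.mem_closedBall, dist_comm]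
    exact P.dist_vert_zero_le k
  have hc : Convex ℝ (Metric.closedBall (P.vert 0) P.perimeter) := convex_closedBall _ _
  refine Set.iUnion_subset fun k => convexHull_min ?_ hc
  rintro x (rfl | rfl | rfl)
  · rw [barycenter, Finset.smul_sum]
    refine hc.sum_mem (fun _ _ => by positivity) ?_ fun k _ => hv k
    rw [Finset.sum_const, Finset.card_univ, Fintype.card_fin, nsmul_eq_mul]
    push_cast
    exact mul_inv_cancel₀ (by positivity)
  · exact hv k
  · exact hv (k + 1)

/-- In coordinates, two points of the cell are at distance at most twice the perimeter. -/
theorem abs_sub_le_of_mem_region {x y : Pt} (hx : x ∈ P.region) (hy : y ∈ P.region) :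
    |x.1 - y.1| ≤ 2 * P.perimeter ∧ |x.2 - y.2| ≤ 2 * P.perimeter := by
  have h1 := P.region_subset_closedBall hx
  have h2 := P.region_subset_closedBall hy
  rw [Metric.mem_closedBall] at h1 h2
  have h3 : dist x y ≤ 2 * P.perimeter := by
    have := dist_triangle_right x y (P.vert 0)
    linarith
  rw [Prod.dist_eq, Real.dist_eq, Real.dist_eq] at h3
  exact ⟨(le_max_left _ _).trans h3, (le_max_right _ _).trans h3⟩

theorem square_subset_disc {c : Pt} {r : ℝ} (hr : 0 < r) {x : Pt} (h1 : |x.1 - c.1| ≤ r / 2)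
    (h2 : |x.2 - c.2| ≤ r / 2) : x ∈ disc c r := by
  have h3 := sq_le_sq' (abs_le.1 h1).1 (abs_le.1 h1).2
  have h4 := sq_le_sq' (abs_le.1 h2).1 (abs_le.1 h2).2
  change (x.1 - c.1) ^ 2 + (x.2 - c.2) ^ 2 < r ^ 2
  nlinarith [sq_pos_of_pos hr]

theorem sq_le_area {c : Pt} {r : ℝ} (hr : 0 < r) (hd : disc c r ⊆ P.region) :
    r ^ 2 ≤ P.area := by
  have hsub : Set.Icc (c.1 - r / 2) (c.1 + r / 2) ×ˢ Set.Icc (c.2 - r / 2) (c.2 + r / 2) ⊆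
      P.region := by
    rintro x ⟨h1, h2⟩
    refine hd (square_subset_disc hr ?_ ?_) <;> rw [abs_le]
    · constructor <;> linarith [h1.1, h1.2]
    · constructor <;> linarith [h2.1, h2.2]
  have h := ENNReal.toReal_mono P.isCompact_region.measure_lt_top.ne
    (measure_mono (μ := volume) hsub)
  rw [Measure.volume_eq_prod, Measure.prod_prod, Real.volume_Icc, Real.volume_Icc,
    ← ENNReal.ofReal_mul (by linarith), ENNReal.toReal_ofReal (by nlinarith)] at h
  calc r ^ 2 = (c.1 + r / 2 - (c.1 - r / 2)) * (c.2 + r / 2 - (c.2 - r / 2)) := by ring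
    _ ≤ P.area := h

end Polygon

/-- The points of an edge belong to the neighbouring cell as well. -/
theorem Mesh.edgePoint_mem_region_nbr (T : Mesh) {i j : T.Cell} {k : Fin ((T.poly i).m + 3)}
    (h : T.nbr i k = some j) {s : ℝ} (hs : s ∈ Set.Icc (0 : ℝ) 1) :
    (T.poly i).edgePoint k s ∈ (T.poly j).region := by
  obtain ⟨l, h1, h2⟩ := (T.nbr_iff i k j).1 h
  have h3 := (T.poly j).edgePoint_mem_region l (s := 1 - s) ⟨by linarith [hs.2], by linarith [hs.1]⟩
  convert h3 using 1
  simp only [Polygon.edgePoint, h1, h2]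
  module

/-! ### The negative part of the Euler matrices -/

/-- If the columns of `P` are eigenvectors of `M`, they are eigenvectors of its negative part,
whatever the decomposition used to compute it. -/
theorem IsNegPart.mul_eq {M R P : Matrix (Fin 5) (Fin 5) ℝ} {d : Fin 5 → ℝ} (h : IsNegPart M R)
    (hP : M * P = P * Matrix.diagonal d) :
    R * P = P * Matrix.diagonal fun a => min (d a) 0 := by
  obtain ⟨A, a, hA, rfl, rfl⟩ := h
  set W := A⁻¹ * P with hW
  have hAW : A * W = P := by rw [hW, ← mul_assoc, Matrix.mul_nonsing_inv A hA, one_mul]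
  have h1 : Matrix.diagonal a * W = W * Matrix.diagonal d := by
    calc Matrix.diagonal a * W = A⁻¹ * (A * Matrix.diagonal a * A⁻¹ * P) := by
          rw [hW]
          simp only [← mul_assoc, Matrix.nonsing_inv_mul A hA, one_mul]
      _ = W * Matrix.diagonal d := by rw [hP, hW, mul_assoc]
  have h2 : Matrix.diagonal (fun k => min (a k) 0) * W =
      W * Matrix.diagonal fun k => min (d k) 0 := by
    ext i j
    have hij := congrFun (congrFun h1 i) j
    rw [Matrix.diagonal_mul, Matrix.mul_diagonal] at hij ⊢
    rcases eq_or_ne (W i j) 0 with h0 | h0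
    · simp [h0]
    · rw [mul_comm] at hij
      rw [mul_left_cancel₀ h0 hij, mul_comm]
  calc A * (Matrix.diagonal fun k => min (a k) 0) * A⁻¹ * P
      = A * ((Matrix.diagonal fun k => min (a k) 0) * W) := by simp only [hW, mul_assoc]
    _ = P * Matrix.diagonal fun k => min (d k) 0 := by rw [h2, ← mul_assoc, hAW]

/-- `matNeg` is computed by any left inverse `Q` of a matrix of eigenvectors; in particular the
eigenvalue decomposition required by its definition exists. -/
theorem matNeg_eq {M P Q : Matrix (Fin 5) (Fin 5) ℝ} {d : Fin 5 → ℝ} (hQP : Q * P = 1)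
    (hP : M * P = P * Matrix.diagonal d) :
    matNeg M = P * (Matrix.diagonal fun a => min (d a) 0) * Q := by
  have hPQ : P * Q = 1 := mul_eq_one_comm.1 hQP
  have hex : ∃ R, IsNegPart M R := by
    refine ⟨_, P, d, Matrix.isUnit_det_of_left_inverse hQP, ?_, rfl⟩
    rw [← hP, Matrix.inv_eq_left_inv hQP, mul_assoc, hPQ, mul_one]
  have hs : IsNegPart M (matNeg M) := by
    rw [matNeg, dif_pos hex]
    exact hex.choose_spec
  rw [← hs.mul_eq hP, mul_assoc, hPQ, mul_one]

/-- The speed of sound. -/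
noncomputable def sound (γ : ℝ) (eos : EOS) (V : State) : ℝ :=
  Real.sqrt (gammaTilde γ eos (V 4) * V 3 / V 0)

/-- The eigenvectors of `matN`: entropy wave, shear wave, the two acoustic waves, marker wave. -/
def waveMat (ρ c a b : ℝ) : Matrix (Fin 5) (Fin 5) ℝ :=
  !![1, 0, ρ, ρ, 0;
     0, -b, c * a, -(c * a), 0;
     0, a, c * b, -(c * b), 0;
     0, 0, ρ * c ^ 2, ρ * c ^ 2, 0;
     0, 0, 0, 0, 1]

/-- The inverse of `waveMat` when `ρ` and `c` do not vanish and `(a, b)` is a unit vector. -/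
noncomputable def waveInv (ρ c a b : ℝ) : Matrix (Fin 5) (Fin 5) ℝ :=
  !![1, 0, 0, -(1 / c ^ 2), 0;
     0, -b, a, 0, 0;
     0, a / (2 * c), b / (2 * c), 1 / (2 * (ρ * c ^ 2)), 0;
     0, -(a / (2 * c)), -(b / (2 * c)), 1 / (2 * (ρ * c ^ 2)), 0;
     0, 0, 0, 0, 1]

theorem waveInv_mul_waveMat {ρ c a b : ℝ} (hρ : ρ ≠ 0) (hc : c ≠ 0) (hn : a ^ 2 + b ^ 2 = 1) :
    waveInv ρ c a b * waveMat ρ c a b = 1 := by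
  have hb : b ^ 2 = 1 - a ^ 2 := by linarith
  ext i j
  fin_cases i <;> fin_cases j <;>
    simp [waveInv, waveMat, Matrix.mul_apply, Fin.sum_univ_succ] <;> field_simp <;>
    ring_nf <;> (try rw [hb]) <;> ring_nf

theorem matN_mul_waveMat {γ : ℝ} {eos : EOS} {V : State} {n : Pt} (hρ : V 0 ≠ 0)
    (hc : sound γ eos V ^ 2 = gammaTilde γ eos (V 4) * V 3 / V 0) (hn : IsUnitVec n) :
    matN γ eos V n * waveMat (V 0) (sound γ eos V) n.1 n.2 =
      waveMat (V 0) (sound γ eos V) n.1 n.2 * Matrix.diagonal ![normalVel V n, normalVel V n,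
        normalVel V n + sound γ eos V, normalVel V n - sound γ eos V, normalVel V n] := by
  have hg : gammaTilde γ eos (V 4) * V 3 = V 0 * sound γ eos V ^ 2 := by
    rw [hc]; field_simp
  have hb : n.2 ^ 2 = 1 - n.1 ^ 2 := by unfold IsUnitVec at hn; linarith
  generalize sound γ eos V = c at *
  ext i j
  rw [Matrix.mul_diagonal]
  fin_cases i <;> fin_cases j <;>
    simp [matN, matA, matB, waveMat, Matrix.mul_apply, Fin.sum_univ_succ, normalVel, hg] <;>
    field_simp <;> ring_nf <;> (try rw [hb]) <;> ring_nf

/-- The density row of the negative part of `matN`. -/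
noncomputable def densityRow (γ : ℝ) (eos : EOS) (n : Pt) (V : State) : State :=
  ![min (normalVel V n) 0,
    n.1 * (V 0 * (min (normalVel V n + sound γ eos V) 0 - min (normalVel V n - sound γ eos V) 0) /
      (2 * sound γ eos V)),
    n.2 * (V 0 * (min (normalVel V n + sound γ eos V) 0 - min (normalVel V n - sound γ eos V) 0) /
      (2 * sound γ eos V)),
    ((min (normalVel V n + sound γ eos V) 0 + min (normalVel V n - sound γ eos V) 0) / 2 -
      min (normalVel V n) 0) / sound γ eos V ^ 2,
    0]

/-- The marker row of the negative part of `matN`. -/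
noncomputable def markerRow (n : Pt) (V : State) : State :=
  ![0, 0, 0, 0, min (normalVel V n) 0]

theorem gammaTilde_gt_one {γ : ℝ} {eos : EOS} {χ : ℝ} (h : 0 < lam γ eos χ) :
    1 < gammaTilde γ eos χ := by
  have : 0 < 1 / lam γ eos χ := by positivity
  rw [gammaTilde]
  linarith

theorem sound_sq {γ : ℝ} {eos : EOS} {V : State} (h : Admissible γ eos V) :
    sound γ eos V ^ 2 = gammaTilde γ eos (V 4) * V 3 / V 0 := by
  have h1 := gammaTilde_gt_one h.2.2
  have h2 := h.1
  have h3 := h.2.1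
  exact Real.sq_sqrt (by positivity)

theorem sound_pos {γ : ℝ} {eos : EOS} {V : State} (h : Admissible γ eos V) :
    0 < sound γ eos V := by
  have h1 := gammaTilde_gt_one h.2.2
  have h2 := h.1
  have h3 := h.2.1
  exact Real.sqrt_pos.2 (by positivity)

theorem matNeg_matN {γ : ℝ} {eos : EOS} {V : State} {n : Pt} (h : Admissible γ eos V)
    (hn : IsUnitVec n) :
    matNeg (matN γ eos V n) = waveMat (V 0) (sound γ eos V) n.1 n.2 *
      (Matrix.diagonal fun a => min (![normalVel V n, normalVel V n,
        normalVel V n + sound γ eos V, normalVel V n - sound γ eos V, normalVel V n] a) 0) *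
      waveInv (V 0) (sound γ eos V) n.1 n.2 :=
  matNeg_eq (waveInv_mul_waveMat h.1.ne' (sound_pos h).ne' hn)
    (matN_mul_waveMat h.1.ne' (sound_sq h) hn)

theorem matNeg_matN_density {γ : ℝ} {eos : EOS} {V : State} {n : Pt} (h : Admissible γ eos V)
    (hn : IsUnitVec n) (b : Fin 5) :
    matNeg (matN γ eos V n) 0 b = densityRow γ eos n V b := by
  rw [matNeg_matN h hn, Matrix.mul_apply]
  simp only [Matrix.mul_diagonal]
  have h0 := h.1.ne'
  have hc := (sound_pos h).ne'
  fin_cases b <;> simp [waveMat, waveInv, densityRow, Fin.sum_univ_succ] <;> field_simp <;> ring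

theorem matNeg_matN_marker {γ : ℝ} {eos : EOS} {V : State} {n : Pt} (h : Admissible γ eos V)
    (hn : IsUnitVec n) (b : Fin 5) :
    matNeg (matN γ eos V n) 4 b = markerRow n V b := by
  rw [matNeg_matN h hn, Matrix.mul_apply]
  simp only [Matrix.mul_diagonal]
  fin_cases b <;> simp [waveMat, waveInv, markerRow, Fin.sum_univ_succ]

/-! ### Measurability -/

@[fun_prop]
theorem measurable_lam (γ : ℝ) (eos : EOS) : Measurable (lam γ eos) := by
  cases eos
  · change Measurable fun χ : ℝ => χ / (γ - 1)
    fun_prop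
  · change Measurable fun χ : ℝ => 1 / (χ * γ - 1)
    fun_prop

@[fun_prop]
theorem measurable_gammaTilde (γ : ℝ) (eos : EOS) : Measurable (gammaTilde γ eos) := by
  unfold gammaTilde
  fun_prop

@[fun_prop]
theorem measurable_sound (γ : ℝ) (eos : EOS) : Measurable (sound γ eos) := by
  unfold sound
  fun_prop

@[fun_prop]
theorem continuous_normalVel (n : Pt) : Continuous fun V => normalVel V n := by
  unfold normalVel
  fun_prop

/-- The formula for the density row is measurable on all of `State`, admissible or not. -/
theorem measurable_densityRow (γ : ℝ) (eos : EOS) (n : Pt) (b : Fin 5) :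
    Measurable fun V => densityRow γ eos n V b := by
  have h := (continuous_normalVel n).measurable
  fin_cases b <;> simp only [densityRow] <;> simp <;> fun_prop

theorem measurable_markerRow (n : Pt) (b : Fin 5) : Measurable fun V => markerRow n V b := by
  have h := (continuous_normalVel n).measurable
  fin_cases b <;> simp only [markerRow] <;> simp; fun_prop

theorem continuous_path : Continuous fun z : (State × State) × ℝ => path z.1.1 z.1.2 z.2 := by
  unfold path
  fun_prop

theorem measurable_integral_path {r : State → ℝ} (hr : Measurable r) :
    Measurable fun z : State × State => ∫ s in (0 : ℝ)..1, r (path z.1 z.2 s) := by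
  simp only [intervalIntegral.integral_of_le zero_le_one]
  exact (StronglyMeasurable.integral_prod_right
    (f := fun (z : State × State) (s : ℝ) => r (path z.1 z.2 s))
    (hr.comp continuous_path.measurable).stronglyMeasurable).measurable

/-! ### States near a contact -/

theorem IsUnitVec.abs_fst_le {n : Pt} (hn : IsUnitVec n) : |n.1| ≤ 1 := by
  unfold IsUnitVec at hn
  rw [← sq_le_one_iff_abs_le_one]; nlinarith

theorem IsUnitVec.abs_snd_le {n : Pt} (hn : IsUnitVec n) : |n.2| ≤ 1 := by
  unfold IsUnitVec at hn
  rw [← sq_le_one_iff_abs_le_one]; nlinarith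

theorem lam_pos_of_mem_uIcc {γ : ℝ} (hγ : 1 < γ) {eos : EOS} {χ₁ χ₂ χ : ℝ}
    (h1 : 0 < lam γ eos χ₁) (h2 : 0 < lam γ eos χ₂) (h : χ ∈ Set.uIcc χ₁ χ₂) :
    0 < lam γ eos χ ∧ lam γ eos χ ≤ lam γ eos χ₁ + lam γ eos χ₂ := by
  have hg : 0 < γ - 1 := by linarith
  cases eos
  · simp only [lam] at *
    rw [← add_div]
    have h1' := (div_pos_iff_of_pos_right hg).1 h1
    have h2' := (div_pos_iff_of_pos_right hg).1 h2
    rcases Set.mem_uIcc.1 h with ⟨ha, hb⟩ | ⟨ha, hb⟩ <;>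
      exact ⟨by apply div_pos <;> linarith, by gcongr; linarith⟩
  · simp only [lam] at *
    have h1' := one_div_pos.1 h1
    have h2' := one_div_pos.1 h2
    rcases Set.mem_uIcc.1 h with ⟨ha, hb⟩ | ⟨ha, hb⟩
    · have h3 : χ₁ * γ - 1 ≤ χ * γ - 1 := by nlinarith
      have := one_div_le_one_div_of_le h1' h3
      exact ⟨one_div_pos.2 (by linarith), by linarith⟩
    · have h3 : χ₂ * γ - 1 ≤ χ * γ - 1 := by nlinarith
      have := one_div_le_one_div_of_le h2' h3
      exact ⟨one_div_pos.2 (by linarith), by linarith⟩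

theorem abs_convex_le {x y a e s : ℝ} (hx : |x - a| ≤ e) (hy : |y - a| ≤ e)
    (hs : s ∈ Set.Icc (0 : ℝ) 1) : |x + s * (y - x) - a| ≤ e := by
  rw [abs_le] at *
  constructor <;> nlinarith [hs.1, hs.2]

namespace NearContact

variable {χ₁ χ₂ M e u₀ v₀ p₀ : ℝ} {V W : State}

theorem mono (h : NearContact χ₁ χ₂ M e u₀ v₀ p₀ V) {e' : ℝ} (he : e ≤ e') :
    NearContact χ₁ χ₂ M e' u₀ v₀ p₀ V :=
  ⟨h.1.trans he, h.2.1.trans he, h.2.2.1.trans he, h.2.2.2⟩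

theorem path_mem (hV : NearContact χ₁ χ₂ M e u₀ v₀ p₀ V)
    (hW : NearContact χ₁ χ₂ M e u₀ v₀ p₀ W) {s : ℝ} (hs : s ∈ Set.Icc (0 : ℝ) 1) :
    NearContact χ₁ χ₂ M e u₀ v₀ p₀ (path V W s) := by
  have hp : ∀ i, path V W s i = V i + s * (W i - V i) := fun i => rfl
  refine ⟨?_, ?_, ?_, ?_, ?_, ?_⟩ <;> rw [hp]
  · exact abs_convex_le hV.1 hW.1 hs
  · exact abs_convex_le hV.2.1 hW.2.1 hs
  · exact abs_convex_le hV.2.2.1 hW.2.2.1 hs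
  · nlinarith [hV.2.2.2.1, hW.2.2.2.1, hs.1, hs.2]
  · nlinarith [hV.2.2.2.2.1, hW.2.2.2.2.1, hs.1, hs.2]
  · have := (convex_uIcc χ₁ χ₂) hV.2.2.2.2.2 hW.2.2.2.2.2 (sub_nonneg.2 hs.2) hs.1 (by ring)
    convert this using 1
    simp only [smul_eq_mul]
    ring

theorem admissible {γ : ℝ} (hγ : 1 < γ) {eos : EOS} (h1 : 0 < lam γ eos χ₁)
    (h2 : 0 < lam γ eos χ₂) (hM : 0 < M) (hp : 1 / M ≤ p₀) (he : e ≤ 1 / (2 * M))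
    (hV : NearContact χ₁ χ₂ M e u₀ v₀ p₀ V) : Admissible γ eos V ∧ 1 / (2 * M) ≤ V 3 := by
  have hM' : 0 < 1 / M := by positivity
  have h3 : 1 / (2 * M) + 1 / (2 * M) = 1 / M := by field_simp; norm_num
  have h4 := (abs_le.1 hV.2.2.1).1
  have h5 : 1 / (2 * M) ≤ V 3 := by linarith
  have h6 : 0 < 1 / (2 * M) := by positivity
  exact ⟨⟨hM'.trans_le hV.2.2.2.1, h6.trans_le h5,
    (lam_pos_of_mem_uIcc hγ h1 h2 hV.2.2.2.2.2).1⟩, h5⟩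

theorem abs_normalVel_sub (hV : NearContact χ₁ χ₂ M e u₀ v₀ p₀ V) {n : Pt} (hn : IsUnitVec n) :
    |normalVel V n - (u₀ * n.1 + v₀ * n.2)| ≤ 2 * e := by
  have h1 := hn.abs_fst_le
  have h2 := hn.abs_snd_le
  have he : 0 ≤ e := (abs_nonneg _).trans hV.1
  have : normalVel V n - (u₀ * n.1 + v₀ * n.2) = (V 1 - u₀) * n.1 + (V 2 - v₀) * n.2 := by
    unfold normalVel; ring
  rw [this]
  refine (abs_add_le _ _).trans ?_
  rw [abs_mul, abs_mul]
  nlinarith [mul_le_mul hV.1 h1 (abs_nonneg _) he, mul_le_mul hV.2.1 h2 (abs_nonneg _) he]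

end NearContact

theorem abs_min_zero_sub_le (x y : ℝ) : |min x 0 - min y 0| ≤ |x - y| := by
  simpa using abs_min_sub_min_le_max x 0 y 0

theorem abs_max_zero_sub_le (x y : ℝ) : |max x 0 - max y 0| ≤ |x - y| := by
  simpa using abs_max_sub_max_le_max x 0 y 0

/-! ### The face fluctuation near a contact -/

section Fluctuation

variable {γ : ℝ} {eos : EOS} {χ₁ χ₂ M e u₀ v₀ p₀ : ℝ} {n : Pt} {V W : State}

theorem fluctuation_density (hγ : 1 < γ) (h1 : 0 < lam γ eos χ₁) (h2 : 0 < lam γ eos χ₂)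
    (hM : 0 < M) (hp : 1 / M ≤ p₀) (he : e ≤ 1 / (2 * M)) (hn : IsUnitVec n)
    (hV : NearContact χ₁ χ₂ M e u₀ v₀ p₀ V) (hW : NearContact χ₁ χ₂ M e u₀ v₀ p₀ W) :
    fluctuation γ eos n V W 0 =
      ∑ b, (∫ s in (0 : ℝ)..1, densityRow γ eos n (path V W s) b) * (W b - V b) := by
  simp only [fluctuation, Matrix.mulVec, dotProduct, matD, Matrix.of_apply, Pi.sub_apply]
  refine Finset.sum_congr rfl fun b _ => ?_
  congr 1
  refine intervalIntegral.integral_congr fun s hs => ?_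
  rw [Set.uIcc_of_le zero_le_one] at hs
  exact matNeg_matN_density ((hV.path_mem hW hs).admissible hγ h1 h2 hM hp he).1 hn b

theorem fluctuation_marker (hγ : 1 < γ) (h1 : 0 < lam γ eos χ₁) (h2 : 0 < lam γ eos χ₂)
    (hM : 0 < M) (hp : 1 / M ≤ p₀) (he : e ≤ 1 / (2 * M)) (hn : IsUnitVec n)
    (hV : NearContact χ₁ χ₂ M e u₀ v₀ p₀ V) (hW : NearContact χ₁ χ₂ M e u₀ v₀ p₀ W) :
    fluctuation γ eos n V W 4 =
      ∑ b, (∫ s in (0 : ℝ)..1, markerRow n (path V W s) b) * (W b - V b) := by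
  simp only [fluctuation, Matrix.mulVec, dotProduct, matD, Matrix.of_apply, Pi.sub_apply]
  refine Finset.sum_congr rfl fun b _ => ?_
  congr 1
  refine intervalIntegral.integral_congr fun s hs => ?_
  rw [Set.uIcc_of_le zero_le_one] at hs
  exact matNeg_matN_marker ((hV.path_mem hW hs).admissible hγ h1 h2 hM hp he).1 hn b

theorem abs_integral_min_normalVel_sub (hn : IsUnitVec n)
    (hV : NearContact χ₁ χ₂ M e u₀ v₀ p₀ V) (hW : NearContact χ₁ χ₂ M e u₀ v₀ p₀ W) :
    |(∫ s in (0 : ℝ)..1, min (normalVel (path V W s) n) 0) - min (u₀ * n.1 + v₀ * n.2) 0|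
      ≤ 2 * e := by
  have hc : Continuous fun s => min (normalVel (path V W s) n) 0 := by
    unfold path normalVel
    fun_prop
  have h0 : (∫ s in (0 : ℝ)..1, min (normalVel (path V W s) n) 0) - min (u₀ * n.1 + v₀ * n.2) 0 =
      ∫ s in (0 : ℝ)..1, (min (normalVel (path V W s) n) 0 - min (u₀ * n.1 + v₀ * n.2) 0) := by
    rw [intervalIntegral.integral_sub (hc.intervalIntegrable _ _) intervalIntegrable_const]
    simp
  rw [h0]
  have := intervalIntegral.norm_integral_le_of_norm_le_const (a := 0) (b := 1) (C := 2 * e)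
    (f := fun s => min (normalVel (path V W s) n) 0 - min (u₀ * n.1 + v₀ * n.2) 0) fun s hs => by
      rw [Set.uIoc_of_le zero_le_one] at hs
      exact (abs_min_zero_sub_le _ _).trans
        ((hV.path_mem hW ⟨hs.1.le, hs.2⟩).abs_normalVel_sub hn)
  simpa using this

theorem abs_densityRow_le (hM : 0 < M) (hV : Admissible γ eos V) (hρ' : V 0 ≤ M)
    (hp : 1 / (2 * M) ≤ V 3) (hn : IsUnitVec n) :
    |densityRow γ eos n V 1| ≤ M ∧ |densityRow γ eos n V 2| ≤ M ∧
      |densityRow γ eos n V 3| ≤ 2 * M := by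
  have hc := sound_pos hV
  have hc2 := sound_sq hV
  have hg := gammaTilde_gt_one hV.2.2
  have hρ0 := hV.1
  have hcM : 1 / (2 * M ^ 2) ≤ sound γ eos V ^ 2 := by
    have h3 : 0 < 1 / (2 * M) := by positivity
    have h4 : 0 < V 3 := hV.2.1
    calc 1 / (2 * M ^ 2) = (1 * (1 / (2 * M))) / M := by field_simp
      _ ≤ sound γ eos V ^ 2 := by rw [hc2]; gcongr
  set c := sound γ eos V
  have hd : |min (normalVel V n + c) 0 - min (normalVel V n - c) 0| ≤ 2 * c := by
    refine (abs_min_zero_sub_le _ _).trans (le_of_eq ?_)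
    rw [show normalVel V n + c - (normalVel V n - c) = 2 * c by ring, abs_of_pos (by positivity)]
  have hq : |V 0 * (min (normalVel V n + c) 0 - min (normalVel V n - c) 0) / (2 * c)| ≤ M := by
    rw [abs_div, abs_mul, abs_of_pos hρ0, abs_of_pos (by positivity : (0 : ℝ) < 2 * c),
      div_le_iff₀ (by positivity)]
    exact mul_le_mul hρ' hd (abs_nonneg _) hM.le
  refine ⟨?_, ?_, ?_⟩
  · change |n.1 * _| ≤ M
    rw [abs_mul]
    exact (mul_le_of_le_one_left (abs_nonneg _) hn.abs_fst_le).trans hq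
  · change |n.2 * _| ≤ M
    rw [abs_mul]
    exact (mul_le_of_le_one_left (abs_nonneg _) hn.abs_snd_le).trans hq
  · change |((min (normalVel V n + c) 0 + min (normalVel V n - c) 0) / 2 -
      min (normalVel V n) 0) / c ^ 2| ≤ 2 * M
    have ha : |min (normalVel V n + c) 0 - min (normalVel V n) 0| ≤ c := by
      refine (abs_min_zero_sub_le _ _).trans (le_of_eq ?_)
      rw [add_sub_cancel_left, abs_of_pos hc]
    have hb : |min (normalVel V n - c) 0 - min (normalVel V n) 0| ≤ c := by
      refine (abs_min_zero_sub_le _ _).trans (le_of_eq ?_)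
      rw [sub_sub_cancel_left, abs_neg, abs_of_pos hc]
    rw [abs_div, abs_of_pos (by positivity : 0 < c ^ 2), div_le_iff₀ (by positivity)]
    have hnum : |(min (normalVel V n + c) 0 + min (normalVel V n - c) 0) / 2 -
        min (normalVel V n) 0| ≤ c := by
      rw [abs_le] at *
      constructor <;> linarith [ha.1, ha.2, hb.1, hb.2]
    refine hnum.trans ?_
    -- `c ≤ 2 M c²` because `c` is at least `1 / (2 M)`
    have h1 : 1 ≤ 2 * M * c := by
      rw [div_le_iff₀ (by positivity)] at hcM
      by_contra hlt
      push Not at hlt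
      have h5 : 0 < M * c := by positivity
      nlinarith
    nlinarith

/-- Near a contact, the density jump is convected with the constant normal velocity. -/
theorem abs_fluctuation_density_sub (hγ : 1 < γ) (h1 : 0 < lam γ eos χ₁)
    (h2 : 0 < lam γ eos χ₂) (hM : 0 < M) (hp : 1 / M ≤ p₀) (he : e ≤ 1 / (2 * M))
    (hn : IsUnitVec n) (hV : NearContact χ₁ χ₂ M e u₀ v₀ p₀ V)
    (hW : NearContact χ₁ χ₂ M e u₀ v₀ p₀ W) :
    |fluctuation γ eos n V W 0 - min (u₀ * n.1 + v₀ * n.2) 0 * (W 0 - V 0)| ≤ 10 * M * e := by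
  have he0 : 0 ≤ e := (abs_nonneg _).trans hV.1
  have hb : ∀ b : Fin 5, ∀ B : ℝ, (∀ s ∈ Set.Icc (0 : ℝ) 1,
      |densityRow γ eos n (path V W s) b| ≤ B) →
      |∫ s in (0 : ℝ)..1, densityRow γ eos n (path V W s) b| ≤ B := by
    intro b B hB
    have := intervalIntegral.norm_integral_le_of_norm_le_const (a := 0) (b := 1) (C := B)
      (f := fun s => densityRow γ eos n (path V W s) b) fun s hs => by
        rw [Set.uIoc_of_le zero_le_one] at hs
        exact hB s ⟨hs.1.le, hs.2⟩
    simpa using this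
  have hr : ∀ s ∈ Set.Icc (0 : ℝ) 1, _ := fun s hs =>
    have hP := hV.path_mem hW hs
    have hA := hP.admissible hγ h1 h2 hM hp he
    abs_densityRow_le hM hA.1 hP.2.2.2.2.1 hA.2 hn
  have e1 := hb 1 M fun s hs => (hr s hs).1
  have e2 := hb 2 M fun s hs => (hr s hs).2.1
  have e3 := hb 3 (2 * M) fun s hs => (hr s hs).2.2
  have e0 := abs_integral_min_normalVel_sub hn hV hW
  have d0 : |W 0 - V 0| ≤ M := by
    have : 0 < 1 / M := by positivity
    rw [abs_le]
    constructor <;> linarith [hV.2.2.2.1, hV.2.2.2.2.1, hW.2.2.2.1, hW.2.2.2.2.1]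
  have dd : ∀ x y a : ℝ, |x - a| ≤ e → |y - a| ≤ e → |x - y| ≤ 2 * e := by
    intro x y a hx hy
    rw [abs_le] at *
    constructor <;> linarith [hx.1, hx.2, hy.1, hy.2]
  have d1 := dd _ _ _ hW.1 hV.1
  have d2 := dd _ _ _ hW.2.1 hV.2.1
  have d3 := dd _ _ _ hW.2.2.1 hV.2.2.1
  rw [fluctuation_density hγ h1 h2 hM hp he hn hV hW]
  simp only [Fin.sum_univ_five]
  have z0 : ∀ s, densityRow γ eos n (path V W s) 0 = min (normalVel (path V W s) n) 0 :=
    fun s => rfl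
  have z4 : ∀ s, densityRow γ eos n (path V W s) 4 = 0 := fun s => rfl
  simp only [z0, z4, intervalIntegral.integral_zero, zero_mul, add_zero]
  set I0 := ∫ s in (0 : ℝ)..1, min (normalVel (path V W s) n) 0
  set I1 := ∫ s in (0 : ℝ)..1, densityRow γ eos n (path V W s) 1
  set I2 := ∫ s in (0 : ℝ)..1, densityRow γ eos n (path V W s) 2
  set I3 := ∫ s in (0 : ℝ)..1, densityRow γ eos n (path V W s) 3
  have m0 : |(I0 - min (u₀ * n.1 + v₀ * n.2) 0) * (W 0 - V 0)| ≤ 2 * e * M := by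
    rw [abs_mul]; exact mul_le_mul e0 d0 (abs_nonneg _) (by positivity)
  have m1 : |I1 * (W 1 - V 1)| ≤ M * (2 * e) := by
    rw [abs_mul]; exact mul_le_mul e1 d1 (abs_nonneg _) hM.le
  have m2 : |I2 * (W 2 - V 2)| ≤ M * (2 * e) := by
    rw [abs_mul]; exact mul_le_mul e2 d2 (abs_nonneg _) hM.le
  have m3 : |I3 * (W 3 - V 3)| ≤ 2 * M * (2 * e) := by
    rw [abs_mul]; exact mul_le_mul e3 d3 (abs_nonneg _) (by positivity)
  rw [abs_le] at *
  constructor <;> linarith [m0.1, m0.2, m1.1, m1.2, m2.1, m2.2, m3.1, m3.2]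

/-- Near a contact, the jump of the marker is convected with the constant normal velocity. -/
theorem abs_fluctuation_marker_sub (hγ : 1 < γ) (h1 : 0 < lam γ eos χ₁)
    (h2 : 0 < lam γ eos χ₂) (hM : 0 < M) (hp : 1 / M ≤ p₀) (he : e ≤ 1 / (2 * M))
    (hn : IsUnitVec n) (hV : NearContact χ₁ χ₂ M e u₀ v₀ p₀ V)
    (hW : NearContact χ₁ χ₂ M e u₀ v₀ p₀ W) :
    |fluctuation γ eos n V W 4 - min (u₀ * n.1 + v₀ * n.2) 0 * (W 4 - V 4)| ≤
      2 * |χ₂ - χ₁| * e := by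
  have he0 : 0 ≤ e := (abs_nonneg _).trans hV.1
  have e0 := abs_integral_min_normalVel_sub hn hV hW
  rw [fluctuation_marker hγ h1 h2 hM hp he hn hV hW]
  simp only [Fin.sum_univ_five]
  have z4 : ∀ s, markerRow n (path V W s) 4 = min (normalVel (path V W s) n) 0 := fun s => rfl
  have z0 : ∀ s, markerRow n (path V W s) 0 = 0 := fun s => rfl
  have z1 : ∀ s, markerRow n (path V W s) 1 = 0 := fun s => rfl
  have z2 : ∀ s, markerRow n (path V W s) 2 = 0 := fun s => rfl
  have z3 : ∀ s, markerRow n (path V W s) 3 = 0 := fun s => rfl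
  simp only [z0, z1, z2, z3, z4, intervalIntegral.integral_zero, zero_mul, zero_add]
  rw [← sub_mul, abs_mul]
  calc _ ≤ 2 * e * |χ₂ - χ₁| := mul_le_mul e0
        (Set.abs_sub_le_of_uIcc_subset_uIcc (Set.uIcc_subset_uIcc hV.2.2.2.2.2 hW.2.2.2.2.2))
        (abs_nonneg _) (by positivity)
    _ = _ := by ring

end Fluctuation

/-! ### The numerical flux -/

/-- The numerical flux: the conserved variables are upwinded with the mean normal velocity of the
two states, and the pressure terms use the mean pressure. -/
noncomputable def upwindFlux (γ : ℝ) (eos : EOS) : NumFlux := fun n V W c =>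
  max ((normalVel V n + normalVel W n) / 2) 0 * consVar γ eos V c +
    min ((normalVel V n + normalVel W n) / 2) 0 * consVar γ eos W c +
    (V 3 + W 3) / 2 * (![0, n.1, n.2, (normalVel V n + normalVel W n) / 2, 0] : State) c

theorem upwindFlux_consistent (γ : ℝ) (eos : EOS) (n : Pt) (V : State) :
    upwindFlux γ eos n V V = physFlux γ eos V n := by
  have h : max (normalVel V n) 0 + min (normalVel V n) 0 = normalVel V n := by
    rw [max_add_min, add_zero]
  ext c
  simp only [upwindFlux, add_self_div_two]
  rw [← add_mul, h]
  fin_cases c <;> simp [consVar, physFlux] <;> ring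

theorem upwindFlux_face (γ : ℝ) (eos : EOS) (n : Pt) (V W : State) :
    upwindFlux γ eos n V W + upwindFlux γ eos (-n) W V = 0 := by
  have h : (normalVel W (-n) + normalVel V (-n)) / 2 = -((normalVel V n + normalVel W n) / 2) := by
    simp only [normalVel, Prod.fst_neg, Prod.snd_neg]
    ring
  ext c
  simp only [upwindFlux, Pi.add_apply, Pi.zero_apply]
  rw [h]
  generalize (normalVel V n + normalVel W n) / 2 = u
  have h1 : max (-u) 0 = -min u 0 := by
    rcases le_total u 0 with hu | hu <;> simp [hu]
  have h2 : min (-u) 0 = -max u 0 := by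
    rcases le_total u 0 with hu | hu <;> simp [hu]
  rw [h1, h2]
  fin_cases c <;> simp <;> ring

/-- A two-point function that is bounded and Lipschitz on `K × K`, uniformly in the direction. -/
def BddLip (K : Set State) (f : Pt → State → State → ℝ) : Prop :=
  ∃ B L : ℝ, 0 ≤ B ∧ 0 ≤ L ∧ (∀ n, IsUnitVec n → ∀ V ∈ K, ∀ W ∈ K, |f n V W| ≤ B) ∧
    ∀ n, IsUnitVec n → ∀ V ∈ K, ∀ W ∈ K, ∀ V' ∈ K, ∀ W' ∈ K,
      |f n V W - f n V' W'| ≤ L * (‖V - V'‖ + ‖W - W'‖)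

namespace BddLip

variable {K : Set State} {f g : Pt → State → State → ℝ}

theorem of_dir {a : Pt → ℝ} {B : ℝ} (hB : 0 ≤ B) (ha : ∀ n, IsUnitVec n → |a n| ≤ B) :
    BddLip K fun n _ _ => a n :=
  ⟨B, 0, hB, le_rfl, fun n hn _ _ _ _ => ha n hn, by simp⟩

theorem snd (h : BddLip K f) : BddLip K fun n _ W => f n W W := by
  obtain ⟨B, L, hB, hL, h1, h2⟩ := h
  refine ⟨B, 2 * L, hB, by positivity, fun n hn _ _ V hV => h1 n hn V hV V hV,
    fun n hn W _ V hV W' _ V' hV' => (h2 n hn V hV V hV V' hV' V' hV').trans ?_⟩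
  nlinarith [mul_nonneg hL (norm_nonneg (W - W'))]

theorem coord (hK : IsCompact K) (i : Fin 5) : BddLip K fun _ V _ => V i := by
  obtain ⟨B, hB⟩ := hK.exists_bound_of_continuousOn (f := fun V : State => V i) (by fun_prop)
  refine ⟨|B|, 1, abs_nonneg _, zero_le_one,
    fun _ _ V hV _ _ => (hB V hV).trans (le_abs_self _), fun _ _ V _ W _ V' _ W' _ => ?_⟩
  have := norm_le_pi_norm (V - V') i
  rw [Pi.sub_apply, Real.norm_eq_abs] at this
  linarith [norm_nonneg (W - W')]

theorem add (hf : BddLip K f) (hg : BddLip K g) : BddLip K fun n V W => f n V W + g n V W := by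
  obtain ⟨B, L, hB, hL, h1, h2⟩ := hf
  obtain ⟨B', L', hB', hL', h1', h2'⟩ := hg
  refine ⟨B + B', L + L', by positivity, by positivity, fun n hn V hV W hW =>
    (abs_add_le _ _).trans (add_le_add (h1 n hn V hV W hW) (h1' n hn V hV W hW)),
    fun n hn V hV W hW V' hV' W' hW' => ?_⟩
  rw [add_sub_add_comm, add_mul]
  exact (abs_add_le _ _).trans
    (add_le_add (h2 n hn V hV W hW V' hV' W' hW') (h2' n hn V hV W hW V' hV' W' hW'))

theorem mul (hf : BddLip K f) (hg : BddLip K g) : BddLip K fun n V W => f n V W * g n V W := by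
  obtain ⟨B, L, hB, hL, h1, h2⟩ := hf
  obtain ⟨B', L', hB', hL', h1', h2'⟩ := hg
  refine ⟨B * B', B * L' + L * B', by positivity, by positivity, fun n hn V hV W hW => ?_,
    fun n hn V hV W hW V' hV' W' hW' => ?_⟩
  · rw [abs_mul]
    exact mul_le_mul (h1 n hn V hV W hW) (h1' n hn V hV W hW) (abs_nonneg _) hB
  · have e : f n V W * g n V W - f n V' W' * g n V' W' =
        f n V W * (g n V W - g n V' W') + (f n V W - f n V' W') * g n V' W' := by ring
    rw [e]
    refine (abs_add_le _ _).trans ?_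
    rw [abs_mul, abs_mul]
    have m1 := mul_le_mul (h1 n hn V hV W hW) (h2' n hn V hV W hW V' hV' W' hW')
      (abs_nonneg _) hB
    have m2 := mul_le_mul (h2 n hn V hV W hW V' hV' W' hW') (h1' n hn V' hV' W' hW')
      (abs_nonneg _) (by positivity)
    calc _ ≤ _ := add_le_add m1 m2
      _ = _ := by ring

theorem lipschitz_comp (hf : BddLip K f) {φ : ℝ → ℝ} (hφ : ∀ x y, |φ x - φ y| ≤ |x - y|)
    (hφ0 : φ 0 = 0) : BddLip K fun n V W => φ (f n V W) := by
  obtain ⟨B, L, hB, hL, h1, h2⟩ := hf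
  refine ⟨B, L, hB, hL, fun n hn V hV W hW => ?_, fun n hn V hV W hW V' hV' W' hW' =>
    (hφ _ _).trans (h2 n hn V hV W hW V' hV' W' hW')⟩
  have := hφ (f n V W) 0
  rw [hφ0, sub_zero, sub_zero] at this
  exact this.trans (h1 n hn V hV W hW)

theorem inv (hf : BddLip K f) {δ : ℝ} (hδ : 0 < δ)
    (h : ∀ n, IsUnitVec n → ∀ V ∈ K, ∀ W ∈ K, δ ≤ f n V W) :
    BddLip K fun n V W => 1 / f n V W := by
  obtain ⟨B, L, hB, hL, h1, h2⟩ := hf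
  refine ⟨1 / δ, L / δ ^ 2, by positivity, by positivity, fun n hn V hV W hW => ?_,
    fun n hn V hV W hW V' hV' W' hW' => ?_⟩
  · have := h n hn V hV W hW
    rw [abs_of_pos (one_div_pos.2 (hδ.trans_le this))]
    exact one_div_le_one_div_of_le hδ this
  · have p1 := h n hn V hV W hW
    have p2 := h n hn V' hV' W' hW'
    have q1 := hδ.trans_le p1
    have q2 := hδ.trans_le p2
    have e : 1 / f n V W - 1 / f n V' W' = (f n V' W' - f n V W) / (f n V W * f n V' W') := by
      field_simp
    rw [e, abs_div, abs_sub_comm, abs_of_pos (mul_pos q1 q2), div_mul_eq_mul_div]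
    refine div_le_div₀ (by positivity) (h2 n hn V hV W hW V' hV' W' hW') (by positivity) ?_
    rw [sq]
    exact mul_le_mul p1 p2 hδ.le q1.le

theorem const_mul (hf : BddLip K f) (c : ℝ) : BddLip K fun n V W => c * f n V W :=
  (of_dir (abs_nonneg c) fun _ _ => le_rfl).mul hf

end BddLip

theorem bddLip_lam {γ : ℝ} {eos : EOS} {K : Set State} (hK : IsCompact K)
    (hA : ∀ V ∈ K, Admissible γ eos V) : BddLip K fun _ V _ => lam γ eos (V 4) := by
  have h4 := BddLip.coord hK 4
  cases eos
  · have := h4.const_mul (1 / (γ - 1))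
    simpa only [lam, one_div_mul_eq_div] using this
  · have h := (h4.const_mul γ).add (BddLip.of_dir (K := K) (a := fun _ => -1) zero_le_one (by simp))
    have hpos : ∃ δ > 0, ∀ V ∈ K, δ ≤ γ * V 4 + -1 := by
      rcases K.eq_empty_or_nonempty with rfl | hne
      · exact ⟨1, one_pos, by simp⟩
      · obtain ⟨V₀, hV₀, hmin⟩ := hK.exists_isMinOn hne
          (f := fun V : State => γ * V 4 + -1) (by fun_prop)
        have := one_div_pos.1 (hA V₀ hV₀).2.2
        exact ⟨γ * V₀ 4 + -1, by linarith, fun V hV => hmin hV⟩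
    obtain ⟨δ, hδ, hle⟩ := hpos
    have := h.inv hδ fun _ _ V hV _ _ => hle V hV
    simpa only [lam, mul_comm γ, ← sub_eq_add_neg] using this

theorem bddLip_normalVel {K : Set State} (hK : IsCompact K) :
    BddLip K fun n V _ => normalVel V n :=
  ((BddLip.coord hK 1).mul (BddLip.of_dir zero_le_one fun _ hn => hn.abs_fst_le)).add
    ((BddLip.coord hK 2).mul (BddLip.of_dir zero_le_one fun _ hn => hn.abs_snd_le))

theorem bddLip_consVar {γ : ℝ} {eos : EOS} {K : Set State} (hK : IsCompact K)
    (hA : ∀ V ∈ K, Admissible γ eos V) (c : Fin 5) :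
    BddLip K fun _ V _ => consVar γ eos V c := by
  have k := BddLip.coord hK
  have hkin : BddLip K fun _ V _ => kinetic V := by
    have := (((k 1).mul (k 1)).const_mul (1 / 2)).add (((k 2).mul (k 2)).const_mul (1 / 2))
    simpa only [kinetic, sq, one_div_mul_eq_div] using this
  fin_cases c
  · exact k 0
  · exact (k 0).mul (k 1)
  · exact (k 0).mul (k 2)
  · exact ((bddLip_lam hK hA).mul (k 3)).add ((k 0).mul hkin)
  · exact (k 0).mul (k 4)

theorem bddLip_upwindFlux {γ : ℝ} {eos : EOS} {K : Set State} (hK : IsCompact K)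
    (hA : ∀ V ∈ K, Admissible γ eos V) (c : Fin 5) :
    BddLip K fun n V W => upwindFlux γ eos n V W c := by
  have hu : BddLip K fun n V W => (normalVel V n + normalVel W n) / 2 := by
    have := ((bddLip_normalVel hK).add (bddLip_normalVel hK).snd).const_mul (1 / 2)
    simpa only [one_div_mul_eq_div] using this
  have hp : BddLip K fun _ V W => (V 3 + W 3) / 2 := by
    have := ((BddLip.coord hK 3).add (BddLip.coord hK 3).snd).const_mul (1 / 2)
    simpa only [one_div_mul_eq_div] using this
  have hQ := bddLip_consVar hK hA c
  refine (((hu.lipschitz_comp abs_max_zero_sub_le (max_self 0)).mul hQ).add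
    ((hu.lipschitz_comp abs_min_zero_sub_le (min_self 0)).mul hQ.snd)).add (hp.mul ?_)
  fin_cases c
  · exact BddLip.of_dir le_rfl (a := fun _ => 0) (by simp)
  · exact BddLip.of_dir zero_le_one fun _ hn => hn.abs_fst_le
  · exact BddLip.of_dir zero_le_one fun _ hn => hn.abs_snd_le
  · exact hu
  · exact BddLip.of_dir le_rfl (a := fun _ => 0) (by simp)

theorem isNumericalFlux_upwindFlux (γ : ℝ) (eos : EOS) :
    IsNumericalFlux γ eos (upwindFlux γ eos) where
  consistent n V _ _ := upwindFlux_consistent γ eos n V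
  face n V W _ _ _ := upwindFlux_face γ eos n V W
  lipschitz K hK hA := by
    choose B L hB hL _ h using bddLip_upwindFlux hK hA
    refine ⟨∑ c, L c, fun n hn V hV W hW V' hV' W' hW' => ?_⟩
    have hs : 0 ≤ ∑ c, L c := Finset.sum_nonneg fun c _ => hL c
    refine (pi_norm_le_iff_of_nonneg (by positivity)).2 fun c => ?_
    refine (h c n hn V hV W hW V' hV' W' hW').trans ?_
    gcongr
    exact Finset.single_le_sum (fun c _ => hL c) (Finset.mem_univ c)

/-! ### Conserved variables and flux near a contact -/

/-- The coefficient of the density in the conserved variables of a contact. -/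
noncomputable def densCoef (u₀ v₀ : ℝ) : State := ![1, u₀, v₀, u₀ ^ 2 / 2 + v₀ ^ 2 / 2, 0]

/-- The coefficient of the marker in the conserved variables of a contact with
`λ(χ) = α + β χ`. -/
def markCoef (β p₀ : ℝ) : State := ![0, 0, 0, β * p₀, 0]

/-- The constant term of the conserved variables of a contact with `λ(χ) = α + β χ`. -/
def constCoef (α p₀ : ℝ) : State := ![0, 0, 0, α * p₀, 0]

/-- The conserved variables of a contact, affine in the density and the marker. -/
noncomputable def contactCons (u₀ v₀ p₀ α β : ℝ) (c : Fin 5) (V : State) : ℝ :=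
  densCoef u₀ v₀ c * V 0 + markCoef β p₀ c * V 4 + constCoef α p₀ c

/-- Bounds near a contact for the first four conserved variables and for their distance to
`contactCons`; `Λ` bounds `λ` and `e` bounds its distance to `α + β χ`. -/
theorem consVar_near {γ : ℝ} {eos : EOS} {χ₁ χ₂ M e u₀ v₀ p₀ Λ α β : ℝ} (hM : 1 ≤ M)
    (he : e ≤ 1 / 2) (hu : |u₀| ≤ M) (hv : |v₀| ≤ M) (hp : |p₀| ≤ M) {V : State}
    (hV : NearContact χ₁ χ₂ M e u₀ v₀ p₀ V) (hΛ : |lam γ eos (V 4)| ≤ Λ)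
    (hl : |lam γ eos (V 4) - (α + β * V 4)| ≤ e) {c : Fin 5} (hc : c ≠ 4) :
    |consVar γ eos V c| ≤ 2 * Λ * M + 4 * M ^ 3 + 2 * M ^ 2 + M ∧
      |consVar γ eos V c - contactCons u₀ v₀ p₀ α β c V| ≤ (Λ + 4 * M ^ 2) * e := by
  obtain ⟨h1, h2, h3, h0, h0', -⟩ := hV
  have hM0 : 0 < M := by linarith
  have he0 : 0 ≤ e := (abs_nonneg _).trans h1
  have hΛ0 : 0 ≤ Λ := (abs_nonneg _).trans hΛ
  have hρ : |V 0| ≤ M := by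
    have : 0 < 1 / M := by positivity
    rw [abs_of_pos (by linarith)]; exact h0'
  have tri : ∀ x a : ℝ, |x - a| ≤ e → |a| ≤ M → |x| ≤ 2 * M := by
    intro x a hx ha
    rw [abs_le] at *
    constructor <;> linarith [hx.1, hx.2, ha.1, ha.2]
  have b1 := tri _ _ h1 hu
  have b2 := tri _ _ h2 hv
  have b3 := tri _ _ h3 hp
  have M2 : M ≤ M ^ 2 := by nlinarith
  have M3 : 0 ≤ M ^ 3 := by positivity
  have ΛM : 0 ≤ Λ * M := by positivity
  have sq_err : ∀ x a : ℝ, |x - a| ≤ e → |a| ≤ M → |x ^ 2 / 2 - a ^ 2 / 2| ≤ 3 / 2 * M * e := by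
    intro x a hx ha
    have hxa : |x + a| ≤ 3 * M := (abs_add_le _ _).trans (by linarith [tri x a hx ha])
    calc |x ^ 2 / 2 - a ^ 2 / 2| = |x - a| * |x + a| / 2 := by
          rw [← abs_mul, ← abs_of_pos (two_pos (α := ℝ)), ← abs_div, abs_of_pos (two_pos (α := ℝ))]
          ring_nf
      _ ≤ e * (3 * M) / 2 := by gcongr
      _ = _ := by ring
  have sq_bd : ∀ x : ℝ, |x| ≤ 2 * M → x ^ 2 ≤ 4 * M ^ 2 := by
    intro x hx
    have := sq_le_sq' (abs_le.1 hx).1 (abs_le.1 hx).2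
    linarith
  have lin_err : ∀ x a : ℝ, |x - a| ≤ e → |V 0 * x - a * V 0| ≤ (Λ + 4 * M ^ 2) * e := by
    intro x a hx
    rw [mul_comm a, ← mul_sub, abs_mul]
    refine (mul_le_mul hρ hx (abs_nonneg _) hM0.le).trans ?_
    gcongr
    linarith
  have lin_bd : ∀ x : ℝ, |x| ≤ 2 * M →
      |V 0 * x| ≤ 2 * Λ * M + 4 * M ^ 3 + 2 * M ^ 2 + M := by
    intro x hx
    rw [abs_mul]
    refine (mul_le_mul hρ hx (abs_nonneg _) hM0.le).trans ?_
    nlinarith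
  fin_cases c
  · constructor
    · change |V 0| ≤ _
      linarith [sq_nonneg M]
    · have : consVar γ eos V 0 - contactCons u₀ v₀ p₀ α β 0 V = 0 := by
        simp [consVar, contactCons, densCoef, markCoef, constCoef]
      change |consVar γ eos V 0 - contactCons u₀ v₀ p₀ α β 0 V| ≤ _
      rw [this, abs_zero]
      positivity
  · refine ⟨lin_bd _ b1, ?_⟩
    have := lin_err _ _ h1
    simpa [consVar, contactCons, densCoef, markCoef, constCoef] using this
  · refine ⟨lin_bd _ b2, ?_⟩
    have := lin_err _ _ h2
    simpa [consVar, contactCons, densCoef, markCoef, constCoef] using this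
  · have k1 := sq_bd _ b1
    have k2 := sq_bd _ b2
    have r1 := sq_err _ _ h1 hu
    have r2 := sq_err _ _ h2 hv
    constructor
    · change |lam γ eos (V 4) * V 3 + V 0 * (V 1 ^ 2 / 2 + V 2 ^ 2 / 2)| ≤ _
      refine (abs_add_le _ _).trans ?_
      rw [abs_mul, abs_mul, abs_of_nonneg (by positivity : 0 ≤ V 1 ^ 2 / 2 + V 2 ^ 2 / 2)]
      have m1 := mul_le_mul hΛ b3 (abs_nonneg _) hΛ0
      have m2 := mul_le_mul hρ (by linarith : V 1 ^ 2 / 2 + V 2 ^ 2 / 2 ≤ 4 * M ^ 2)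
        (by positivity) hM0.le
      nlinarith
    · have e3 : consVar γ eos V 3 - contactCons u₀ v₀ p₀ α β 3 V =
          lam γ eos (V 4) * (V 3 - p₀) + p₀ * (lam γ eos (V 4) - (α + β * V 4)) +
          V 0 * ((V 1 ^ 2 / 2 - u₀ ^ 2 / 2) + (V 2 ^ 2 / 2 - v₀ ^ 2 / 2)) := by
        simp [consVar, contactCons, densCoef, markCoef, constCoef, totalEnergy, kinetic]
        ring
      change |consVar γ eos V 3 - contactCons u₀ v₀ p₀ α β 3 V| ≤ _
      rw [e3]
      have m1 : |lam γ eos (V 4) * (V 3 - p₀)| ≤ Λ * e := by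
        rw [abs_mul]; exact mul_le_mul hΛ h3 (abs_nonneg _) hΛ0
      have m2 : |p₀ * (lam γ eos (V 4) - (α + β * V 4))| ≤ M * e := by
        rw [abs_mul]; exact mul_le_mul hp hl (abs_nonneg _) hM0.le
      have m3 : |V 0 * ((V 1 ^ 2 / 2 - u₀ ^ 2 / 2) + (V 2 ^ 2 / 2 - v₀ ^ 2 / 2))| ≤
          M * (3 * M * e) := by
        rw [abs_mul]
        exact mul_le_mul hρ ((abs_add_le _ _).trans (by linarith)) (abs_nonneg _) hM0.le
      refine (abs_add_three _ _ _).trans ?_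
      nlinarith
  · exact absurd rfl hc

/-- The pressure part of the flux of a contact. -/
def pressureCoef (u₀ v₀ p₀ : ℝ) (n : Pt) : State :=
  ![0, p₀ * n.1, p₀ * n.2, p₀ * (u₀ * n.1 + v₀ * n.2), 0]

/-- Near a contact, the numerical flux is the upwind flux of `contactCons` for the constant normal
velocity, plus the pressure part. -/
theorem upwindFlux_near {γ : ℝ} {eos : EOS} {χ₁ χ₂ M e u₀ v₀ p₀ Λ α β : ℝ} (hM : 1 ≤ M)
    (he : e ≤ 1 / 2) (hu : |u₀| ≤ M) (hv : |v₀| ≤ M) (hp : |p₀| ≤ M) {V W : State}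
    (hV : NearContact χ₁ χ₂ M e u₀ v₀ p₀ V) (hΛV : |lam γ eos (V 4)| ≤ Λ)
    (hlV : |lam γ eos (V 4) - (α + β * V 4)| ≤ e)
    (hW : NearContact χ₁ χ₂ M e u₀ v₀ p₀ W) (hΛW : |lam γ eos (W 4)| ≤ Λ)
    (hlW : |lam γ eos (W 4) - (α + β * W 4)| ≤ e) {n : Pt} (hn : IsUnitVec n) {c : Fin 5}
    (hc : c ≠ 4) :
    |upwindFlux γ eos n V W c -
        (max (u₀ * n.1 + v₀ * n.2) 0 * contactCons u₀ v₀ p₀ α β c V +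
          min (u₀ * n.1 + v₀ * n.2) 0 * contactCons u₀ v₀ p₀ α β c W +
          pressureCoef u₀ v₀ p₀ n c)| ≤
      (4 * (2 * Λ * M + 4 * M ^ 3 + 2 * M ^ 2 + M) + 4 * M * (Λ + 4 * M ^ 2) + 6 * M) * e := by
  obtain ⟨qV, eV⟩ := consVar_near hM he hu hv hp hV hΛV hlV hc
  obtain ⟨qW, eW⟩ := consVar_near hM he hu hv hp hW hΛW hlW hc
  have hM0 : 0 < M := by linarith
  have he0 : 0 ≤ e := (abs_nonneg _).trans hV.1
  have n1 := hn.abs_fst_le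
  have n2 := hn.abs_snd_le
  set un := u₀ * n.1 + v₀ * n.2 with hun
  have hunM : |un| ≤ 2 * M := by
    refine (abs_add_le _ _).trans ?_
    rw [abs_mul, abs_mul]
    nlinarith [mul_le_mul hu n1 (abs_nonneg _) hM0.le, mul_le_mul hv n2 (abs_nonneg _) hM0.le]
  set ub := (normalVel V n + normalVel W n) / 2 with hub
  have hube : |ub - un| ≤ 2 * e := by
    have a1 := hV.abs_normalVel_sub hn
    have a2 := hW.abs_normalVel_sub hn
    rw [abs_le] at *
    constructor <;> linarith [a1.1, a1.2, a2.1, a2.2]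
  set pb := (V 3 + W 3) / 2 with hpb
  have hpbe : |pb - p₀| ≤ e := by
    have a1 := hV.2.2.1
    have a2 := hW.2.2.1
    rw [abs_le] at *
    constructor <;> linarith [a1.1, a1.2, a2.1, a2.2]
  have hpbM : |pb| ≤ 2 * M := by
    rw [abs_le] at *
    constructor <;> linarith [hpbe.1, hpbe.2, hp.1, hp.2]
  have hmax : |max un 0| ≤ 2 * M := by
    have := abs_max_zero_sub_le un 0
    simp only [max_self, sub_zero] at this
    exact this.trans hunM
  have hmin : |min un 0| ≤ 2 * M := by
    have := abs_min_zero_sub_le un 0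
    simp only [min_self, sub_zero] at this
    exact this.trans hunM
  have dmax : |max ub 0 - max un 0| ≤ 2 * e := (abs_max_zero_sub_le _ _).trans hube
  have dmin : |min ub 0 - min un 0| ≤ 2 * e := (abs_min_zero_sub_le _ _).trans hube
  have hpr : |pb * (![0, n.1, n.2, ub, 0] : State) c - pressureCoef u₀ v₀ p₀ n c| ≤ 6 * M * e := by
    have hdir : ∀ a : ℝ, |a| ≤ 1 → |pb * a - p₀ * a| ≤ 6 * M * e := by
      intro a ha
      rw [← sub_mul, abs_mul]
      nlinarith [mul_le_mul hpbe ha (abs_nonneg _) he0]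
    fin_cases c
    · change |pb * 0 - 0| ≤ _
      rw [mul_zero, sub_zero, abs_zero]
      positivity
    · exact hdir _ n1
    · exact hdir _ n2
    · change |pb * ub - p₀ * un| ≤ _
      have e1 : pb * ub - p₀ * un = pb * (ub - un) + (pb - p₀) * un := by ring
      rw [e1]
      refine (abs_add_le _ _).trans ?_
      rw [abs_mul, abs_mul]
      nlinarith [mul_le_mul hpbM hube (abs_nonneg _) (by positivity),
        mul_le_mul hpbe hunM (abs_nonneg _) he0]
    · exact absurd rfl hc
  have conv : ∀ (m m' q l : ℝ), |m - m'| ≤ 2 * e → |m'| ≤ 2 * M →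
      |q| ≤ 2 * Λ * M + 4 * M ^ 3 + 2 * M ^ 2 + M → |q - l| ≤ (Λ + 4 * M ^ 2) * e →
      |m * q - m' * l| ≤ 2 * e * (2 * Λ * M + 4 * M ^ 3 + 2 * M ^ 2 + M) +
        2 * M * ((Λ + 4 * M ^ 2) * e) := by
    intro m m' q l h1 h2 h3 h4
    have e1 : m * q - m' * l = (m - m') * q + m' * (q - l) := by ring
    rw [e1]
    refine (abs_add_le _ _).trans ?_
    rw [abs_mul, abs_mul]
    exact add_le_add (mul_le_mul h1 h3 (abs_nonneg _) (by positivity))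
      (mul_le_mul h2 h4 (abs_nonneg _) (by positivity))
  have t1 := conv _ _ _ _ dmax hmax qV eV
  have t2 := conv _ _ _ _ dmin hmin qW eW
  have e0 : upwindFlux γ eos n V W c - (max un 0 * contactCons u₀ v₀ p₀ α β c V +
      min un 0 * contactCons u₀ v₀ p₀ α β c W + pressureCoef u₀ v₀ p₀ n c) =
      (max ub 0 * consVar γ eos V c - max un 0 * contactCons u₀ v₀ p₀ α β c V) +
      (min ub 0 * consVar γ eos W c - min un 0 * contactCons u₀ v₀ p₀ α β c W) +
      (pb * (![0, n.1, n.2, ub, 0] : State) c - pressureCoef u₀ v₀ p₀ n c) := by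
    simp only [upwindFlux, ← hub, ← hpb]
    ring
  rw [e0]
  refine (abs_add_three _ _ _).trans ?_
  linarith

/-! ### Comparison of integrals -/

/-- Only the measurability of `f` is required: its integrability follows from that of `g`. -/
theorem abs_setIntegral_sub_le {X : Type*} [MeasurableSpace X] {μ : Measure X} {s : Set X}
    (hs : MeasurableSet s) (hμ : μ s < ∞) {f g : X → ℝ} {c : ℝ}
    (hf : AEStronglyMeasurable f (μ.restrict s)) (hg : IntegrableOn g s μ)
    (h : ∀ x ∈ s, |f x - g x| ≤ c) :
    |(∫ x in s, f x ∂μ) - ∫ x in s, g x ∂μ| ≤ c * (μ s).toReal := by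
  have hd : IntegrableOn (fun x => f x - g x) s μ :=
    IntegrableOn.of_bound hμ (hf.sub hg.aestronglyMeasurable) c
      ((ae_restrict_iff' hs).2 (Eventually.of_forall h))
  have hfi : IntegrableOn f s μ := by
    have := hd.add hg
    refine this.congr_fun (fun x _ => ?_) hs
    simp
  rw [← integral_sub hfi hg]
  exact norm_setIntegral_le_of_norm_le_const (f := fun x => f x - g x) hμ h

theorem abs_intervalIntegral_sub_le {a b c : ℝ} (hab : a ≤ b) {f g : ℝ → ℝ}
    (hf : AEStronglyMeasurable f (volume.restrict (Set.Ioc a b))) (hg : Continuous g)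
    (h : ∀ t ∈ Set.Icc a b, |f t - g t| ≤ c) :
    |(∫ t in a..b, f t) - ∫ t in a..b, g t| ≤ c * (b - a) := by
  rw [intervalIntegral.integral_of_le hab, intervalIntegral.integral_of_le hab]
  have := abs_setIntegral_sub_le measurableSet_Ioc measure_Ioc_lt_top hf
    ((hg.intervalIntegrable a b).1) fun t ht => h t ⟨ht.1.le, ht.2⟩
  rwa [Real.volume_Ioc, ENNReal.toReal_ofReal (sub_nonneg.2 hab)] at this

theorem Polygon.abs_integral_region_sub_le (P : Polygon) {f g : Pt → ℝ} {c : ℝ}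
    (hf : Measurable f) (hg : Continuous g) (h : ∀ x ∈ P.region, |f x - g x| ≤ c) :
    |(∫ x in P.region, f x) - ∫ x in P.region, g x| ≤ c * P.area :=
  abs_setIntegral_sub_le P.isCompact_region.measurableSet P.isCompact_region.measure_lt_top
    hf.aestronglyMeasurable (P.integrableOn_region hg) h

/-! ### The discrete solution as a polynomial -/

theorem Polygon.basis_mem_polySpace (P : Polygon) {ℓ : ℕ × ℕ} {d : ℕ} (h : ℓ.1 + ℓ.2 ≤ d) :
    P.basis ℓ ∈ polySpace d := by
  have hx : (fun x : Pt => (x.1 - P.bary.1) / P.size) ∈ polySpace 1 := by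
    have h1 := (polySpace 1).smul_mem P.size⁻¹ (Submodule.sub_mem _
      (monomial_mem_polySpace (a := 1) (b := 0) le_rfl) (const_mem_polySpace P.bary.1 1))
    convert h1 using 1
    ext x
    simp [div_eq_inv_mul]
  have hy : (fun x : Pt => (x.2 - P.bary.2) / P.size) ∈ polySpace 1 := by
    have h1 := (polySpace 1).smul_mem P.size⁻¹ (Submodule.sub_mem _
      (monomial_mem_polySpace (a := 0) (b := 1) le_rfl) (const_mem_polySpace P.bary.2 1))
    convert h1 using 1
    ext x
    simp [div_eq_inv_mul]
  exact polySpace_mono h (mul_mem_polySpace (pow_mem_polySpace hx ℓ.1) (pow_mem_polySpace hy ℓ.2))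

theorem Polygon.basis_zero (P : Polygon) (x : Pt) : P.basis (0, 0) x = 1 := by
  simp [Polygon.basis]

theorem mem_idx2 {N : ℕ} {ℓ : ℕ × ℕ} (h : ℓ ∈ idx2 N) : ℓ.1 + ℓ.2 ≤ N :=
  (Finset.mem_filter.1 h).2

theorem mem_idx3 {N : ℕ} {ℓ : (ℕ × ℕ) × ℕ} (h : ℓ ∈ idx3 N) : ℓ.1.1 + ℓ.1.2 ≤ N := by
  have := (Finset.mem_filter.1 h).2
  omega

theorem zero_mem_idx2 (N : ℕ) : ((0, 0) : ℕ × ℕ) ∈ idx2 N := by simp [idx2]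

namespace Discretization

variable {N : ℕ} (D : Discretization N)

theorem sol_mem_polySpace (n : ℕ) (i : D.mesh.Cell) (c : Fin 5) :
    (fun x => D.sol n i x c) ∈ polySpace N := by
  have h : ∑ ℓ ∈ idx2 N, D.solCoef n i ℓ c • (D.mesh.poly i).basis ℓ ∈ polySpace N :=
    Submodule.sum_mem _ fun ℓ hℓ =>
      Submodule.smul_mem _ _ ((D.mesh.poly i).basis_mem_polySpace (mem_idx2 hℓ))
  convert h using 1
  ext x
  simp [Discretization.sol, mul_comm]

theorem pred_mem_polySpace (n : ℕ) (i : D.mesh.Cell) (t : ℝ) (c : Fin 5) :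
    (fun x => D.pred n i x t c) ∈ polySpace N := by
  have h : ∑ ℓ ∈ idx3 N, (((t - D.time n) / (D.mesh.poly i).size) ^ ℓ.2 * D.predCoef n i ℓ c) •
      (D.mesh.poly i).basis ℓ.1 ∈ polySpace N :=
    Submodule.sum_mem _ fun ℓ hℓ =>
      Submodule.smul_mem _ _ ((D.mesh.poly i).basis_mem_polySpace (mem_idx3 hℓ))
  convert h using 1
  ext x
  simp only [Discretization.pred, Finset.sum_apply, Pi.smul_apply, smul_eq_mul]
  exact Finset.sum_congr rfl fun ℓ _ => by ring

theorem continuous_sol (n : ℕ) (i : D.mesh.Cell) : Continuous fun x => D.sol n i x :=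
  continuous_pi fun c => polySpace_continuous (D.sol_mem_polySpace n i c)

theorem continuous_pred_time (n : ℕ) (i : D.mesh.Cell) (x : Pt) :
    Continuous fun t => D.pred n i x t := by
  unfold Discretization.pred
  fun_prop

theorem continuous_outer_time (n : ℕ) (i : D.mesh.Cell) (k : Fin ((D.mesh.poly i).m + 3))
    (x : Pt) : Continuous fun t => D.outer n i k x t :=
  D.continuous_pred_time n _ x

theorem continuous_dx_pred_time (n : ℕ) (i : D.mesh.Cell) (x : Pt) (c : Fin 5) :
    Continuous fun t => dx (fun y => D.pred n i y t c) x := by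
  have h : ∀ t, dx (fun y => D.pred n i y t c) x = ∑ ℓ ∈ idx3 N,
      dx ((D.mesh.poly i).basis ℓ.1) x * ((t - D.time n) / (D.mesh.poly i).size) ^ ℓ.2 *
        D.predCoef n i ℓ c := fun t => by
    refine HasDerivAt.deriv (HasDerivAt.fun_sum fun ℓ hℓ => ?_)
    exact ((hasDerivAt_dx (polySpace_contDiff
      ((D.mesh.poly i).basis_mem_polySpace (mem_idx3 hℓ))) x).mul_const _).mul_const _
  simp only [h]
  fun_prop

theorem continuous_dy_pred_time (n : ℕ) (i : D.mesh.Cell) (x : Pt) (c : Fin 5) :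
    Continuous fun t => dy (fun y => D.pred n i y t c) x := by
  have h : ∀ t, dy (fun y => D.pred n i y t c) x = ∑ ℓ ∈ idx3 N,
      dy ((D.mesh.poly i).basis ℓ.1) x * ((t - D.time n) / (D.mesh.poly i).size) ^ ℓ.2 *
        D.predCoef n i ℓ c := fun t => by
    refine HasDerivAt.deriv (HasDerivAt.fun_sum fun ℓ hℓ => ?_)
    exact ((hasDerivAt_dy (polySpace_contDiff
      ((D.mesh.poly i).basis_mem_polySpace (mem_idx3 hℓ))) x).mul_const _).mul_const _
  simp only [h]
  fun_prop

theorem nonCons_density (γ : ℝ) (eos : EOS) (n : ℕ) (i : D.mesh.Cell) (x : Pt) (t : ℝ) :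
    D.nonCons γ eos n i x t 0 =
      D.pred n i x t 1 * dx (fun y => D.pred n i y t 0) x +
        D.pred n i x t 0 * dx (fun y => D.pred n i y t 1) x +
      (D.pred n i x t 2 * dy (fun y => D.pred n i y t 0) x +
        D.pred n i x t 0 * dy (fun y => D.pred n i y t 2) x) := by
  simp [Discretization.nonCons, matA, matB, dotProduct, Fin.sum_univ_succ, dx, dy]

theorem nonCons_marker (γ : ℝ) (eos : EOS) (n : ℕ) (i : D.mesh.Cell) (x : Pt) (t : ℝ) :
    D.nonCons γ eos n i x t 4 =
      D.pred n i x t 1 * dx (fun y => D.pred n i y t 4) x +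
      D.pred n i x t 2 * dy (fun y => D.pred n i y t 4) x := by
  simp [Discretization.nonCons, matA, matB, dotProduct, Fin.sum_univ_succ, dx, dy]

/-! ### Quadrature on the boundary of a cell -/

section bdryQuad

variable {D} {i : D.mesh.Cell} {f g : Fin ((D.mesh.poly i).m + 3) → Pt → ℝ}

theorem bdryQuad_add :
    D.bdryQuad i (fun k x => f k x + g k x) = D.bdryQuad i f + D.bdryQuad i g := by
  simp only [Discretization.bdryQuad, QuadRule.eval_add, mul_add, Finset.sum_add_distrib]

theorem bdryQuad_sub :
    D.bdryQuad i (fun k x => f k x - g k x) = D.bdryQuad i f - D.bdryQuad i g := by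
  simp only [Discretization.bdryQuad, QuadRule.eval_sub, mul_sub, Finset.sum_sub_distrib]

theorem bdryQuad_const_mul (a : ℝ) :
    D.bdryQuad i (fun k x => a * f k x) = a * D.bdryQuad i f := by
  simp only [Discretization.bdryQuad, QuadRule.eval_const_mul, Finset.mul_sum, mul_left_comm]

theorem abs_bdryQuad_le (hq : EdgeRuleExact D.edgeRule N) {e : ℝ}
    (h : ∀ k, ∀ s ∈ Set.Icc (0 : ℝ) 1, |f k ((D.mesh.poly i).edgePoint k s)| ≤ e) :
    |D.bdryQuad i f| ≤ (D.mesh.poly i).perimeter * e := by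
  refine (Finset.abs_sum_le_sum_abs _ _).trans ?_
  rw [Polygon.perimeter, Finset.sum_mul]
  refine Finset.sum_le_sum fun k _ => ?_
  have h0 := (D.mesh.poly i).edgeLen_nonneg k
  rw [abs_mul, abs_of_nonneg h0]
  have := D.edgeRule.abs_eval_le hq.weight_nonneg
    (f := fun s => f k ((D.mesh.poly i).edgePoint k s)) fun a => h k _ (hq.node_mem a)
  rw [hq.sum_weight, one_mul] at this
  exact mul_le_mul_of_nonneg_left this h0

theorem continuous_bdryQuad {F : ℝ → Fin ((D.mesh.poly i).m + 3) → Pt → ℝ}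
    (h : ∀ k x, Continuous fun t => F t k x) : Continuous fun t => D.bdryQuad i (F t) := by
  unfold Discretization.bdryQuad QuadRule.eval
  fun_prop

theorem measurable_bdryQuad {F : ℝ → Fin ((D.mesh.poly i).m + 3) → Pt → ℝ}
    (h : ∀ k x, Measurable fun t => F t k x) : Measurable fun t => D.bdryQuad i (F t) := by
  unfold Discretization.bdryQuad QuadRule.eval
  fun_prop

/-- A quadrature rule depends on the values of the integrand at the nodes only, which lie on the
edges. -/
theorem bdryQuad_congr (hq : EdgeRuleExact D.edgeRule N)
    (h : ∀ k, ∀ s ∈ Set.Icc (0 : ℝ) 1, f k ((D.mesh.poly i).edgePoint k s) =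
      g k ((D.mesh.poly i).edgePoint k s)) : D.bdryQuad i f = D.bdryQuad i g :=
  Finset.sum_congr rfl fun k _ => congrArg _ <| Finset.sum_congr rfl fun a _ =>
    congrArg _ (h k _ (hq.node_mem a))

/-- The discrete form of the vanishing of the mean normal over a closed curve. -/
theorem bdryQuad_normal (hq : EdgeRuleExact D.edgeRule N) (a b : ℝ) :
    D.bdryQuad i (fun k _ => a * ((D.mesh.poly i).normal k).1 +
      b * ((D.mesh.poly i).normal k).2) = 0 := by
  have h1 := (D.mesh.poly i).sum_edgeLen_mul_normal_fst
  have h2 := (D.mesh.poly i).sum_edgeLen_mul_normal_snd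
  simp only [Discretization.bdryQuad, QuadRule.eval, ← Finset.sum_mul, hq.sum_weight, one_mul]
  calc _ = a * ∑ k, (D.mesh.poly i).edgeLen k * ((D.mesh.poly i).normal k).1 +
        b * ∑ k, (D.mesh.poly i).edgeLen k * ((D.mesh.poly i).normal k).2 := by
        rw [Finset.mul_sum, Finset.mul_sum, ← Finset.sum_add_distrib]
        exact Finset.sum_congr rfl fun k _ => by ring
    _ = 0 := by rw [h1, h2]; ring

/-- The discrete divergence theorem: both quadrature rules are exact on the polynomials involved. -/
theorem eval_grad_eq_bdryQuad (hc : CellRuleExact (D.mesh.poly i) (D.cellRule i) (N - 1))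
    (hq : EdgeRuleExact D.edgeRule N) {w : Pt → ℝ} (hw : w ∈ polySpace N) (a b : ℝ) :
    (D.cellRule i).eval (fun x => a * dx w x + b * dy w x) =
      D.bdryQuad i (fun k x => (a * ((D.mesh.poly i).normal k).1 +
        b * ((D.mesh.poly i).normal k).2) * w x) := by
  have hw1 := polySpace_contDiff hw
  have hmem : (fun x => a * dx w x + b * dy w x) ∈ polySpace (N - 1) :=
    Submodule.add_mem _ (Submodule.smul_mem _ a (dx_mem_polySpace hw))
      (Submodule.smul_mem _ b (dy_mem_polySpace hw))
  rw [hc.eval_polySpace (D.mesh.poly i).isCompact_region hmem,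
    integral_add ((D.mesh.poly i).integrableOn_region (by have := continuous_dx hw1; fun_prop))
      ((D.mesh.poly i).integrableOn_region (by have := continuous_dy hw1; fun_prop)),
    integral_const_mul, integral_const_mul, Polygon.integral_region_dx _ hw1,
    Polygon.integral_region_dy _ hw1, Finset.mul_sum, Finset.mul_sum, ← Finset.sum_add_distrib]
  refine Finset.sum_congr rfl fun k _ => ?_
  rw [QuadRule.eval_const_mul]
  have hs : D.edgeRule.eval (fun s => w ((D.mesh.poly i).edgePoint k s)) =
      segMean w ((D.mesh.poly i).vert k) ((D.mesh.poly i).vert (k + 1)) := by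
    obtain ⟨P, hP, hPe⟩ := polySpace_line hw ((D.mesh.poly i).vert k)
      ((D.mesh.poly i).vert (k + 1) - (D.mesh.poly i).vert k)
    simp only [Polygon.edgePoint, segMean, hPe]
    exact hq.eval_polynomial P hP
  rw [hs, ← Polygon.edgeLen_mul_normal_fst, ← Polygon.edgeLen_mul_normal_snd]
  ring

end bdryQuad

end Discretization

namespace Discretization

variable {N : ℕ} (D : Discretization N)

/-! ### The estimate in one cell -/

/-- The property `R` of states holds for the solution at both time levels and the predictor on the
closed cell `i`, and for the outer traces on its boundary.  This is what the estimates use of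
`HoldsAround`. -/
def HoldsOn (n : ℕ) (i : D.mesh.Cell) (R : State → Prop) : Prop :=
  (∀ x ∈ (D.mesh.poly i).region, R (D.sol n i x) ∧ R (D.sol (n + 1) i x) ∧
    ∀ t ∈ Set.Icc (D.time n) (D.time (n + 1)), R (D.pred n i x t)) ∧
  ∀ k, ∀ s ∈ Set.Icc (0 : ℝ) 1, ∀ t ∈ Set.Icc (D.time n) (D.time (n + 1)),
    R (D.outer n i k ((D.mesh.poly i).edgePoint k s) t)

theorem HoldsAround.holdsOn {D : Discretization N} {n : ℕ} {i : D.mesh.Cell} {R : State → Prop}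
    (h : D.HoldsAround n i R) : D.HoldsOn n i R := by
  obtain ⟨r, hr, h⟩ := h
  refine ⟨fun x hx => h i x ⟨hx, hr hx⟩, fun k s hs t ht => ?_⟩
  have hx := (D.mesh.poly i).edgePoint_mem_region k hs
  rw [Discretization.outer]
  cases hk : D.mesh.nbr i k with
  | none => exact (h i _ ⟨hx, hr hx⟩).2.2 t ht
  | some j => exact (h j _ ⟨D.mesh.edgePoint_mem_region_nbr hk hs, hr hx⟩).2.2 t ht

theorem HoldsOn.mono {D : Discretization N} {n : ℕ} {i : D.mesh.Cell} {R R' : State → Prop}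
    (h : D.HoldsOn n i R) (hR : ∀ V, R V → R' V) : D.HoldsOn n i R' :=
  ⟨fun x hx => ⟨hR _ (h.1 x hx).1, hR _ (h.1 x hx).2.1, fun t ht => hR _ ((h.1 x hx).2.2 t ht)⟩,
    fun k s hs t ht => hR _ (h.2 k s hs t ht)⟩

/-- A computation that is near a contact in the cell `i` during the `n`-th step: velocity and
pressure are constant up to `e`, and `λ(χ)` agrees with `α + β χ` up to `e`.  The remaining fields
are the assumptions on the mesh, the quadrature rules and the scheme in this cell and step.  The
bound on `e` keeps the pressure away from zero. -/
structure CellContact (γ : ℝ) (eos : EOS) (χ₁ χ₂ M σ e u₀ v₀ p₀ α β : ℝ) (n : ℕ)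
    (i : D.mesh.Cell) : Prop where
  one_lt : 1 < γ
  lam₁ : 0 < lam γ eos χ₁
  lam₂ : 0 < lam γ eos χ₂
  M_pos : 0 < M
  e_le : e ≤ 1 / (2 * M)
  abs_u : |u₀| ≤ M
  abs_v : |v₀| ≤ M
  le_p : 1 / M ≤ p₀
  p_le : p₀ ≤ M
  σ_pos : 0 < σ
  h_pos : 0 < D.h
  disc : ∃ c, disc c (σ * D.h) ⊆ (D.mesh.poly i).region
  perim : (D.mesh.poly i).perimeter ≤ D.h / σ
  dt_le : σ * D.h ≤ D.dt n
  cell_quad : CellRuleExact (D.mesh.poly i) (D.cellRule i) (N - 1)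
  edge_quad : EdgeRuleExact D.edgeRule N
  scheme : D.SatisfiesDG γ eos n i
  near : D.HoldsOn n i (NearContact χ₁ χ₂ M e u₀ v₀ p₀)
  linked : D.HoldsOn n i (fun V => |lam γ eos (V 4) - (α + β * V 4)| ≤ e)

namespace CellContact

variable {D} {γ : ℝ} {eos : EOS} {χ₁ χ₂ M σ e u₀ v₀ p₀ α β : ℝ} {n : ℕ} {i : D.mesh.Cell}

theorem one_le_M (H : D.CellContact γ eos χ₁ χ₂ M σ e u₀ v₀ p₀ α β n i) : 1 ≤ M := by
  have h := H.le_p.trans H.p_le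
  have hM := H.M_pos
  rw [div_le_iff₀ hM] at h
  nlinarith

theorem dt_pos (H : D.CellContact γ eos χ₁ χ₂ M σ e u₀ v₀ p₀ α β n i) : 0 < D.dt n :=
  (mul_pos H.σ_pos H.h_pos).trans_le H.dt_le

theorem time_le (H : D.CellContact γ eos χ₁ χ₂ M σ e u₀ v₀ p₀ α β n i) :
    D.time n ≤ D.time (n + 1) := by
  have := H.dt_pos
  rw [Discretization.dt] at this
  linarith

theorem exists_mem (H : D.CellContact γ eos χ₁ χ₂ M σ e u₀ v₀ p₀ α β n i) :
    ∃ c ∈ (D.mesh.poly i).region, QCons.disc c (σ * D.h) ⊆ (D.mesh.poly i).region := by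
  obtain ⟨c, hc⟩ := H.disc
  have hr := mul_pos H.σ_pos H.h_pos
  refine ⟨c, hc (Polygon.square_subset_disc hr ?_ ?_), hc⟩ <;> rw [sub_self, abs_zero] <;>
    positivity

theorem e_nonneg (H : D.CellContact γ eos χ₁ χ₂ M σ e u₀ v₀ p₀ α β n i) : 0 ≤ e := by
  obtain ⟨c, hc, -⟩ := H.exists_mem
  exact (abs_nonneg _).trans (H.near.1 c hc).1.1

theorem sq_le_area (H : D.CellContact γ eos χ₁ χ₂ M σ e u₀ v₀ p₀ α β n i) :
    (σ * D.h) ^ 2 ≤ (D.mesh.poly i).area := by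
  obtain ⟨c, -, hc⟩ := H.exists_mem
  exact (D.mesh.poly i).sq_le_area (mul_pos H.σ_pos H.h_pos) hc

theorem area_pos (H : D.CellContact γ eos χ₁ χ₂ M σ e u₀ v₀ p₀ α β n i) :
    0 < (D.mesh.poly i).area := by
  have h1 := mul_pos H.σ_pos H.h_pos
  have h2 := H.sq_le_area
  nlinarith

/-- The inverse inequality on the cell, at scale `h`. -/
theorem abs_grad_le (H : D.CellContact γ eos χ₁ χ₂ M σ e u₀ v₀ p₀ α β n i) {K : ℝ}
    (hK : IsInverseConstant N (2 / σ ^ 2) K)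
    {f : Pt → ℝ} (hf : f ∈ polySpace N) {a b : ℝ}
    (hb : ∀ x ∈ (D.mesh.poly i).region, |f x - a| ≤ b) {x : Pt}
    (hx : x ∈ (D.mesh.poly i).region) :
    |dx f x| ≤ K * b / (σ * D.h) ∧ |dy f x| ≤ K * b / (σ * D.h) := by
  obtain ⟨c, hc, hd⟩ := H.exists_mem
  have hσ := H.σ_pos
  have hh := H.h_pos
  have hr := mul_pos hσ hh
  have h2 : 2 / σ ^ 2 * (σ * D.h) = 2 * (D.h / σ) := by field_simp
  have h3 := (D.mesh.poly i).abs_sub_le_of_mem_region hx hc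
  have hp := H.perim
  exact hK.2 f hf c (σ * D.h) b a hr
    (fun y h1 h2 => hb y (hd (Polygon.square_subset_disc hr h1 h2))) x
    (by rw [h2]; linarith [h3.1]) (by rw [h2]; linarith [h3.2])

theorem abs_nonCons_density_sub (H : D.CellContact γ eos χ₁ χ₂ M σ e u₀ v₀ p₀ α β n i) {K : ℝ}
    (hK : IsInverseConstant N (2 / σ ^ 2) K)
    {x : Pt} (hx : x ∈ (D.mesh.poly i).region) {t : ℝ}
    (ht : t ∈ Set.Icc (D.time n) (D.time (n + 1))) :
    |D.nonCons γ eos n i x t 0 - (u₀ * dx (fun y => D.pred n i y t 0) x +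
      v₀ * dy (fun y => D.pred n i y t 0) x)| ≤ 4 * K * M / σ * (e / D.h) := by
  have hn := fun y hy => (H.near.1 y hy).2.2 t ht
  have hσ := H.σ_pos
  have hh := H.h_pos
  have hM := H.M_pos
  have he := H.e_nonneg
  have hM' : 0 < 1 / M := by positivity
  have hρ : ∀ y ∈ (D.mesh.poly i).region, |D.pred n i y t 0| ≤ M := fun y hy => by
    rw [abs_of_pos (hM'.trans_le (hn y hy).2.2.2.1)]
    exact (hn y hy).2.2.2.2.1
  obtain ⟨r1, r2⟩ := H.abs_grad_le hK (D.pred_mem_polySpace n i t 0) (a := 0) (b := M)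
    (fun y hy => by rw [sub_zero]; exact hρ y hy) hx
  obtain ⟨a1, -⟩ := H.abs_grad_le hK (D.pred_mem_polySpace n i t 1) (a := u₀) (b := e)
    (fun y hy => (hn y hy).1) hx
  obtain ⟨-, b2⟩ := H.abs_grad_le hK (D.pred_mem_polySpace n i t 2) (a := v₀) (b := e)
    (fun y hy => (hn y hy).2.1) hx
  obtain ⟨n1, n2, -⟩ := hn x hx
  have n0 := hρ x hx
  rw [D.nonCons_density]
  generalize dx (fun y => D.pred n i y t 0) x = ρx at *
  generalize dy (fun y => D.pred n i y t 0) x = ρy at *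
  generalize dx (fun y => D.pred n i y t 1) x = ux at *
  generalize dy (fun y => D.pred n i y t 2) x = vy at *
  generalize D.pred n i x t = V at *
  have m1 : |(V 1 - u₀) * ρx| ≤ e * (K * M / (σ * D.h)) := by
    rw [abs_mul]; exact mul_le_mul n1 r1 (abs_nonneg _) he
  have m2 : |(V 2 - v₀) * ρy| ≤ e * (K * M / (σ * D.h)) := by
    rw [abs_mul]; exact mul_le_mul n2 r2 (abs_nonneg _) he
  have m3 : |V 0 * ux| ≤ M * (K * e / (σ * D.h)) := by
    rw [abs_mul]; exact mul_le_mul n0 a1 (abs_nonneg _) hM.le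
  have m4 : |V 0 * vy| ≤ M * (K * e / (σ * D.h)) := by
    rw [abs_mul]; exact mul_le_mul n0 b2 (abs_nonneg _) hM.le
  have e1 : e * (K * M / (σ * D.h)) = K * M / σ * (e / D.h) := by field_simp
  have e2 : M * (K * e / (σ * D.h)) = K * M / σ * (e / D.h) := by field_simp
  rw [e1] at m1 m2
  rw [e2] at m3 m4
  have e3 : 4 * K * M / σ * (e / D.h) = 4 * (K * M / σ * (e / D.h)) := by ring
  rw [e3]
  rw [abs_le] at *
  constructor <;> linarith [m1.1, m1.2, m2.1, m2.2, m3.1, m3.2, m4.1, m4.2]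

theorem abs_nonCons_marker_sub (H : D.CellContact γ eos χ₁ χ₂ M σ e u₀ v₀ p₀ α β n i) {K : ℝ}
    (hK : IsInverseConstant N (2 / σ ^ 2) K)
    {x : Pt} (hx : x ∈ (D.mesh.poly i).region) {t : ℝ}
    (ht : t ∈ Set.Icc (D.time n) (D.time (n + 1))) :
    |D.nonCons γ eos n i x t 4 - (u₀ * dx (fun y => D.pred n i y t 4) x +
      v₀ * dy (fun y => D.pred n i y t 4) x)| ≤ 2 * K * |χ₂ - χ₁| / σ * (e / D.h) := by
  have hn := fun y hy => (H.near.1 y hy).2.2 t ht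
  have hσ := H.σ_pos
  have hh := H.h_pos
  have he := H.e_nonneg
  obtain ⟨r1, r2⟩ := H.abs_grad_le hK (D.pred_mem_polySpace n i t 4) (a := χ₁) (b := |χ₂ - χ₁|)
    (fun y hy => Set.abs_sub_left_of_mem_uIcc (hn y hy).2.2.2.2.2) hx
  obtain ⟨n1, n2, -⟩ := hn x hx
  rw [D.nonCons_marker]
  generalize dx (fun y => D.pred n i y t 4) x = ρx at *
  generalize dy (fun y => D.pred n i y t 4) x = ρy at *
  generalize D.pred n i x t = V at *
  generalize |χ₂ - χ₁| = δ at *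
  have m1 : |(V 1 - u₀) * ρx| ≤ e * (K * δ / (σ * D.h)) := by
    rw [abs_mul]; exact mul_le_mul n1 r1 (abs_nonneg _) he
  have m2 : |(V 2 - v₀) * ρy| ≤ e * (K * δ / (σ * D.h)) := by
    rw [abs_mul]; exact mul_le_mul n2 r2 (abs_nonneg _) he
  have e1 : e * (K * δ / (σ * D.h)) = K * δ / σ * (e / D.h) := by field_simp
  have e3 : 2 * K * δ / σ * (e / D.h) = 2 * (K * δ / σ * (e / D.h)) := by ring
  rw [e1] at m1 m2
  rw [e3]
  rw [abs_le] at *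
  constructor <;> linarith [m1.1, m1.2, m2.1, m2.2]

end CellContact

/-- The time integral of the upwind flux of the component `c`, convected with the constant
velocity `(u₀, v₀)`. -/
noncomputable def upwindBalance (n : ℕ) (i : D.mesh.Cell) (u₀ v₀ : ℝ) (c : Fin 5) : ℝ :=
  ∫ t in (D.time n)..(D.time (n + 1)), D.bdryQuad i (fun k x =>
    max (u₀ * ((D.mesh.poly i).normal k).1 + v₀ * ((D.mesh.poly i).normal k).2) 0 *
        D.pred n i x t c +
      min (u₀ * ((D.mesh.poly i).normal k).1 + v₀ * ((D.mesh.poly i).normal k).2) 0 *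
        D.outer n i k x t c)

/-- The update of the mean of the component `c`. -/
noncomputable def increment (n : ℕ) (i : D.mesh.Cell) (c : Fin 5) : ℝ :=
  ∫ x in (D.mesh.poly i).region, (D.sol (n + 1) i x c - D.sol n i x c)

namespace CellContact

variable {D} {γ : ℝ} {eos : EOS} {χ₁ χ₂ M σ e u₀ v₀ p₀ α β : ℝ} {n : ℕ} {i : D.mesh.Cell}

/-- The scheme tested with the constant function, compared with the upwind scheme for the linear
transport of the component `c`.  The hypotheses `hrep`, `hA` describe the fluctuation near a contact
and `hcont`, `hB` the non-conservative product. -/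
theorem abs_increment_add_le (H : D.CellContact γ eos χ₁ χ₂ M σ e u₀ v₀ p₀ α β n i) {c : Fin 5}
    {r : Pt → State → State} (hr : ∀ m b, Measurable fun V => r m V b)
    (hrep : ∀ m V W, IsUnitVec m → NearContact χ₁ χ₂ M e u₀ v₀ p₀ V →
      NearContact χ₁ χ₂ M e u₀ v₀ p₀ W → fluctuation γ eos m V W c =
        ∑ b, (∫ s in (0 : ℝ)..1, r m (path V W s) b) * (W b - V b))
    {A : ℝ} (hA : ∀ m V W, IsUnitVec m → NearContact χ₁ χ₂ M e u₀ v₀ p₀ V →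
      NearContact χ₁ χ₂ M e u₀ v₀ p₀ W →
        |fluctuation γ eos m V W c - min (u₀ * m.1 + v₀ * m.2) 0 * (W c - V c)| ≤ A)
    (hcont : ∀ x, Continuous fun t => D.nonCons γ eos n i x t c)
    {B : ℝ} (hB : ∀ x ∈ (D.mesh.poly i).region, ∀ t ∈ Set.Icc (D.time n) (D.time (n + 1)),
      |D.nonCons γ eos n i x t c - (u₀ * dx (fun y => D.pred n i y t c) x +
        v₀ * dy (fun y => D.pred n i y t c) x)| ≤ B) :
    |D.increment n i c + D.upwindBalance n i u₀ v₀ c| ≤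
      ((D.mesh.poly i).perimeter * A + (D.mesh.poly i).area * B) * D.dt n := by
  have hab := H.time_le
  have hpc : ∀ x, Continuous fun t => D.pred n i x t c := fun x =>
    (continuous_apply c).comp (D.continuous_pred_time n i x)
  have hoc : ∀ k x, Continuous fun t => D.outer n i k x t c := fun k x =>
    (continuous_apply c).comp (D.continuous_outer_time n i k x)
  -- the increment is the first term of the scheme
  have hinc : D.increment n i c = ∑ ℓ ∈ idx2 N, (∫ x in (D.mesh.poly i).region,
      (D.mesh.poly i).basis (0, 0) x * (D.mesh.poly i).basis ℓ x) *
      (D.solCoef (n + 1) i ℓ c - D.solCoef n i ℓ c) := by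
    simp only [Polygon.basis_zero, one_mul, Discretization.increment, ← integral_mul_const]
    rw [← integral_finsetSum _ fun ℓ hℓ => ((D.mesh.poly i).integrableOn_region
      (polySpace_continuous ((D.mesh.poly i).basis_mem_polySpace (mem_idx2 hℓ)))).mul_const _]
    refine integral_congr_ae (Eventually.of_forall fun x => ?_)
    simp only [Discretization.sol, ← Finset.sum_sub_distrib, mul_sub]
  have hs := H.scheme (0, 0) (zero_mem_idx2 N) c
  rw [← hinc] at hs
  simp only [Polygon.basis_zero, one_mul] at hs
  -- the fluctuations
  set g₁ : ℝ → ℝ := fun t => D.bdryQuad i (fun k x =>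
    min (u₀ * ((D.mesh.poly i).normal k).1 + v₀ * ((D.mesh.poly i).normal k).2) 0 *
      (D.outer n i k x t c - D.pred n i x t c)) with hg₁
  set g₂ : ℝ → ℝ := fun t => D.bdryQuad i (fun k x =>
    (u₀ * ((D.mesh.poly i).normal k).1 + v₀ * ((D.mesh.poly i).normal k).2) *
      D.pred n i x t c) with hg₂
  have hg₁c : Continuous g₁ := continuous_bdryQuad fun k x => by
    have h1 := hpc x
    have h2 := hoc k x
    fun_prop
  have hg₂c : Continuous g₂ := continuous_bdryQuad fun k x => by
    have h1 := hpc x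
    fun_prop
  have k₁ := abs_intervalIntegral_sub_le (c := (D.mesh.poly i).perimeter * A) hab
    (f := fun t => D.bdryQuad i (fun k x =>
      fluctuation γ eos ((D.mesh.poly i).normal k) (D.pred n i x t) (D.outer n i k x t) c)) (g := g₁)
    (by
      -- the explicit form of the fluctuation shows its measurability in time
      have hm : Measurable fun t => D.bdryQuad i (fun k x =>
          ∑ b, (∫ s in (0 : ℝ)..1, r ((D.mesh.poly i).normal k)
            (path (D.pred n i x t) (D.outer n i k x t) s) b) *
            (D.outer n i k x t b - D.pred n i x t b)) := by
        refine measurable_bdryQuad fun k x => Finset.measurable_fun_sum _ fun b _ => ?_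
        have h1 := (D.continuous_pred_time n i x).measurable
        have h2 := (D.continuous_outer_time n i k x).measurable
        refine Measurable.mul ?_ (by fun_prop)
        exact (measurable_integral_path (hr ((D.mesh.poly i).normal k) b)).comp (h1.prodMk h2)
      refine hm.aestronglyMeasurable.congr ((ae_restrict_iff' measurableSet_Ioc).2
        (Eventually.of_forall fun t ht => bdryQuad_congr H.edge_quad fun k s hs => ?_))
      have ht' : t ∈ Set.Icc (D.time n) (D.time (n + 1)) := ⟨ht.1.le, ht.2⟩
      exact (hrep _ _ _ ((D.mesh.poly i).isUnitVec_normal k)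
        ((H.near.1 _ ((D.mesh.poly i).edgePoint_mem_region k hs)).2.2 t ht')
        (H.near.2 k s hs t ht')).symm)
    hg₁c
    (fun t ht => by
      rw [hg₁, ← bdryQuad_sub]
      refine abs_bdryQuad_le H.edge_quad fun k s hs => ?_
      exact hA _ _ _ ((D.mesh.poly i).isUnitVec_normal k)
        ((H.near.1 _ ((D.mesh.poly i).edgePoint_mem_region k hs)).2.2 t ht) (H.near.2 k s hs t ht))
  -- the volume term, converted by the discrete divergence theorem
  have k₂ := abs_intervalIntegral_sub_le (c := (D.mesh.poly i).area * B) hab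
    (f := fun t => (D.cellRule i).eval (fun x => D.nonCons γ eos n i x t c)) (g := g₂)
    (by
      refine Continuous.aestronglyMeasurable ?_
      unfold QuadRule.eval
      fun_prop)
    hg₂c
    (fun t ht => by
      rw [hg₂]
      simp only
      rw [← eval_grad_eq_bdryQuad H.cell_quad H.edge_quad (D.pred_mem_polySpace n i t c) u₀ v₀,
        ← QuadRule.eval_sub]
      have := (D.cellRule i).abs_eval_le H.cell_quad.weight_nonneg
        (f := fun x => D.nonCons γ eos n i x t c - (u₀ * dx (fun y => D.pred n i y t c) x +
          v₀ * dy (fun y => D.pred n i y t c) x)) (e := B)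
        fun a => hB _ (H.cell_quad.node_mem a) t ht
      rwa [H.cell_quad.sum_weight] at this)
  have hY : D.upwindBalance n i u₀ v₀ c = (∫ t in (D.time n)..(D.time (n + 1)), g₁ t) +
      ∫ t in (D.time n)..(D.time (n + 1)), g₂ t := by
    rw [← intervalIntegral.integral_add (hg₁c.intervalIntegrable _ _)
      (hg₂c.intervalIntegrable _ _), Discretization.upwindBalance]
    refine intervalIntegral.integral_congr fun t _ => ?_
    simp only [hg₁, hg₂, ← bdryQuad_add]
    congr 1
    ext k x
    have := max_add_min (u₀ * ((D.mesh.poly i).normal k).1 + v₀ * ((D.mesh.poly i).normal k).2) 0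
    rw [add_zero] at this
    linear_combination D.pred n i x t c * this
  rw [hY, add_mul, Discretization.dt]
  rw [abs_le] at *
  constructor <;> linarith [k₁.1, k₁.2, k₂.1, k₂.2]

end CellContact

end Discretization

/-! ### The conservation defect of one cell -/

theorem measurable_consVar (γ : ℝ) (eos : EOS) (c : Fin 5) :
    Measurable fun V => consVar γ eos V c := by
  fin_cases c <;> simp only [consVar, totalEnergy, kinetic] <;> simp <;> fun_prop

theorem measurable_upwindFlux (γ : ℝ) (eos : EOS) (n : Pt) (c : Fin 5) {V W : ℝ → State}
    (hV : Measurable V) (hW : Measurable W) :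
    Measurable fun t => upwindFlux γ eos n (V t) (W t) c := by
  have h1 := measurable_consVar γ eos c
  have h2 := (continuous_normalVel n).measurable
  have h3 : Measurable fun t =>
      (![0, n.1, n.2, (normalVel (V t) n + normalVel (W t) n) / 2, 0] : State) c := by
    fin_cases c <;> simp; all_goals fun_prop
  unfold upwindFlux
  fun_prop

namespace Discretization.CellContact

variable {N : ℕ} {D : Discretization N} {γ : ℝ} {eos : EOS}
  {χ₁ χ₂ M σ e u₀ v₀ p₀ α β : ℝ} {n : ℕ} {i : D.mesh.Cell}

theorem abs_increment_density (H : D.CellContact γ eos χ₁ χ₂ M σ e u₀ v₀ p₀ α β n i) {K : ℝ}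
    (hK : IsInverseConstant N (2 / σ ^ 2) K) :
    |D.increment n i 0 + D.upwindBalance n i u₀ v₀ 0| ≤
      ((D.mesh.poly i).perimeter * (10 * M * e) +
        (D.mesh.poly i).area * (4 * K * M / σ * (e / D.h))) * D.dt n := by
  refine H.abs_increment_add_le (fun m b => measurable_densityRow γ eos m b)
    (fun m V W hm hV hW =>
      fluctuation_density H.one_lt H.lam₁ H.lam₂ H.M_pos H.le_p H.e_le hm hV hW)
    (fun m V W hm hV hW =>
      abs_fluctuation_density_sub H.one_lt H.lam₁ H.lam₂ H.M_pos H.le_p H.e_le hm hV hW)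
    (fun x => ?_) (fun x hx t ht => H.abs_nonCons_density_sub hK hx ht)
  simp only [D.nonCons_density]
  have h1 := D.continuous_pred_time n i x
  have h2 := D.continuous_dx_pred_time n i x
  have h3 := D.continuous_dy_pred_time n i x
  have h4 : ∀ c, Continuous fun t => D.pred n i x t c := fun c => (continuous_apply c).comp h1
  exact (((h4 1).mul (h2 0)).add ((h4 0).mul (h2 1))).add
    (((h4 2).mul (h3 0)).add ((h4 0).mul (h3 2)))

theorem abs_increment_marker (H : D.CellContact γ eos χ₁ χ₂ M σ e u₀ v₀ p₀ α β n i) {K : ℝ}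
    (hK : IsInverseConstant N (2 / σ ^ 2) K) :
    |D.increment n i 4 + D.upwindBalance n i u₀ v₀ 4| ≤
      ((D.mesh.poly i).perimeter * (2 * |χ₂ - χ₁| * e) +
        (D.mesh.poly i).area * (2 * K * |χ₂ - χ₁| / σ * (e / D.h))) * D.dt n := by
  refine H.abs_increment_add_le (r := markerRow) (fun m b => measurable_markerRow m b)
    (fun m V W hm hV hW =>
      fluctuation_marker H.one_lt H.lam₁ H.lam₂ H.M_pos H.le_p H.e_le hm hV hW)
    (fun m V W hm hV hW =>
      abs_fluctuation_marker_sub H.one_lt H.lam₁ H.lam₂ H.M_pos H.le_p H.e_le hm hV hW)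
    (fun x => ?_) (fun x hx t ht => H.abs_nonCons_marker_sub hK hx ht)
  simp only [D.nonCons_marker]
  have h4 : ∀ c, Continuous fun t => D.pred n i x t c := fun c =>
    (continuous_apply c).comp (D.continuous_pred_time n i x)
  exact ((h4 1).mul (D.continuous_dx_pred_time n i x 4)).add
    ((h4 2).mul (D.continuous_dy_pred_time n i x 4))

theorem e_le_half (H : D.CellContact γ eos χ₁ χ₂ M σ e u₀ v₀ p₀ α β n i) : e ≤ 1 / 2 := by
  refine H.e_le.trans ?_
  have := H.one_le_M
  exact one_div_le_one_div_of_le two_pos (by linarith)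

theorem abs_p_le (H : D.CellContact γ eos χ₁ χ₂ M σ e u₀ v₀ p₀ α β n i) : |p₀| ≤ M := by
  have := one_div_pos.2 H.M_pos
  rw [abs_of_pos (this.trans_le H.le_p)]
  exact H.p_le

/-- The boundary fluxes of the conserved variables reduce to the upwind balances of the density and
the marker: the constant terms do not contribute, by `bdryQuad_normal`. -/
theorem abs_flux_sub_le (H : D.CellContact γ eos χ₁ χ₂ M σ e u₀ v₀ p₀ α β n i) {Λ : ℝ}
    (hΛ : ∀ χ ∈ Set.uIcc χ₁ χ₂, |lam γ eos χ| ≤ Λ) {c : Fin 5} (hc : c ≠ 4) :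
    |(∫ t in (D.time n)..(D.time (n + 1)), D.bdryQuad i (fun k x =>
        upwindFlux γ eos ((D.mesh.poly i).normal k) (D.pred n i x t) (D.outer n i k x t) c)) -
      (densCoef u₀ v₀ c * D.upwindBalance n i u₀ v₀ 0 +
        markCoef β p₀ c * D.upwindBalance n i u₀ v₀ 4)| ≤
      (D.mesh.poly i).perimeter * ((4 * (2 * Λ * M + 4 * M ^ 3 + 2 * M ^ 2 + M) +
        4 * M * (Λ + 4 * M ^ 2) + 6 * M) * e) * D.dt n := by
  set un : Fin ((D.mesh.poly i).m + 3) → ℝ := fun k =>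
    u₀ * ((D.mesh.poly i).normal k).1 + v₀ * ((D.mesh.poly i).normal k).2 with hun
  set y : Fin 5 → ℝ → ℝ := fun b t => D.bdryQuad i (fun k x =>
    max (un k) 0 * D.pred n i x t b + min (un k) 0 * D.outer n i k x t b) with hy
  have hpc : ∀ x b, Continuous fun t => D.pred n i x t b := fun x b =>
    (continuous_apply b).comp (D.continuous_pred_time n i x)
  have hoc : ∀ k x b, Continuous fun t => D.outer n i k x t b := fun k x b =>
    (continuous_apply b).comp (D.continuous_outer_time n i k x)
  have hyc : ∀ b, Continuous (y b) := fun b => continuous_bdryQuad fun k x => by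
    have h1 := hpc x b
    have h2 := hoc k x b
    fun_prop
  have hconst : ∃ a b : ℝ, ∀ m : Pt, constCoef α p₀ c * (u₀ * m.1 + v₀ * m.2) +
      pressureCoef u₀ v₀ p₀ m c = a * m.1 + b * m.2 := by
    fin_cases c
    · exact ⟨0, 0, fun m => by simp [constCoef, pressureCoef]⟩
    · exact ⟨p₀, 0, fun m => by simp [constCoef, pressureCoef]⟩
    · exact ⟨0, p₀, fun m => by simp [constCoef, pressureCoef]⟩
    · exact ⟨(α * p₀ + p₀) * u₀, (α * p₀ + p₀) * v₀, fun m => by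
        simp [constCoef, pressureCoef]; ring⟩
    · exact absurd rfl hc
  obtain ⟨a, b, hab⟩ := hconst
  have hg : ∀ t, densCoef u₀ v₀ c * y 0 t + markCoef β p₀ c * y 4 t =
      D.bdryQuad i (fun k x =>
        max (un k) 0 * contactCons u₀ v₀ p₀ α β c (D.pred n i x t) +
          min (un k) 0 * contactCons u₀ v₀ p₀ α β c (D.outer n i k x t) +
          pressureCoef u₀ v₀ p₀ ((D.mesh.poly i).normal k) c) := by
    intro t
    have hz := bdryQuad_normal (i := i) H.edge_quad a b
    have hsum : densCoef u₀ v₀ c * y 0 t + markCoef β p₀ c * y 4 t =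
        densCoef u₀ v₀ c * y 0 t + markCoef β p₀ c * y 4 t + D.bdryQuad i (fun k _ =>
          a * ((D.mesh.poly i).normal k).1 + b * ((D.mesh.poly i).normal k).2) := by
      rw [hz, add_zero]
    rw [hsum, hy]
    simp only [← bdryQuad_const_mul, ← bdryQuad_add]
    congr 1
    ext k x
    rw [← hab]
    have := max_add_min (un k) 0
    rw [add_zero] at this
    change _ + (constCoef α p₀ c * un k + _) = _
    simp only [contactCons]
    linear_combination -constCoef α p₀ c * this
  have hmeas : ∀ k x, Measurable fun t =>
      upwindFlux γ eos ((D.mesh.poly i).normal k) (D.pred n i x t) (D.outer n i k x t) c :=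
    fun k x => measurable_upwindFlux γ eos _ c (D.continuous_pred_time n i x).measurable
      (D.continuous_outer_time n i k x).measurable
  have hgc : Continuous fun t => densCoef u₀ v₀ c * y 0 t + markCoef β p₀ c * y 4 t := by
    have h0 := hyc 0
    have h4 := hyc 4
    fun_prop
  have hdiff : ∀ t ∈ Set.Icc (D.time n) (D.time (n + 1)),
      |D.bdryQuad i (fun k x =>
        upwindFlux γ eos ((D.mesh.poly i).normal k) (D.pred n i x t) (D.outer n i k x t) c) -
        (densCoef u₀ v₀ c * y 0 t + markCoef β p₀ c * y 4 t)| ≤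
      (D.mesh.poly i).perimeter * ((4 * (2 * Λ * M + 4 * M ^ 3 + 2 * M ^ 2 + M) +
        4 * M * (Λ + 4 * M ^ 2) + 6 * M) * e) := by
    intro t ht
    rw [hg, ← bdryQuad_sub]
    refine abs_bdryQuad_le H.edge_quad fun k s hs => ?_
    have hx := (D.mesh.poly i).edgePoint_mem_region k hs
    have hV := (H.near.1 _ hx).2.2 t ht
    have hW := H.near.2 k s hs t ht
    exact upwindFlux_near H.one_le_M H.e_le_half H.abs_u H.abs_v H.abs_p_le hV
      (hΛ _ hV.2.2.2.2.2) ((H.linked.1 _ hx).2.2 t ht) hW (hΛ _ hW.2.2.2.2.2)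
      (H.linked.2 k s hs t ht) ((D.mesh.poly i).isUnitVec_normal k) hc
  have hmain := abs_intervalIntegral_sub_le H.time_le
    (measurable_bdryQuad hmeas).aestronglyMeasurable hgc hdiff
  rw [intervalIntegral.integral_add (((hyc 0).const_mul _).intervalIntegrable _ _)
    (((hyc 4).const_mul _).intervalIntegrable _ _), intervalIntegral.integral_const_mul,
    intervalIntegral.integral_const_mul] at hmain
  exact hmain

/-- The increments of the conserved variables reduce to those of the density and the marker. -/
theorem abs_cons_sub_le (H : D.CellContact γ eos χ₁ χ₂ M σ e u₀ v₀ p₀ α β n i) {Λ : ℝ}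
    (hΛ : ∀ χ ∈ Set.uIcc χ₁ χ₂, |lam γ eos χ| ≤ Λ) {c : Fin 5} (hc : c ≠ 4) :
    |(∫ x in (D.mesh.poly i).region, consVar γ eos (D.sol (n + 1) i x) c) -
      (∫ x in (D.mesh.poly i).region, consVar γ eos (D.sol n i x) c) -
      (densCoef u₀ v₀ c * D.increment n i 0 + markCoef β p₀ c * D.increment n i 4)| ≤
      2 * ((Λ + 4 * M ^ 2) * e * (D.mesh.poly i).area) := by
  have hsc : ∀ m b, Continuous fun x => D.sol m i x b := fun m b =>
    (continuous_apply b).comp (D.continuous_sol m i)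
  have hl : ∀ m, Continuous fun x => contactCons u₀ v₀ p₀ α β c (D.sol m i x) := fun m => by
    have h0 := hsc m 0
    have h4 := hsc m 4
    unfold contactCons
    fun_prop
  have hm : ∀ m, (∀ x ∈ (D.mesh.poly i).region, NearContact χ₁ χ₂ M e u₀ v₀ p₀ (D.sol m i x) ∧
      |lam γ eos (D.sol m i x 4) - (α + β * D.sol m i x 4)| ≤ e) →
      |(∫ x in (D.mesh.poly i).region, consVar γ eos (D.sol m i x) c) -
        ∫ x in (D.mesh.poly i).region, contactCons u₀ v₀ p₀ α β c (D.sol m i x)| ≤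
        (Λ + 4 * M ^ 2) * e * (D.mesh.poly i).area := fun m hx =>
    (D.mesh.poly i).abs_integral_region_sub_le
      ((measurable_consVar γ eos c).comp (D.continuous_sol m i).measurable) (hl m)
      fun x hxr => (consVar_near H.one_le_M H.e_le_half H.abs_u H.abs_v H.abs_p_le (hx x hxr).1
        (hΛ _ (hx x hxr).1.2.2.2.2.2) (hx x hxr).2 hc).2
  have h0 := hm n fun x hx => ⟨(H.near.1 x hx).1, (H.linked.1 x hx).1⟩
  have h1 := hm (n + 1) fun x hx => ⟨(H.near.1 x hx).2.1, (H.linked.1 x hx).2.1⟩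
  have hi : ∀ b, IntegrableOn (fun x => D.sol (n + 1) i x b - D.sol n i x b)
      (D.mesh.poly i).region := fun b =>
    (D.mesh.poly i).integrableOn_region ((hsc (n + 1) b).sub (hsc n b))
  have hlin : (∫ x in (D.mesh.poly i).region, contactCons u₀ v₀ p₀ α β c (D.sol (n + 1) i x)) -
      (∫ x in (D.mesh.poly i).region, contactCons u₀ v₀ p₀ α β c (D.sol n i x)) =
      densCoef u₀ v₀ c * D.increment n i 0 + markCoef β p₀ c * D.increment n i 4 := by
    rw [← integral_sub ((D.mesh.poly i).integrableOn_region (hl _))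
      ((D.mesh.poly i).integrableOn_region (hl _)), Discretization.increment,
      Discretization.increment, ← integral_const_mul, ← integral_const_mul,
      ← integral_add ((hi 0).const_mul _) ((hi 4).const_mul _)]
    refine integral_congr_ae (Eventually.of_forall fun x => ?_)
    simp only [contactCons]
    ring
  rw [← hlin]
  rw [abs_le] at *
  constructor <;> linarith [h0.1, h0.2, h1.1, h1.2]

/-- The conservation defect of one cell is at most a constant multiple of `e / h`. -/
theorem abs_defect_le (H : D.CellContact γ eos χ₁ χ₂ M σ e u₀ v₀ p₀ α β n i) {K : ℝ}
    (hK : IsInverseConstant N (2 / σ ^ 2) K)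
    {Λ : ℝ} (hΛ : ∀ χ ∈ Set.uIcc χ₁ χ₂, |lam γ eos χ| ≤ Λ) {B : ℝ} (hβ : |β| ≤ B)
    {c : Fin 5} (hc : c ≠ 4) :
    |D.defect γ eos (upwindFlux γ eos) n i c| ≤
      (2 * (Λ + 4 * M ^ 2) / σ +
        (4 * (2 * Λ * M + 4 * M ^ 3 + 2 * M ^ 2 + M) + 4 * M * (Λ + 4 * M ^ 2) + 6 * M) / σ ^ 3 +
        (1 + M + M ^ 2) * (10 * M / σ ^ 3 + 4 * K * M / σ) +
        B * M * (2 * |χ₂ - χ₁| / σ ^ 3 + 2 * K * |χ₂ - χ₁| / σ)) * (e / D.h) := by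
  have hσ := H.σ_pos
  have hh := H.h_pos
  have hM := H.M_pos
  have he := H.e_nonneg
  have hdt := H.dt_pos
  have har := H.area_pos
  have hK0 := hK.1
  have hB : 0 ≤ B := (abs_nonneg _).trans hβ
  have hΛ0 : 0 ≤ Λ := (abs_nonneg _).trans (hΛ χ₁ Set.left_mem_uIcc)
  have hcons := H.abs_cons_sub_le hΛ hc
  have hflux := H.abs_flux_sub_le hΛ hc
  have hdens := H.abs_increment_density hK
  have hmark := H.abs_increment_marker hK
  have cdens : |densCoef u₀ v₀ c| ≤ 1 + M + M ^ 2 := by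
    have h2 := sq_nonneg M
    have hu := sq_le_sq' (abs_le.1 H.abs_u).1 (abs_le.1 H.abs_u).2
    have hv := sq_le_sq' (abs_le.1 H.abs_v).1 (abs_le.1 H.abs_v).2
    fin_cases c
    · change |(1 : ℝ)| ≤ _
      rw [abs_one]; linarith
    · change |u₀| ≤ _
      linarith [H.abs_u]
    · change |v₀| ≤ _
      linarith [H.abs_v]
    · change |u₀ ^ 2 / 2 + v₀ ^ 2 / 2| ≤ _
      rw [abs_of_nonneg (by positivity)]; linarith
    · exact absurd rfl hc
  have cmark : |markCoef β p₀ c| ≤ B * M := by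
    have h0 : |(0 : ℝ)| ≤ B * M := by rw [abs_zero]; positivity
    fin_cases c
    · exact h0
    · exact h0
    · exact h0
    · change |β * p₀| ≤ _
      rw [abs_mul]
      exact mul_le_mul hβ H.abs_p_le (abs_nonneg _) hB
    · exact h0
  set P := (D.mesh.poly i).perimeter
  set a := (D.mesh.poly i).area with ha
  set τ := D.dt n with hτ
  set q := e / D.h with hq
  have hq0 : 0 ≤ q := by positivity
  have hqe : e = q * D.h := by rw [hq]; field_simp
  -- the two scalings: `h ≲ Δt`, and the perimeter is `≲ |ω| / h`
  have f1 : e * a ≤ q * a * τ / σ := by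
    rw [le_div_iff₀ hσ, hqe]
    have := mul_le_mul_of_nonneg_left H.dt_le (mul_nonneg hq0 har.le)
    linarith
  have f2 : P * e ≤ q * a / σ ^ 3 := by
    calc P * e ≤ D.h / σ * e := mul_le_mul_of_nonneg_right H.perim he
      _ = q * (σ * D.h) ^ 2 / σ ^ 3 := by rw [hqe]; field_simp
      _ ≤ q * a / σ ^ 3 := by gcongr; exact H.sq_le_area
  set I := (∫ x in (D.mesh.poly i).region, consVar γ eos (D.sol (n + 1) i x) c) with hI
  set J := (∫ x in (D.mesh.poly i).region, consVar γ eos (D.sol n i x) c) with hJ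
  set Φ := ∫ t in (D.time n)..(D.time (n + 1)), D.bdryQuad i (fun k x =>
    upwindFlux γ eos ((D.mesh.poly i).normal k) (D.pred n i x t) (D.outer n i k x t) c) with hΦ
  have hdef : D.defect γ eos (upwindFlux γ eos) n i c = (I - J + Φ) / (a * τ) := by
    simp only [Discretization.defect, Discretization.consAverage, Discretization.fluxBalance,
      ← hI, ← hJ, ← hΦ, ← ha, ← hτ]
    field_simp
  rw [hdef, abs_div, abs_of_pos (mul_pos har hdt), div_le_iff₀ (mul_pos har hdt)]
  set cd := densCoef u₀ v₀ c
  set cm := markCoef β p₀ c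
  set δ := |χ₂ - χ₁| with hδ
  have hδ0 : 0 ≤ δ := abs_nonneg _
  have esplit : I - J + Φ = (I - J - (cd * D.increment n i 0 + cm * D.increment n i 4)) +
      (Φ - (cd * D.upwindBalance n i u₀ v₀ 0 + cm * D.upwindBalance n i u₀ v₀ 4)) +
      (cd * (D.increment n i 0 + D.upwindBalance n i u₀ v₀ 0) +
        cm * (D.increment n i 4 + D.upwindBalance n i u₀ v₀ 4)) := by ring
  rw [esplit]
  refine (abs_add_three _ _ _).trans ?_
  have t1 : 2 * ((Λ + 4 * M ^ 2) * e * a) ≤ 2 * (Λ + 4 * M ^ 2) / σ * q * (a * τ) := by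
    calc 2 * ((Λ + 4 * M ^ 2) * e * a) = 2 * (Λ + 4 * M ^ 2) * (e * a) := by ring
      _ ≤ 2 * (Λ + 4 * M ^ 2) * (q * a * τ / σ) := by gcongr
      _ = _ := by ring
  have t2 : P * ((4 * (2 * Λ * M + 4 * M ^ 3 + 2 * M ^ 2 + M) + 4 * M * (Λ + 4 * M ^ 2) + 6 * M) *
      e) * τ ≤ (4 * (2 * Λ * M + 4 * M ^ 3 + 2 * M ^ 2 + M) + 4 * M * (Λ + 4 * M ^ 2) + 6 * M) /
        σ ^ 3 * q * (a * τ) := by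
    have hκ : 0 ≤ 4 * (2 * Λ * M + 4 * M ^ 3 + 2 * M ^ 2 + M) + 4 * M * (Λ + 4 * M ^ 2) +
      6 * M := by positivity
    generalize 4 * (2 * Λ * M + 4 * M ^ 3 + 2 * M ^ 2 + M) + 4 * M * (Λ + 4 * M ^ 2) +
      6 * M = κ at *
    calc P * (κ * e) * τ = κ * (P * e) * τ := by ring
      _ ≤ κ * (q * a / σ ^ 3) * τ := by gcongr
      _ = _ := by ring
  have t3 : |cd * (D.increment n i 0 + D.upwindBalance n i u₀ v₀ 0)| ≤
      (1 + M + M ^ 2) * (10 * M / σ ^ 3 + 4 * K * M / σ) * q * (a * τ) := by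
    rw [abs_mul]
    calc _ ≤ (1 + M + M ^ 2) * ((P * (10 * M * e) + a * (4 * K * M / σ * q)) * τ) :=
          mul_le_mul cdens hdens (abs_nonneg _) (by positivity)
      _ = (1 + M + M ^ 2) * ((10 * M * (P * e) + a * (4 * K * M / σ * q)) * τ) := by ring
      _ ≤ (1 + M + M ^ 2) * ((10 * M * (q * a / σ ^ 3) + a * (4 * K * M / σ * q)) * τ) := by
          gcongr
      _ = _ := by ring
  have t4 : |cm * (D.increment n i 4 + D.upwindBalance n i u₀ v₀ 4)| ≤
      B * M * (2 * δ / σ ^ 3 + 2 * K * δ / σ) * q * (a * τ) := by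
    rw [abs_mul]
    calc _ ≤ B * M * ((P * (2 * δ * e) + a * (2 * K * δ / σ * q)) * τ) :=
          mul_le_mul cmark hmark (abs_nonneg _) (by positivity)
      _ = B * M * ((2 * δ * (P * e) + a * (2 * K * δ / σ * q)) * τ) := by ring
      _ ≤ B * M * ((2 * δ * (q * a / σ ^ 3) + a * (2 * K * δ / σ * q)) * τ) := by gcongr
      _ = _ := by ring
  have t5 := abs_add_le (cd * (D.increment n i 0 + D.upwindBalance n i u₀ v₀ 0))
    (cm * (D.increment n i 4 + D.upwindBalance n i u₀ v₀ 4))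
  linarith [hcons.trans t1, hflux.trans t2]

end Discretization.CellContact

/-! ### Passage to the limit -/

/-- Quasi-conservation holds as soon as `λ(χ)` agrees around each selected cell with an affine
function of bounded slope up to `o(h)`. -/
theorem quasiConservative_of_linked {γ : ℝ} (hγ : 1 < γ) {eos : EOS}
    {χ₁ χ₂ ε σ C M : ℝ} {N : ℕ} {D : ℕ → Discretization N}
    {S : ∀ k, Set ((D k).mesh.Cell × ℕ)} (h1 : 0 < lam γ eos χ₁) (h2 : 0 < lam γ eos χ₂)
    (hε : 0 < ε) (hσ : 0 < σ) (hM : 0 < M) (hS : ContactSetting γ eos χ₁ χ₂ ε σ C M D S)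
    {δ C' B : ℝ} (hδ : 0 < δ)
    (hl : ∀ k, ∀ s ∈ S k, ∃ α β : ℝ, |β| ≤ B ∧ (D k).HoldsOn s.2 s.1
      (fun V => |lam γ eos (V 4) - (α + β * V 4)| ≤ C' * (D k).h ^ (1 + δ))) :
    QuasiConservative γ eos (upwindFlux γ eos) D S := by
  obtain ⟨K, hK⟩ := exists_isInverseConstant N (2 / σ ^ 2)
  set e : ℕ → ℝ := fun k => |C| * (D k).h ^ (1 + ε) + |C'| * (D k).h ^ (1 + δ) with he
  have hpow : ∀ η : ℝ, 0 < η → Tendsto (fun k => (D k).h ^ η) atTop (𝓝 0) := fun η hη => by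
    have := hS.h_lim.rpow_const (p := η) (Or.inr hη.le)
    rwa [Real.zero_rpow hη.ne'] at this
  have he0 : Tendsto e atTop (𝓝 0) := by
    have := ((hpow (1 + ε) (by linarith)).const_mul |C|).add
      ((hpow (1 + δ) (by linarith)).const_mul |C'|)
    simpa using this
  have heh : Tendsto (fun k => e k / (D k).h) atTop (𝓝 0) := by
    have := ((hpow ε hε).const_mul |C|).add ((hpow δ hδ).const_mul |C'|)
    simp only [mul_zero, add_zero] at this
    refine this.congr fun k => ?_
    have hk := hS.h_pos k
    simp only [he]
    rw [Real.rpow_add hk, Real.rpow_add hk, Real.rpow_one]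
    field_simp
  set Λ := lam γ eos χ₁ + lam γ eos χ₂ with hΛdef
  have hΛ : ∀ χ ∈ Set.uIcc χ₁ χ₂, |lam γ eos χ| ≤ Λ := fun χ hχ => by
    obtain ⟨hp, hle⟩ := lam_pos_of_mem_uIcc hγ h1 h2 hχ
    rwa [abs_of_pos hp]
  set Q : ℝ := 2 * (Λ + 4 * M ^ 2) / σ +
    (4 * (2 * Λ * M + 4 * M ^ 3 + 2 * M ^ 2 + M) + 4 * M * (Λ + 4 * M ^ 2) + 6 * M) / σ ^ 3 +
    (1 + M + M ^ 2) * (10 * M / σ ^ 3 + 4 * K * M / σ) +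
    B * M * (2 * |χ₂ - χ₁| / σ ^ 3 + 2 * K * |χ₂ - χ₁| / σ) with hQ
  have hev : ∀ᶠ k in atTop, e k ≤ 1 / (2 * M) :=
    (he0.eventually (gt_mem_nhds (by positivity : (0 : ℝ) < 1 / (2 * M)))).mono fun k hk => hk.le
  have hlim : Tendsto (fun k => ENNReal.ofReal (Q * (e k / (D k).h))) atTop (𝓝 0) := by
    have := ENNReal.tendsto_ofReal (heh.const_mul Q)
    simpa using this
  refine tendsto_of_tendsto_of_tendsto_of_le_of_le' tendsto_const_nhds hlim
    (Eventually.of_forall fun k => zero_le) (hev.mono fun k hk => ?_)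
  refine iSup₂_le fun s hs => iSup_le fun c => ?_
  obtain ⟨u₀, v₀, p₀, hu, hv, hp, hp', hnear⟩ := hS.contact k s hs
  obtain ⟨α, β, hβ, hlink⟩ := hl k s hs
  have hhk := hS.h_pos k
  have le1 : C * (D k).h ^ (1 + ε) ≤ e k := by
    have := mul_le_mul_of_nonneg_right (le_abs_self C) (Real.rpow_nonneg hhk.le (1 + ε))
    have : 0 ≤ |C'| * (D k).h ^ (1 + δ) := by positivity
    simp only [he]
    linarith
  have le2 : C' * (D k).h ^ (1 + δ) ≤ e k := by
    have := mul_le_mul_of_nonneg_right (le_abs_self C') (Real.rpow_nonneg hhk.le (1 + δ))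
    have : 0 ≤ |C| * (D k).h ^ (1 + ε) := by positivity
    simp only [he]
    linarith
  have H : (D k).CellContact γ eos χ₁ χ₂ M σ (e k) u₀ v₀ p₀ α β s.2 s.1 :=
    { one_lt := hγ
      lam₁ := h1
      lam₂ := h2
      M_pos := hM
      e_le := hk
      abs_u := hu
      abs_v := hv
      le_p := hp
      p_le := hp'
      σ_pos := hσ
      h_pos := hhk
      disc := (hS.shape k s.1).1
      perim := (hS.shape k s.1).2
      dt_le := hS.step k s.2
      cell_quad := hS.cell_quad k s.1
      edge_quad := hS.edge_quad k
      scheme := hS.scheme k s hs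
      near := hnear.holdsOn.mono fun V hV => hV.mono le1
      linked := hlink.mono fun V hV => hV.trans le2 }
  rw [← ofReal_norm, Real.norm_eq_abs]
  exact ENNReal.ofReal_le_ofReal (H.abs_defect_le hK hΛ hβ (Fin.castSucc_ne_last c))

end QCons

theorem proposition5 (γ : ℝ) (hγ : 1 < γ) (eos : QCons.EOS) :
    ∃ F : QCons.NumFlux, QCons.IsNumericalFlux γ eos F ∧
      ∀ (χ₁ χ₂ ε σ C M : ℝ) (N : ℕ) (D : ℕ → QCons.Discretization N)
        (S : ∀ k, Set ((D k).mesh.Cell × ℕ)),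
        χ₁ ≠ χ₂ → 0 < QCons.lam γ eos χ₁ → 0 < QCons.lam γ eos χ₂ →
        0 < ε → 0 < σ → 0 < M →
        QCons.ContactSetting γ eos χ₁ χ₂ ε σ C M D S →
        (QCons.SingleMaterial D S → QCons.QuasiConservative γ eos F D S) ∧
        (eos = QCons.EOS.linear → QCons.QuasiConservative γ eos F D S) ∧
        (eos = QCons.EOS.ratio →
          (∃ δ C' : ℝ, 0 < δ ∧ QCons.Compatible γ χ₁ χ₂ δ C' D S) →
          QCons.QuasiConservative γ eos F D S) := by
  refine ⟨QCons.upwindFlux γ eos, QCons.isNumericalFlux_upwindFlux γ eos,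
    fun χ₁ χ₂ ε σ C M N D S _ h1 h2 hε hσ hM hS => ⟨fun hsingle => ?_, ?_, ?_⟩⟩
  · -- the marker is constant, hence so is `λ(χ)`
    refine QCons.quasiConservative_of_linked (B := 0) (C' := 0) hγ h1 h2 hε hσ hM hS one_pos
      fun k s hs => ?_
    obtain ⟨χ₀, hχ₀⟩ := hsingle k s hs
    refine ⟨QCons.lam γ eos χ₀, 0, by simp, hχ₀.holdsOn.mono fun V hV => ?_⟩
    simp [hV]
  · -- `λ(χ)` is linear in the marker
    rintro rfl
    refine QCons.quasiConservative_of_linked (B := |1 / (γ - 1)|) (C' := 0) hγ h1 h2 hε hσ hM hS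
      one_pos fun k s hs => ?_
    obtain ⟨u₀, v₀, p₀, -, -, -, -, hnear⟩ := hS.contact k s hs
    refine ⟨0, 1 / (γ - 1), le_rfl, hnear.holdsOn.mono fun V _ => ?_⟩
    simp [QCons.lam, div_eq_inv_mul]
  · -- `ϱ(χ) / (γ - 1)` is affine in the marker
    rintro rfl ⟨δ, C', hδ, hcomp⟩
    set b := (1 / (γ * χ₂ - 1) - 1 / (γ * χ₁ - 1)) / (χ₂ - χ₁) with hb
    refine QCons.quasiConservative_of_linked (B := |b|) (C' := C') hγ h1 h2 hε hσ hM hS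
      hδ fun k s hs => ?_
    refine ⟨1 / (γ * χ₁ - 1) - b * χ₁, b, le_rfl, (hcomp k s hs).holdsOn.mono fun V hV => ?_⟩
    have hg : γ - 1 ≠ 0 := by linarith
    have e : QCons.linkMap γ χ₁ χ₂ (V 4) / (γ - 1) = 1 / (γ * χ₁ - 1) - b * χ₁ + b * V 4 := by
      rw [div_eq_iff hg, QCons.linkMap, hb]
      ring
    rw [e] at hV
    simpa only [QCons.lam, mul_comm (V 4) γ] using hV
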